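/- Let $\mathcal G$ be a compact Lie algebra, i.e. a finite-dimensional real Lie algebra with a positive definite inner product $(\cdot,\cdot)$ satisfying $(X,[Y,Z])=-([Y,X],Z)$, and let $|\cdot|$ be the induced norm. For a gauge potential $A=(A_1,A_2,A_3)$, $A_k:\mathbb R^3\to\mathcal G$, put (all derivatives being weak derivatives) $$\nabla_k=\partial_k+[A_k,\cdot\,],\qquad \Delta(A)=\sum_{k=1}^3\nabla_k^2,\qquad G_{kl}=\partial_lA_k-\partial_kA_l-[A_k,A_l],\qquad (\nabla\cdot G)_k=\sum_{j=1}^3\nabla_jG_{jk}.$$ For a $\mathcal G$-valued tensor $X$ let $|\nabla^pX|$ be the square root of the sum of $|\nabla_{k_1}\cdots\nabla_{k_p}X_{i_1\cdots i_r}|^2$ over all indices, and write $\|\cdot\|_p$ for the norm of $L^p(\mathbb R^3)$. Fix $0<\sigma\le1$, let $w(x)=(1+|x|^2)^{1/2}$, and for $m\ge1$ let $$\|\Phi\|_{m,2}=\Bigl(\sum_{p=1}^m\int_{\mathbb R^3} w^{(2p-3)(1-\sigma)}|\nabla^p\Phi|^2\,d^3x\Bigr)^{1/2}.$$ Let $n\ge2$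 be an integer. The local assumptions of order $n$ on $A$ are the following, for all $k,l$: - if $n=2$: $A_k\in C(\mathbb R^3,\mathcal G)$, $\partial^1A_k\in L^3_{loc}$, $\partial^2A_k\in L^1_{loc}$, $G_{kl}\in C(\mathbb R^3,\mathcal G)$; - if $n\ge3$: $A_k\in C^{n-3}(\mathbb R^3,\mathcal G)$, $\partial^{n-2}A_k\in L^q_{loc}$ for some $q>3$, $\partial^{n-1}A_k\in L^2_{loc}$, $G_{kl}\in C^{n-3}(\mathbb R^3,\mathcal G)$. Here $\partial^mA_k$ denotes the collection of all weak partial derivatives of order $m$, and membership of $G_{kl}$ in $C^m$ means equality almost everywhere with a $C^m$ mapping. **Proposition 3.1.** Let $p_n=0$ if $n=2$ and $p_n=n-3$ if $n\ge3$. There is a function $C$ with finite non-negative values, depending only on $n$, $\sigma$ and $\mathcal G$ (with its inner product), such that for every $A$ satisfying the local assumptions of order $n$ for which the norms $$a_p=\|w^{(p+2)(1-\sigma)}\nabla^pG\|_\infty,\qquad b_p=\|w^{(p+2)(1-\sigma)}\nabla^p(\nabla\cdot G)\|_3,\qquad p=0,\dots,p_n,$$ are finite, the inequality $$\|\Phi\|_{n,2}\le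 C(a_0,\dots,a_{p_n},b_0,\dots,b_{p_n})\Bigl(\|\Phi\|_{n-1,2}+\|w^{(n-3/2)(1-\sigma)}\nabla^{n-2}\Delta(A)\Phi\|_2\Bigr)$$ holds for all $\Phi\in C^{n+1}_c(\mathbb R^3,\mathcal G)$. -/

import Mathlib

open MeasureTheory
open scoped ContDiff ENNReal NNReal

noncomputable section

namespace CovariantPoisson

/-- A Lie ring whose additive group is normed (the two additive structures coincide). -/
class NormedLieRing (𝔤 : Type*) extends NormedAddCommGroup 𝔤, LieRing 𝔤

/-- A compact real Lie algebra: a finite-dimensional real Lie algebra with a positive definite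
inner product that is invariant under the adjoint action. -/
class CompactLieAlgebra (𝔤 : Type*) [NormedLieRing 𝔤] extends
    InnerProductSpace ℝ 𝔤, LieAlgebra ℝ 𝔤 where
  finiteDimensional : FiniteDimensional ℝ 𝔤
  inner_lie : ∀ X Y Z : 𝔤, inner X ⁅Y, Z⁆ = - inner ⁅Y, X⁆ Z

/-- Euclidean three-space. -/
abbrev R3 : Type := EuclideanSpace ℝ (Fin 3)

/-- The weight `w(x) = (1 + |x|²)^{1/2}`. -/
def w (x : R3) : ℝ := (1 + ‖x‖ ^ 2) ^ (1 / 2 : ℝ)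

/-- The classical partial derivative `∂_k φ` of a real function. -/
def partialDeriv (k : Fin 3) (φ : R3 → ℝ) : R3 → ℝ :=
  fun x => fderiv ℝ φ x (EuclideanSpace.single k 1)

/-- The classical iterated partial derivative `∂_{k₁} ⋯ ∂_{kₘ} φ` for `α = [k₁, …, kₘ]`. -/
def iterPartialDeriv (α : List (Fin 3)) (φ : R3 → ℝ) : R3 → ℝ :=
  α.foldr partialDeriv φ

section Weak

variable {V : Type*} [NormedAddCommGroup V] [NormedSpace ℝ V]

/-- `g` is the weak derivative `∂^α f` (both locally integrable), tested against
`C_c^∞(ℝ³)`. -/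
structure HasWeakDeriv (α : List (Fin 3)) (f g : R3 → V) : Prop where
  locallyIntegrable_left : LocallyIntegrable f
  locallyIntegrable_right : LocallyIntegrable g
  integral_eq : ∀ φ : R3 → ℝ, ContDiff ℝ ∞ φ → HasCompactSupport φ →
    ∫ x, iterPartialDeriv α φ x • f x = (-1 : ℝ) ^ α.length • ∫ x, φ x • g x

/-- Weak derivatives are unique up to null sets. -/
theorem HasWeakDeriv.ae_eq [CompleteSpace V] {α : List (Fin 3)} {f g₁ g₂ : R3 → V}
    (h₁ : HasWeakDeriv α f g₁) (h₂ : HasWeakDeriv α f g₂) : g₁ =ᵐ[volume] g₂ := by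
  refine ae_eq_of_integral_contDiff_smul_eq h₁.locallyIntegrable_right
    h₂.locallyIntegrable_right fun φ hφ hc => ?_
  have h := (h₁.integral_eq φ hφ hc).symm.trans (h₂.integral_eq φ hφ hc)
  exact smul_right_injective V (pow_ne_zero _ (by norm_num : (-1 : ℝ) ≠ 0)) h

open Classical in
/-- The weak partial derivative `∂_k f`, a representative of its almost-everywhere class
(and `0` if there is no weak partial derivative). -/
def weakPartial (k : Fin 3) (f : R3 → V) : R3 → V :=
  if h : ∃ g, HasWeakDeriv [k] f g then h.choose else 0

/-- `f ∈ L^p_loc(ℝ³)`. -/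
def MemLpLoc (f : R3 → V) (p : ℝ≥0∞) : Prop :=
  ∀ K : Set R3, IsCompact K → MemLp f p (volume.restrict K)

/-- `∂^m f ∈ L^p_loc(ℝ³)`: all weak partial derivatives of order `m` exist and lie in
`L^p_loc`. -/
def WeakDerivsMemLpLoc (m : ℕ) (f : R3 → V) (p : ℝ≥0∞) : Prop :=
  ∀ α : List (Fin 3), α.length = m → ∃ g, HasWeakDeriv α f g ∧ MemLpLoc g p

/-- The almost-everywhere class of `f` has a representative of class `C^m`. -/
def AEContDiff (m : ℕ) (f : R3 → V) : Prop :=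
  ∃ g : R3 → V, ContDiff ℝ m g ∧ f =ᵐ[volume] g

end Weak

variable {𝔤 : Type*} [NormedLieRing 𝔤] [CompactLieAlgebra 𝔤]

/-- The covariant derivative `∇_k X = ∂_k X + [A_k, X]`. -/
def covDeriv (A : Fin 3 → R3 → 𝔤) (k : Fin 3) (X : R3 → 𝔤) : R3 → 𝔤 :=
  fun x => weakPartial k X x + ⁅A k x, X x⁆

/-- `∇_{k₁} ⋯ ∇_{kₚ} X` for `α = (k₁, …, kₚ)`. -/
def iterCovDeriv (A : Fin 3 → R3 → 𝔤) {p : ℕ} (α : Fin p → Fin 3) (X : R3 → 𝔤) : R3 → 𝔤 :=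
  (List.ofFn α).foldr (covDeriv A) X

/-- The pointwise norm `|∇^p X|` of a `𝔤`-valued tensor `X` with components `X i`. -/
def covNorm (A : Fin 3 → R3 → 𝔤) (p : ℕ) {ι : Type} [Fintype ι] (X : ι → R3 → 𝔤) (x : R3) : ℝ :=
  Real.sqrt (∑ α : Fin p → Fin 3, ∑ i, ‖iterCovDeriv A α (X i) x‖ ^ 2)

/-- The covariant Laplacian `Δ(A) X = ∑ₖ ∇_k ∇_k X`. -/
def covLaplacian (A : Fin 3 → R3 → 𝔤) (X : R3 → 𝔤) : R3 → 𝔤 :=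
  fun x => ∑ k, covDeriv A k (covDeriv A k X) x

/-- The curvature form `G_{kl} = ∂_l A_k - ∂_k A_l - [A_k, A_l]`. -/
def curvature (A : Fin 3 → R3 → 𝔤) (i : Fin 3 × Fin 3) : R3 → 𝔤 :=
  fun x => weakPartial i.2 (A i.1) x - weakPartial i.1 (A i.2) x - ⁅A i.1 x, A i.2 x⁆

/-- The covariant divergence `(∇ · G)_k = ∑ⱼ ∇_j G_{jk}`. -/
def divCurvature (A : Fin 3 → R3 → 𝔤) (k : Fin 3) : R3 → 𝔤 :=
  fun x => ∑ j, covDeriv A j (curvature A (j, k)) x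

/-- The local regularity assumptions of order `n`. -/
def LocalAssumptions (n : ℕ) (A : Fin 3 → R3 → 𝔤) : Prop :=
  if n = 2 then
    (∀ k, Continuous (A k)) ∧
    (∀ k, WeakDerivsMemLpLoc 1 (A k) 3) ∧
    (∀ k, WeakDerivsMemLpLoc 2 (A k) 1) ∧
    (∀ k l, AEContDiff 0 (curvature A (k, l)))
  else
    (∀ k, ContDiff ℝ (n - 3 : ℕ) (A k)) ∧
    (∃ q : ℝ≥0∞, 3 < q ∧ ∀ k, WeakDerivsMemLpLoc (n - 2) (A k) q) ∧
    (∀ k, WeakDerivsMemLpLoc (n - 1) (A k) 2) ∧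
    (∀ k l, AEContDiff (n - 3) (curvature A (k, l)))

/-- The norm `‖Φ‖_{n,2}`, the square root of
`∑_{p=1}^n ∫ w^{(2p-3)(1-σ)} |∇^p Φ|²`. -/
def sobolevNorm (σ : ℝ) (A : Fin 3 → R3 → 𝔤) (n : ℕ) (Φ : R3 → 𝔤) : ℝ≥0∞ :=
  (∑ p ∈ Finset.Icc 1 n, ∫⁻ x, ENNReal.ofReal
    (w x ^ ((2 * (p : ℝ) - 3) * (1 - σ)) * covNorm A p (fun _ : Unit => Φ) x ^ 2)) ^ (1 / 2 : ℝ)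

/-- The norm `‖w^{(n-3/2)(1-σ)} ∇^{n-2} Δ(A) Φ‖₂` (for `n ≥ 2`). -/
def laplacianNorm (σ : ℝ) (A : Fin 3 → R3 → 𝔤) (n : ℕ) (Φ : R3 → 𝔤) : ℝ≥0∞ :=
  eLpNorm (fun x => w x ^ (((n : ℝ) - 3 / 2) * (1 - σ)) *
    covNorm A (n - 2) (fun _ : Unit => covLaplacian A Φ) x) 2 volume

/-- The norm `‖w^{(p+2)(1-σ)} ∇^p G‖_∞`. -/
def curvatureNorm (σ : ℝ) (A : Fin 3 → R3 → 𝔤) (p : ℕ) : ℝ≥0∞ :=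
  eLpNorm (fun x => w x ^ (((p : ℝ) + 2) * (1 - σ)) * covNorm A p (curvature A) x) ∞ volume

/-- The norm `‖w^{(p+2)(1-σ)} ∇^p (∇ · G)‖₃`. -/
def divCurvatureNorm (σ : ℝ) (A : Fin 3 → R3 → 𝔤) (p : ℕ) : ℝ≥0∞ :=
  eLpNorm (fun x => w x ^ (((p : ℝ) + 2) * (1 - σ)) * covNorm A p (divCurvature A) x) 3 volume

/-- The highest order `p` of the curvature norms that enter the constant. -/
def curvatureOrder (n : ℕ) : ℕ := if n = 2 then 0 else n - 3

end CovariantPoisson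

end

/-!
Put `s = 1 - σ ∈ [0, 1)` and `Y = ∇_J Φ` with `|J| = n - 2`. Only the top order part
`∑ ∫ w^e |∇_k ∇_l Y|²`, `e = (2n - 3)s`, of `‖Φ‖_{n,2}²` has to be bounded. Integrating by parts
twice gives a weighted Bochner identity: up to integrals of divergences, it equals `∫ w^e |Δ(A)Y|²`
plus terms with a derivative of the weight and terms with the commutator `[∇_k, ∇_l] = -[G_{kl}, ·]`.
As `|∂w^e| ≤ |e| w^{e-1}` and `w^{2s}|G|` is bounded, Young's inequality absorbs these terms except for
`∫ w^e ⟨∇_k ∇_l Y, [G_{kl}, Y]⟩`. For `n ≥ 3` this one is bounded in the same way, because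
`∫ w^{e-4s}|Y|²` is part of `‖Φ‖_{n-1,2}²`. For `n = 2` there is no such term in the norm; one integrates
by parts once more, which produces `∇·G` and `∫ w^{-s-2}|Φ|²`, the latter being controlled by Hardy's
inequality (`weightedSq_hardy`; this is where `σ > 0` enters). The two versions are
`RegPotential.sum_weightedSq_le_of_curvature_sq` and
`RegPotential.sum_weightedSq_le_of_divCurvature`.

It remains to pass from `Δ(A)∇_J Φ` to `∇_J Δ(A)Φ`. The commutator is a finite sum of brackets
`[∇_{J'}(∇·G), ∇_K Φ]` and `[∇_{J'} G, ∇_K Φ]`, the latter with `|K| ≥ 1`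
(`RegPotential.covLaplacian_covDerivs`). The second kind is bounded with the sup norms of `∇^p G`. The
first kind is bounded by Hölder's inequality `L³ · L⁶ → L²` and a weighted covariant Sobolev inequality
(`exists_weighted_sobolev`), in which the potential drops out since `⟨u, [A_k, u]⟩ = 0`. The powers of
`w` match in every term (`exists_weightedSq_eval_le`).

The analytic difficulty is the low regularity of `A`: for `n = 2` the second derivatives of `A` are only
locally integrable. All products and commutators are therefore taken on the scale `Reg r j`, on which
the weak product rule holds (`Reg.bilin`), and the integration by parts behind the Bochner identity,
`integral_exchangeForm`, is stated in `H¹` and proved by mollifying the functions but not the potential: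
the derivatives of `A` enter only through the bounded curvature.
-/

set_option linter.unusedSectionVars false

/-! ### Local integrability and elementary calculus of weak derivatives -/

namespace CovariantPoisson

open Filter Topology Metric

section WeakCalculus

variable {V V₁ V₂ V₃ : Type*} [NormedAddCommGroup V] [NormedSpace ℝ V]
  [NormedAddCommGroup V₁] [NormedSpace ℝ V₁] [NormedAddCommGroup V₂] [NormedSpace ℝ V₂]
  [NormedAddCommGroup V₃] [NormedSpace ℝ V₃]

theorem memLpLoc_one_iff {f : R3 → V} : MemLpLoc f 1 ↔ LocallyIntegrable f := by
  rw [locallyIntegrable_iff]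
  exact forall₂_congr fun K _ => memLp_one_iff_integrable

theorem MemLpLoc.congr {f g : R3 → V} {p : ℝ≥0∞} (hf : MemLpLoc f p) (h : f =ᵐ[volume] g) :
    MemLpLoc g p := fun K hK => (memLp_congr_ae (ae_restrict_of_ae h)).1 (hf K hK)

theorem MemLpLoc.mono_exponent {f : R3 → V} {p q : ℝ≥0∞} (hf : MemLpLoc f q) (h : p ≤ q) :
    MemLpLoc f p := fun K hK =>
  haveI : IsFiniteMeasure (volume.restrict K : Measure R3) := ⟨by
    simpa using hK.measure_lt_top⟩
  (hf K hK).mono_exponent h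

theorem MemLpLoc.locallyIntegrable {f : R3 → V} {p : ℝ≥0∞} (hf : MemLpLoc f p) (h : 1 ≤ p) :
    LocallyIntegrable f := memLpLoc_one_iff.1 (hf.mono_exponent h)

theorem MemLpLoc.add {f g : R3 → V} {p : ℝ≥0∞} (hf : MemLpLoc f p) (hg : MemLpLoc g p) :
    MemLpLoc (fun x => f x + g x) p := fun K hK => (hf K hK).add (hg K hK)

theorem MemLpLoc.neg {f : R3 → V} {p : ℝ≥0∞} (hf : MemLpLoc f p) :
    MemLpLoc (fun x => - f x) p := fun K hK => (hf K hK).neg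

theorem MemLpLoc.clm_comp {f : R3 → V₁} {p : ℝ≥0∞} (L : V₁ →L[ℝ] V₂) (hf : MemLpLoc f p) :
    MemLpLoc (fun x => L (f x)) p := fun K hK => L.comp_memLp' (hf K hK)

theorem MemLpLoc.bilin {f : R3 → V₁} {g : R3 → V₂} {p q : ℝ≥0∞} (r : ℝ≥0∞)
    [p.HolderTriple q r] (B : V₁ →L[ℝ] V₂ →L[ℝ] V₃) (hf : MemLpLoc f p) (hg : MemLpLoc g q) :
    MemLpLoc (fun x => B (f x) (g x)) r :=
  fun K hK => B.memLp_of_bilin r (hf K hK) (hg K hK)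

theorem memLpLoc_zero {p : ℝ≥0∞} : MemLpLoc (fun _ : R3 => (0 : V)) p :=
  fun _ _ => MemLp.zero'

theorem _root_.Continuous.memLpLoc {f : R3 → V} (hf : Continuous f) (p : ℝ≥0∞) :
    MemLpLoc f p := by
  suffices h : MemLpLoc f ∞ from h.mono_exponent le_top
  intro K hK
  obtain ⟨C, hC⟩ := hK.exists_bound_of_continuousOn hf.continuousOn
  exact memLp_top_of_bound (hf.aestronglyMeasurable) C
    ((ae_restrict_iff' hK.measurableSet).2 (Eventually.of_forall hC))

theorem MemLpLoc.aestronglyMeasurable {f : R3 → V} {p : ℝ≥0∞} (hf : MemLpLoc f p) (h : 1 ≤ p) :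
    AEStronglyMeasurable f volume := (hf.locallyIntegrable h).aestronglyMeasurable

theorem memLpLoc_top_of_ae_bound {f : R3 → V} (hf : AEStronglyMeasurable f volume) (C : ℝ)
    (h : ∀ᵐ x, ‖f x‖ ≤ C) : MemLpLoc f ∞ := fun _ _ =>
  memLp_top_of_bound hf.restrict C (ae_restrict_of_ae h)

/-- `f` vanishes almost everywhere outside the ball of radius `R` around the origin. -/
def VanishesOff (R : ℝ) (f : R3 → V) : Prop := ∀ᵐ x : R3, R < ‖x‖ → f x = 0

theorem VanishesOff.memLp {R : ℝ} {f : R3 → V} {p : ℝ≥0∞} (h : VanishesOff R f)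
    (hf : MemLpLoc f p) : MemLp f p volume := by
  have h1 := hf (closedBall 0 R) (isCompact_closedBall 0 R)
  rw [← memLp_indicator_iff_restrict measurableSet_closedBall] at h1
  refine (memLp_congr_ae ?_).1 h1
  filter_upwards [h] with x hx
  by_cases hxR : x ∈ closedBall (0 : R3) R
  · rw [Set.indicator_of_mem hxR]
  · rw [Set.indicator_of_notMem hxR, hx (by simpa using hxR)]

theorem contDiff_partialDeriv {φ : R3 → ℝ} (hφ : ContDiff ℝ ∞ φ) (k : Fin 3) :
    ContDiff ℝ ∞ (partialDeriv k φ) :=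
  (hφ.fderiv_right (m := ∞) (by simp)).clm_apply contDiff_const

theorem hasCompactSupport_partialDeriv {φ : R3 → ℝ} (hc : HasCompactSupport φ) (k : Fin 3) :
    HasCompactSupport (partialDeriv k φ) := hc.fderiv_apply (𝕜 := ℝ) _

theorem partialDeriv_comm {φ : R3 → ℝ} (hφ : ContDiff ℝ ∞ φ) (k l : Fin 3) :
    partialDeriv k (partialDeriv l φ) = partialDeriv l (partialDeriv k φ) := by
  have key : ∀ (v u : R3) (x : R3), fderiv ℝ (fun y => fderiv ℝ φ y v) x u =
      fderiv ℝ (fderiv ℝ φ) x u v := fun v u x => by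
    have hd : DifferentiableAt ℝ (fderiv ℝ φ) x :=
      (hφ.fderiv_right (m := ∞) (by simp)).differentiable (by simp) x
    rw [fderiv_clm_apply hd (differentiableAt_const v)]
    simp
  ext x
  have hs : IsSymmSndFDerivAt ℝ φ x := (hφ.contDiffAt).isSymmSndFDerivAt (by
    simp only [minSmoothness_of_isRCLikeNormedField]; exact WithTop.coe_le_coe.2 (le_top : (2 : ℕ∞) ≤ ⊤))
  change fderiv ℝ (fun y => fderiv ℝ φ y _) x _ = fderiv ℝ (fun y => fderiv ℝ φ y _) x _
  rw [key, key]
  exact hs _ _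

theorem partialDeriv_mul {φ ψ : R3 → ℝ} (hφ : ContDiff ℝ ∞ φ) (hψ : ContDiff ℝ ∞ ψ) (k : Fin 3)
    (x : R3) : partialDeriv k (fun y => φ y * ψ y) x =
      φ x * partialDeriv k ψ x + partialDeriv k φ x * ψ x := by
  simp only [partialDeriv]
  rw [fderiv_fun_mul (hφ.differentiable (by simp) x) (hψ.differentiable (by simp) x)]
  simp [mul_comm]

theorem _root_.MeasureTheory.LocallyIntegrable.integrable_test {f : R3 → V} {φ : R3 → ℝ}
    (hf : LocallyIntegrable f)
    (hφ : ContDiff ℝ ∞ φ) (hc : HasCompactSupport φ) : Integrable (fun x => φ x • f x) :=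
  hf.integrable_smul_left_of_hasCompactSupport hφ.continuous hc

theorem _root_.MeasureTheory.LocallyIntegrable.integrable_partialDeriv_test {f : R3 → V} {φ : R3 → ℝ}
    (hf : LocallyIntegrable f) (hφ : ContDiff ℝ ∞ φ) (hc : HasCompactSupport φ) (k : Fin 3) :
    Integrable (fun x => partialDeriv k φ x • f x) :=
  hf.integrable_test (contDiff_partialDeriv hφ k) (hasCompactSupport_partialDeriv hc k)

theorem hasWeakDeriv_singleton_iff {k : Fin 3} {f g : R3 → V} :
    HasWeakDeriv [k] f g ↔ LocallyIntegrable f ∧ LocallyIntegrable g ∧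
      ∀ φ : R3 → ℝ, ContDiff ℝ ∞ φ → HasCompactSupport φ →
        ∫ x, partialDeriv k φ x • f x = - ∫ x, φ x • g x := by
  constructor
  · rintro ⟨h1, h2, h3⟩
    exact ⟨h1, h2, fun φ hφ hc => by simpa [iterPartialDeriv] using h3 φ hφ hc⟩
  · rintro ⟨h1, h2, h3⟩
    exact ⟨h1, h2, fun φ hφ hc => by simpa [iterPartialDeriv] using h3 φ hφ hc⟩

theorem HasWeakDeriv.congr {α : List (Fin 3)} {f f' g g' : R3 → V} (h : HasWeakDeriv α f g)
    (hf : f =ᵐ[volume] f') (hg : g =ᵐ[volume] g') : HasWeakDeriv α f' g' where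
  locallyIntegrable_left := h.locallyIntegrable_left.congr hf
  locallyIntegrable_right := h.locallyIntegrable_right.congr hg
  integral_eq φ hφ hc := by
    have h1 : ∫ x, iterPartialDeriv α φ x • f x = ∫ x, iterPartialDeriv α φ x • f' x :=
      integral_congr_ae (by filter_upwards [hf] with x hx; simp only [hx])
    have h2 : ∫ x, φ x • g x = ∫ x, φ x • g' x :=
      integral_congr_ae (by filter_upwards [hg] with x hx; simp only [hx])
    rw [← h1, ← h2, h.integral_eq φ hφ hc]

theorem HasWeakDeriv.add {k : Fin 3} {f f' g g' : R3 → V} (h : HasWeakDeriv [k] f g)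
    (h' : HasWeakDeriv [k] f' g') :
    HasWeakDeriv [k] (fun x => f x + f' x) (fun x => g x + g' x) := by
  rw [hasWeakDeriv_singleton_iff] at *
  refine ⟨h.1.add h'.1, h.2.1.add h'.2.1, fun φ hφ hc => ?_⟩
  simp only [smul_add]
  rw [integral_add (h.1.integrable_partialDeriv_test hφ hc k)
    (h'.1.integrable_partialDeriv_test hφ hc k),
    integral_add (h.2.1.integrable_test hφ hc) (h'.2.1.integrable_test hφ hc),
    h.2.2 φ hφ hc, h'.2.2 φ hφ hc, neg_add]

theorem HasWeakDeriv.clm_comp [CompleteSpace V₁] [CompleteSpace V₂] {k : Fin 3} {f g : R3 → V₁}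
    (L : V₁ →L[ℝ] V₂) (h : HasWeakDeriv [k] f g) :
    HasWeakDeriv [k] (fun x => L (f x)) (fun x => L (g x)) := by
  rw [hasWeakDeriv_singleton_iff] at *
  refine ⟨memLpLoc_one_iff.1 ((memLpLoc_one_iff.2 h.1).clm_comp L),
    memLpLoc_one_iff.1 ((memLpLoc_one_iff.2 h.2.1).clm_comp L), fun φ hφ hc => ?_⟩
  simp only [← map_smul]
  rw [L.integral_comp_comm (h.1.integrable_partialDeriv_test hφ hc k),
    L.integral_comp_comm (h.2.1.integrable_test hφ hc), h.2.2 φ hφ hc, map_neg]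

theorem HasWeakDeriv.neg [CompleteSpace V] {k : Fin 3} {f g : R3 → V} (h : HasWeakDeriv [k] f g) :
    HasWeakDeriv [k] (fun x => - f x) (fun x => - g x) :=
  h.clm_comp (-ContinuousLinearMap.id ℝ V)

theorem HasWeakDeriv.sub [CompleteSpace V] {k : Fin 3} {f f' g g' : R3 → V}
    (h : HasWeakDeriv [k] f g) (h' : HasWeakDeriv [k] f' g') :
    HasWeakDeriv [k] (fun x => f x - f' x) (fun x => g x - g' x) := by
  simpa only [sub_eq_add_neg] using h.add h'.neg

theorem hasWeakDeriv_zero (k : Fin 3) :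
    HasWeakDeriv [k] (fun _ : R3 => (0 : V)) (fun _ => 0) := by
  rw [hasWeakDeriv_singleton_iff]
  exact ⟨locallyIntegrable_zero, locallyIntegrable_zero, fun φ _ _ => by simp⟩

theorem HasWeakDeriv.sum {ι : Type*} (s : Finset ι) {k : Fin 3} {f g : ι → R3 → V}
    (h : ∀ i ∈ s, HasWeakDeriv [k] (f i) (g i)) :
    HasWeakDeriv [k] (fun x => ∑ i ∈ s, f i x) (fun x => ∑ i ∈ s, g i x) := by
  classical
  induction s using Finset.induction_on with
  | empty => simpa using hasWeakDeriv_zero k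
  | insert a s ha ih =>
    simp only [Finset.sum_insert ha]
    exact (h a (by simp)).add (ih fun i hi => h i (by simp [hi]))

/-- A classical partial derivative of a `C¹` function is a weak one. -/
theorem hasWeakDeriv_of_contDiff {f : R3 → V} (hf : ContDiff ℝ 1 f) (k : Fin 3) :
    HasWeakDeriv [k] f (fun x => fderiv ℝ f x (EuclideanSpace.single k 1)) := by
  have hc' : Continuous (fun x => fderiv ℝ f x (EuclideanSpace.single k 1)) :=
    (hf.continuous_fderiv (by simp)).clm_apply continuous_const
  rw [hasWeakDeriv_singleton_iff]
  refine ⟨hf.continuous.locallyIntegrable, hc'.locallyIntegrable, fun φ hφ hc => ?_⟩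
  have := integral_smul_fderiv_eq_neg_fderiv_smul_of_integrable (μ := (volume : Measure R3))
    (f := φ) (g := f) (v := EuclideanSpace.single k 1)
    (hf.continuous.locallyIntegrable.integrable_partialDeriv_test hφ hc k)
    (hc'.locallyIntegrable.integrable_test hφ hc)
    (hf.continuous.locallyIntegrable.integrable_test hφ hc)
    (fun x _ => hφ.differentiable (by simp) x) (fun x _ => hf.differentiable (by simp) x)
  simp only [partialDeriv]
  rw [this, neg_neg]

theorem HasWeakDeriv.smooth_smul {k : Fin 3} {f g : R3 → V} {ψ : R3 → ℝ}
    (h : HasWeakDeriv [k] f g) (hψ : ContDiff ℝ ∞ ψ) :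
    HasWeakDeriv [k] (fun x => ψ x • f x) (fun x => partialDeriv k ψ x • f x + ψ x • g x) := by
  rw [hasWeakDeriv_singleton_iff] at *
  have hl : ∀ {χ : R3 → ℝ} {u : R3 → V}, ContDiff ℝ ∞ χ → LocallyIntegrable u →
      LocallyIntegrable (fun x => χ x • u x) := fun hχ hu => memLpLoc_one_iff.1 <|
    MemLpLoc.bilin (p := ∞) 1 (ContinuousLinearMap.lsmul ℝ ℝ) (hχ.continuous.memLpLoc ∞)
      (memLpLoc_one_iff.2 hu)
  have hd := contDiff_partialDeriv hψ k
  refine ⟨hl hψ h.1, (hl hd h.1).add (hl hψ h.2.1), fun φ hφ hc => ?_⟩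
  have hφψ : ContDiff ℝ ∞ (fun x => φ x * ψ x) := hφ.mul hψ
  have hcφψ : HasCompactSupport (fun x => φ x * ψ x) := hc.mul_right
  have h1 := h.2.2 _ hφψ hcφψ
  have i1 := (hl hψ h.1).integrable_partialDeriv_test hφ hc k
  have i2 := (hl hd h.1).integrable_test hφ hc
  have i3 := (hl hψ h.2.1).integrable_test hφ hc
  have h2 : ∫ x, partialDeriv k (fun x => φ x * ψ x) x • f x =
      (∫ x, partialDeriv k φ x • ψ x • f x) + ∫ x, φ x • partialDeriv k ψ x • f x := by
    rw [← integral_add i1 i2]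
    refine integral_congr_ae (Eventually.of_forall fun x => ?_)
    simp only [partialDeriv_mul hφ hψ, add_smul, mul_smul]
    abel
  simp only [smul_add]
  rw [integral_add i2 i3]
  rw [h2] at h1
  simp only [mul_smul] at h1
  rw [neg_add, ← h1]
  abel

/-- Weak second derivatives commute. -/
theorem HasWeakDeriv.comm [CompleteSpace V] {k l : Fin 3} {f fk fl fkl flk : R3 → V}
    (hk : HasWeakDeriv [k] f fk) (hl : HasWeakDeriv [l] f fl) (hkl : HasWeakDeriv [k] fl fkl)
    (hlk : HasWeakDeriv [l] fk flk) : fkl =ᵐ[volume] flk := by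
  rw [hasWeakDeriv_singleton_iff] at *
  refine ae_eq_of_integral_contDiff_smul_eq hkl.2.1 hlk.2.1 fun φ hφ hc => ?_
  have h1 := hkl.2.2 φ hφ hc
  have h2 := hlk.2.2 φ hφ hc
  have h3 := hl.2.2 _ (contDiff_partialDeriv hφ k) (hasCompactSupport_partialDeriv hc k)
  have h4 := hk.2.2 _ (contDiff_partialDeriv hφ l) (hasCompactSupport_partialDeriv hc l)
  rw [partialDeriv_comm hφ k l] at h4
  rw [h3] at h4
  have h5 : ∫ x, partialDeriv k φ x • fl x = ∫ x, partialDeriv l φ x • fk x := neg_injective h4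
  rw [h5, h2] at h1
  exact (neg_injective h1).symm

/-- If `∂^β f` and `∂^β ∂_j f` exist weakly, the latter is the weak `∂_j` of the former. -/
theorem HasWeakDeriv.of_append {β : List (Fin 3)} {j : Fin 3} {f g h : R3 → V}
    (hg : HasWeakDeriv β f g) (hh : HasWeakDeriv (β ++ [j]) f h) : HasWeakDeriv [j] g h := by
  rw [hasWeakDeriv_singleton_iff]
  refine ⟨hg.locallyIntegrable_right, hh.locallyIntegrable_right, fun φ hφ hc => ?_⟩
  have h1 := hg.integral_eq _ (contDiff_partialDeriv hφ j) (hasCompactSupport_partialDeriv hc j)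
  have h2 := hh.integral_eq φ hφ hc
  have h3 : iterPartialDeriv (β ++ [j]) φ = iterPartialDeriv β (partialDeriv j φ) := by
    simp [iterPartialDeriv]
  rw [h3, h1, List.length_append, List.length_singleton, pow_succ, mul_smul] at h2
  have h4 := smul_right_injective V (pow_ne_zero β.length (by norm_num : (-1 : ℝ) ≠ 0)) h2
  simpa using h4

theorem contDiff_iterPartialDeriv {φ : R3 → ℝ} (hφ : ContDiff ℝ ∞ φ) (β : List (Fin 3)) :
    ContDiff ℝ ∞ (iterPartialDeriv β φ) := by
  induction β with
  | nil => exact hφ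
  | cons k β ih => exact contDiff_partialDeriv ih k

theorem hasCompactSupport_iterPartialDeriv {φ : R3 → ℝ} (hc : HasCompactSupport φ)
    (β : List (Fin 3)) : HasCompactSupport (iterPartialDeriv β φ) := by
  induction β with
  | nil => exact hc
  | cons k β ih => exact hasCompactSupport_partialDeriv ih k

/-- If `∂_k f` and `∂_k ∂^β f` exist weakly, the latter is the weak `∂^β` of the former. -/
theorem HasWeakDeriv.of_cons {β : List (Fin 3)} {k : Fin 3} {f g h : R3 → V}
    (hg : HasWeakDeriv [k] f g) (hh : HasWeakDeriv (k :: β) f h) : HasWeakDeriv β g h := by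
  refine ⟨hg.locallyIntegrable_right, hh.locallyIntegrable_right, fun φ hφ hc => ?_⟩
  have h1 := (hasWeakDeriv_singleton_iff.1 hg).2.2 _ (contDiff_iterPartialDeriv hφ β)
    (hasCompactSupport_iterPartialDeriv hc β)
  have h2 := hh.integral_eq φ hφ hc
  have h3 : iterPartialDeriv (k :: β) φ = partialDeriv k (iterPartialDeriv β φ) := rfl
  rw [h3, h1, List.length_cons, pow_succ, mul_smul, neg_one_smul, smul_neg] at h2
  exact neg_injective h2

/-- A weak derivative vanishes where the function does. -/
theorem HasWeakDeriv.vanishesOff [CompleteSpace V] {k : Fin 3} {f g : R3 → V} {R : ℝ}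
    (h : HasWeakDeriv [k] f g) (hf : VanishesOff R f) : VanishesOff R g := by
  have hU : IsOpen {x : R3 | R < ‖x‖} := isOpen_lt continuous_const continuous_norm
  rw [hasWeakDeriv_singleton_iff] at h
  refine hU.ae_eq_zero_of_integral_contDiff_smul_eq_zero
    (h.2.1.locallyIntegrableOn _) fun φ hφ hc hs => ?_
  rw [← neg_eq_zero, ← h.2.2 φ hφ hc]
  refine integral_eq_zero_of_ae ?_
  filter_upwards [hf] with x hx
  by_cases hxR : R < ‖x‖
  · simp [hx hxR]
  · have : fderiv ℝ φ x = 0 := by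
      have : x ∉ tsupport φ := fun hx' => hxR (hs hx')
      exact image_eq_zero_of_notMem_tsupport (fun h' => this (tsupport_fderiv_subset ℝ h'))
    simp [partialDeriv, this]

/-- The weak derivative of a function of bounded support has integral zero. -/
theorem HasWeakDeriv.integral_eq_zero [CompleteSpace V] {k : Fin 3} {f g : R3 → V} {R : ℝ}
    (h : HasWeakDeriv [k] f g) (hf : VanishesOff R f) : ∫ x, g x = 0 := by
  have hg := h.vanishesOff hf
  let χ : ContDiffBump (0 : R3) := ⟨|R| + 1, |R| + 2, by positivity, by linarith⟩
  have h1 := (hasWeakDeriv_singleton_iff.1 h).2.2 χ χ.contDiff χ.hasCompactSupport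
  have hle := le_abs_self R
  have h2 : ∫ x, partialDeriv k χ x • f x = 0 := by
    refine integral_eq_zero_of_ae ?_
    filter_upwards [hf] with x hx
    by_cases hxR : R < ‖x‖
    · simp [hx hxR]
    · have hev : (χ : R3 → ℝ) =ᶠ[𝓝 x] fun _ => 1 := by
        have : ball (0 : R3) (|R| + 1) ∈ 𝓝 x := isOpen_ball.mem_nhds (by
          simp only [mem_ball, dist_zero_right]; linarith)
        filter_upwards [this] with y hy
        exact χ.one_of_mem_closedBall (ball_subset_closedBall hy)
      simp [partialDeriv, hev.fderiv_eq]
  have h3 : ∫ x, χ x • g x = ∫ x, g x := by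
    refine integral_congr_ae ?_
    filter_upwards [hg] with x hx
    by_cases hxR : R < ‖x‖
    · simp [hx hxR]
    · have : χ x = 1 := χ.one_of_mem_closedBall (by
        simp only [mem_closedBall, dist_zero_right]; change ‖x‖ ≤ |R| + 1; linarith)
      simp [this]
  rw [h2, h3] at h1
  exact neg_eq_zero.1 h1.symm

end WeakCalculus

end CovariantPoisson

/-! ### Mollification -/

namespace CovariantPoisson

open Filter Topology Metric
open scoped Convolution

section Mollification

variable {V V₁ V₂ V₃ : Type*} [NormedAddCommGroup V] [NormedSpace ℝ V]
  [NormedAddCommGroup V₁] [NormedSpace ℝ V₁] [NormedAddCommGroup V₂] [NormedSpace ℝ V₂]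
  [NormedAddCommGroup V₃] [NormedSpace ℝ V₃]

/-- A bump function supported in the ball of radius `1/(n+1)`. -/
noncomputable def bump (n : ℕ) : ContDiffBump (0 : R3) where
  rIn := 1 / (n + 1) / 2
  rOut := 1 / (n + 1)
  rIn_pos := by positivity
  rIn_lt_rOut := half_lt_self (by positivity)

theorem bump_rOut_le (n : ℕ) : (bump n).rOut ≤ 1 := by
  change (1 : ℝ) / (n + 1) ≤ 1
  rw [div_le_one (by positivity)]
  linarith [n.cast_nonneg (α := ℝ)]

theorem tendsto_bump_rOut : Tendsto (fun n => (bump n).rOut) atTop (𝓝 0) :=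
  tendsto_one_div_add_atTop_nhds_zero_nat

/-- The mollification of `f` at scale `1/(n+1)`. -/
noncomputable def mollify (n : ℕ) (f : R3 → V) : R3 → V :=
  (bump n).normed volume ⋆[ContinuousLinearMap.lsmul ℝ ℝ, volume] f

theorem contDiff_mollify [CompleteSpace V] (n : ℕ) {f : R3 → V} (hf : LocallyIntegrable f) :
    ContDiff ℝ ∞ (mollify n f) :=
  (bump n).hasCompactSupport_normed.contDiff_convolution_left _ (bump n).contDiff_normed hf

theorem convolutionExists_bump (n : ℕ) {f : R3 → V} (hf : LocallyIntegrable f) :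
    ConvolutionExists ((bump n).normed volume) f (ContinuousLinearMap.lsmul ℝ ℝ) volume :=
  (bump n).hasCompactSupport_normed.convolutionExists_left _ (bump n).continuous_normed hf

theorem mollify_sub (n : ℕ) {f g : R3 → V} (hf : LocallyIntegrable f) (hg : LocallyIntegrable g) :
    mollify n (f - g) = mollify n f - mollify n g := by
  have h := ConvolutionExists.distrib_add (convolutionExists_bump n (hf.sub hg))
    (convolutionExists_bump n hg)
  rw [sub_add_cancel] at h
  exact eq_sub_of_add_eq h.symm

/-- Mollification commutes with weak derivatives. -/
theorem fderiv_mollify [CompleteSpace V] (n : ℕ) {k : Fin 3} {f g : R3 → V}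
    (h : HasWeakDeriv [k] f g) (x : R3) :
    fderiv ℝ (mollify n f) x (EuclideanSpace.single k 1) = mollify n g x := by
  have hf := h.locallyIntegrable_left
  set ρ := (bump n).normed (volume : Measure R3) with hρ
  have hρs : ContDiff ℝ ∞ ρ := (bump n).contDiff_normed
  have hρc : HasCompactSupport ρ := (bump n).hasCompactSupport_normed
  have h1 := (hρc.hasFDerivAt_convolution_left (ContinuousLinearMap.lsmul ℝ ℝ)
    (hρs.of_le (by simp)) hf x).fderiv
  have hex : ConvolutionExistsAt (fderiv ℝ ρ) f x
      ((ContinuousLinearMap.lsmul ℝ ℝ : ℝ →L[ℝ] V →L[ℝ] V).precompL R3) volume :=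
    (hρc.fderiv (𝕜 := ℝ)).convolutionExists_left _ (hρs.continuous_fderiv (by simp)) hf x
  change fderiv ℝ (ρ ⋆[ContinuousLinearMap.lsmul ℝ ℝ, volume] f) x _ = _
  rw [h1, convolution_def, ContinuousLinearMap.integral_apply hex]
  simp only [ContinuousLinearMap.precompL_apply, ContinuousLinearMap.lsmul_apply]
  rw [← integral_sub_left_eq_self _ volume x]
  simp only [sub_sub_cancel]
  have hφ : ContDiff ℝ ∞ (fun t => ρ (x - t)) := hρs.comp (contDiff_const.sub contDiff_id)
  have hφc : HasCompactSupport (fun t => ρ (x - t)) :=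
    hρc.comp_homeomorph (Homeomorph.subLeft x)
  have h2 := (hasWeakDeriv_singleton_iff.1 h).2.2 _ hφ hφc
  have h3 : ∀ t, partialDeriv k (fun t => ρ (x - t)) t =
      - fderiv ℝ ρ (x - t) (EuclideanSpace.single k 1) := fun t => by
    have hd : HasFDerivAt (fun t => ρ (x - t))
        ((fderiv ℝ ρ (x - t)).comp (-ContinuousLinearMap.id ℝ R3)) t :=
      (hρs.differentiable (by simp) (x - t)).hasFDerivAt.comp t
        ((hasFDerivAt_id t).const_sub x)
    simp [partialDeriv, hd.fderiv]
  simp only [h3, neg_smul, integral_neg, neg_inj] at h2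
  rw [h2]
  change _ = (ρ ⋆[ContinuousLinearMap.lsmul ℝ ℝ, volume] g) x
  rw [convolution_eq_swap]
  rfl

theorem norm_mollify_le (n : ℕ) {f : R3 → V} {C : ℝ} (hC : ∀ᵐ x, ‖f x‖ ≤ C) (x : R3) :
    ‖mollify n f x‖ ≤ C := by
  have hae : ∀ᵐ t : R3, ‖f (x - t)‖ ≤ C :=
    (quasiMeasurePreserving_sub_left_of_right_invariant volume x).ae hC
  have h1 : ‖mollify n f x‖ ≤ ∫ t, (bump n).normed volume t * C := by
    refine norm_integral_le_of_norm_le (((bump n).integrable_normed).mul_const C) ?_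
    filter_upwards [hae] with t ht
    simp only [ContinuousLinearMap.lsmul_apply, norm_smul, Real.norm_eq_abs,
      abs_of_nonneg ((bump n).nonneg_normed t)]
    exact mul_le_mul_of_nonneg_left ht ((bump n).nonneg_normed t)
  rwa [integral_mul_const, (bump n).integral_normed, one_mul] at h1

theorem VanishesOff.mollify_eq_zero {R : ℝ} {f : R3 → V} (hf : VanishesOff R f) (n : ℕ) {x : R3}
    (hx : R + 1 < ‖x‖) : mollify n f x = 0 := by
  refine integral_eq_zero_of_ae ?_
  have hae : ∀ᵐ t : R3, R < ‖x - t‖ → f (x - t) = 0 :=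
    (quasiMeasurePreserving_sub_left_of_right_invariant volume x).ae hf
  filter_upwards [hae] with t ht
  by_cases h : R < ‖x - t‖
  · simp [ht h]
  · have h1 : t ∉ Function.support ((bump n).normed (volume : Measure R3)) := by
      rw [(bump n).support_normed_eq, mem_ball_zero_iff, not_lt]
      have := bump_rOut_le n
      have h2 : ‖x‖ ≤ ‖x - t‖ + ‖t‖ := by simpa using norm_add_le (x - t) t
      linarith
    simp [Function.notMem_support.1 h1]

theorem VanishesOff.mollify {R : ℝ} {f : R3 → V} (hf : VanishesOff R f) (n : ℕ) :
    VanishesOff (R + 1) (mollify n f) := Eventually.of_forall fun _ hx => hf.mollify_eq_zero n hx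

theorem VanishesOff.hasCompactSupport_mollify {R : ℝ} {f : R3 → V} (hf : VanishesOff R f)
    (n : ℕ) : HasCompactSupport (CovariantPoisson.mollify n f) :=
  HasCompactSupport.intro (isCompact_closedBall (0 : R3) (R + 1)) fun x hx =>
    hf.mollify_eq_zero n (by simpa using hx)

theorem ae_tendsto_mollify [CompleteSpace V] {f : R3 → V} (hf : LocallyIntegrable f) :
    ∀ᵐ x, Tendsto (fun n => mollify n f x) atTop (𝓝 (f x)) :=
  ContDiffBump.ae_convolution_tendsto_right_of_locallyIntegrable (K := 2) tendsto_bump_rOut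
    (Eventually.of_forall fun n => by
      change (1 : ℝ) / (n + 1) ≤ 2 * (1 / (n + 1) / 2); linarith) hf

/-- Young's inequality for mollification: it does not increase `L^p` norms. -/
theorem eLpNorm_mollify_le (n : ℕ) {f : R3 → V} {p : ℝ≥0∞} (hp : 1 ≤ p) (hp' : p ≠ ⊤)
    (hf : AEStronglyMeasurable f volume) : eLpNorm (mollify n f) p volume ≤ eLpNorm f p volume := by
  set ρ := (bump n).normed (volume : Measure R3) with hρ
  have hρm : Measurable (fun t => ENNReal.ofReal (ρ t)) :=
    ((bump n).continuous_normed.measurable).ennreal_ofReal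
  let ν : Measure R3 := volume.withDensity fun t => ENNReal.ofReal (ρ t)
  have hν : IsProbabilityMeasure ν := ⟨by
    rw [withDensity_apply _ MeasurableSet.univ, setLIntegral_univ,
      ← ofReal_integral_eq_lintegral_ofReal (bump n).integrable_normed
        (Eventually.of_forall (bump n).nonneg_normed), (bump n).integral_normed]
    simp⟩
  have hνac : ν ≪ volume := withDensity_absolutelyContinuous _ _
  have hp0 : p ≠ 0 := (zero_lt_one.trans_le hp).ne'
  have hq : 0 < p.toReal := ENNReal.toReal_pos hp0 hp'
  have hfx : ∀ x, AEStronglyMeasurable (fun t => f (x - t)) ν := fun x =>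
    (hf.comp_quasiMeasurePreserving
      (quasiMeasurePreserving_sub_left_of_right_invariant volume x)).mono_ac hνac
  have hprod : AEStronglyMeasurable (fun z : R3 × R3 => f (z.1 - z.2)) (volume.prod ν) :=
    hf.comp_quasiMeasurePreserving (quasiMeasurePreserving_sub_of_right_invariant volume ν)
  -- Jensen's inequality for the probability measure `ν`.
  have hjensen : ∀ x, ‖mollify n f x‖ₑ ^ p.toReal ≤ ∫⁻ t, ‖f (x - t)‖ₑ ^ p.toReal ∂ν := fun x => by
    have h1 : ‖mollify n f x‖ₑ ≤ ∫⁻ t, ‖f (x - t)‖ₑ ∂ν := by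
      refine (enorm_integral_le_lintegral_enorm _).trans ?_
      rw [lintegral_withDensity_eq_lintegral_mul_non_measurable₀ _ hρm.aemeasurable
        (Eventually.of_forall fun t => ENNReal.ofReal_lt_top)]
      refine lintegral_mono fun t => ?_
      simp only [ContinuousLinearMap.lsmul_apply, enorm_smul, Pi.mul_apply]
      rw [Real.enorm_of_nonneg ((bump n).nonneg_normed t)]
    have h2 := eLpNorm_le_eLpNorm_of_exponent_le hp (hfx x)
    rw [eLpNorm_one_eq_lintegral_enorm, eLpNorm_eq_lintegral_rpow_enorm_toReal hp0 hp'] at h2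
    calc ‖mollify n f x‖ₑ ^ p.toReal
        ≤ ((∫⁻ t, ‖f (x - t)‖ₑ ^ p.toReal ∂ν) ^ (1 / p.toReal)) ^ p.toReal :=
          ENNReal.rpow_le_rpow (h1.trans h2) hq.le
      _ = _ := by rw [← ENNReal.rpow_mul, one_div_mul_cancel hq.ne', ENNReal.rpow_one]
  rw [eLpNorm_eq_lintegral_rpow_enorm_toReal hp0 hp',
    eLpNorm_eq_lintegral_rpow_enorm_toReal hp0 hp']
  refine ENNReal.rpow_le_rpow ?_ (by positivity)
  calc ∫⁻ x, ‖mollify n f x‖ₑ ^ p.toReal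
      ≤ ∫⁻ x, ∫⁻ t, ‖f (x - t)‖ₑ ^ p.toReal ∂ν := lintegral_mono hjensen
    _ = ∫⁻ t, (∫⁻ x, ‖f (x - t)‖ₑ ^ p.toReal) ∂ν :=
        lintegral_lintegral_swap ((hprod.enorm).pow_const _)
    _ = ∫⁻ _, (∫⁻ x, ‖f x‖ₑ ^ p.toReal) ∂ν := by
        refine lintegral_congr fun t => ?_
        exact lintegral_sub_right_eq_self (fun x => ‖f x‖ₑ ^ p.toReal) t
    _ = _ := by simp

theorem tendsto_eLpNorm_mollify_sub [CompleteSpace V] {f : R3 → V} {p : ℝ≥0∞} (hp : 1 ≤ p)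
    (hp' : p ≠ ⊤) (hf : MemLp f p volume) :
    Tendsto (fun n => eLpNorm (mollify n f - f) p volume) atTop (𝓝 0) := by
  have hfl : LocallyIntegrable f := hf.locallyIntegrable hp
  rw [ENNReal.tendsto_nhds_zero]
  intro ε hε
  obtain ⟨g, hgc, hfg, hg, hgp⟩ := hf.exists_hasCompactSupport_eLpNorm_sub_le hp'
    (ε := ε / 3) (by simpa using hε.ne')
  have hgl : LocallyIntegrable g := hg.locallyIntegrable
  obtain ⟨R, hR⟩ : ∃ R : ℝ, ∀ x : R3, R < ‖x‖ → g x = 0 := by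
    obtain ⟨R, hR⟩ := hgc.isCompact.isBounded.subset_closedBall (0 : R3)
    exact ⟨R, fun x hx => image_eq_zero_of_notMem_tsupport fun h => by
      have := hR h; simp at this; linarith⟩
  have hgR : VanishesOff R g := Eventually.of_forall hR
  -- The mollifications of a continuous function of compact support converge uniformly.
  have hlim : ∀ᶠ n in atTop, eLpNorm (mollify n g - g) p volume ≤ ε / 3 := by
    set K := closedBall (0 : R3) (R + 1)
    obtain ⟨δ, hδ, hδε⟩ : ∃ δ : ℝ, 0 < δ ∧
        volume K ^ p.toReal⁻¹ * ENNReal.ofReal δ ≤ ε / 3 := by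
      have hKf : volume K ^ p.toReal⁻¹ ≠ ⊤ :=
        ENNReal.rpow_ne_top_of_nonneg (inv_nonneg.2 ENNReal.toReal_nonneg) (isCompact_closedBall _ _).measure_lt_top.ne
      have ht : Tendsto (fun δ : ℝ => volume K ^ p.toReal⁻¹ * ENNReal.ofReal δ) (𝓝[>] 0)
          (𝓝 (volume K ^ p.toReal⁻¹ * ENNReal.ofReal 0)) :=
        (ENNReal.Tendsto.const_mul (ENNReal.tendsto_ofReal tendsto_id) (Or.inr hKf)).mono_left
          nhdsWithin_le_nhds
      rw [ENNReal.ofReal_zero, mul_zero, ENNReal.tendsto_nhds_zero] at ht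
      obtain ⟨δ, h1, h2⟩ := ((ht (ε / 3) (by simpa using hε.ne')).and self_mem_nhdsWithin).exists
      exact ⟨δ, h2, h1⟩
    obtain ⟨η, hη, hunif⟩ := Metric.uniformContinuous_iff.1
      (hg.uniformContinuous_of_tendsto_cocompact hgc.is_zero_at_infty) δ hδ
    filter_upwards [(tendsto_bump_rOut).eventually (gt_mem_nhds hη)] with n hn
    have hsup : Function.support (mollify n g - g) ⊆ K := fun x hx => by
      by_contra hxK
      have hx' : R + 1 < ‖x‖ := by simpa [K] using hxK
      exact hx (by simp [hgR.mollify_eq_zero n hx', hR x (by linarith)])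
    rw [← eLpNorm_restrict_eq_of_support_subset hsup]
    refine le_trans (eLpNorm_le_of_ae_bound (C := δ) ?_) (by simpa using hδε)
    refine Eventually.of_forall fun x => ?_
    rw [Pi.sub_apply, ← dist_eq_norm]
    refine ContDiffBump.dist_normed_convolution_le hg.aestronglyMeasurable fun y hy => ?_
    exact (hunif (lt_trans hy hn)).le
  filter_upwards [hlim] with n hn
  have hdec : mollify n f - f = mollify n (f - g) + ((mollify n g - g) - (f - g)) := by
    rw [mollify_sub n hfl hgl]; abel
  have hm1 : AEStronglyMeasurable (f - g) volume := (hf.sub hgp).1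
  have hmm : ∀ {u : R3 → V}, LocallyIntegrable u → AEStronglyMeasurable (mollify n u) volume :=
    fun hu => (contDiff_mollify n hu).continuous.aestronglyMeasurable
  rw [hdec]
  calc eLpNorm (mollify n (f - g) + ((mollify n g - g) - (f - g))) p volume
      ≤ eLpNorm (mollify n (f - g)) p volume + eLpNorm ((mollify n g - g) - (f - g)) p volume :=
        eLpNorm_add_le (hmm (hfl.sub hgl)) (((hmm hgl).sub hgp.1).sub hm1) hp
    _ ≤ eLpNorm (f - g) p volume + (eLpNorm (mollify n g - g) p volume +
        eLpNorm (f - g) p volume) :=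
        add_le_add (eLpNorm_mollify_le n hp hp' hm1)
          (eLpNorm_sub_le ((hmm hgl).sub hgp.1) hm1 hp)
    _ ≤ ε / 3 + (ε / 3 + ε / 3) := by gcongr
    _ = ε := by rw [← add_assoc, ENNReal.add_thirds]

end Mollification

end CovariantPoisson

/-! ### Product rule and Sobolev inequality for weak derivatives -/

namespace CovariantPoisson

open Filter Topology Metric

section ProductRule

variable {V V₁ V₂ V₃ : Type*} [NormedAddCommGroup V] [NormedSpace ℝ V]
  [NormedAddCommGroup V₁] [NormedSpace ℝ V₁] [NormedAddCommGroup V₂] [NormedSpace ℝ V₂]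
  [NormedAddCommGroup V₃] [NormedSpace ℝ V₃]

theorem _root_.MeasureTheory.LocallyIntegrable.smul_memLpLoc_top {f : R3 → ℝ} {g : R3 → V}
    (hf : LocallyIntegrable f) (hg : MemLpLoc g ∞) : LocallyIntegrable (fun x => f x • g x) :=
  memLpLoc_one_iff.1 (MemLpLoc.bilin 1 (ContinuousLinearMap.lsmul ℝ ℝ) (memLpLoc_one_iff.2 hf) hg)

theorem MemLpLoc.smul_locallyIntegrable {f : R3 → ℝ} {g : R3 → V}
    (hf : MemLpLoc f ∞) (hg : LocallyIntegrable g) : LocallyIntegrable (fun x => f x • g x) :=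
  memLpLoc_one_iff.1 (MemLpLoc.bilin 1 (ContinuousLinearMap.lsmul ℝ ℝ) hf (memLpLoc_one_iff.2 hg))

theorem tendsto_integral_smul_of_tendsto_L1 {u : ℕ → R3 → ℝ} {f : R3 → ℝ} {h : R3 → V}
    (hu : ∀ n, AEStronglyMeasurable (u n) volume) (hf : MemLp f 1 volume)
    (hlim : Tendsto (fun n => eLpNorm (u n - f) 1 volume) atTop (𝓝 0)) (hh : MemLp h ∞ volume) :
    Tendsto (fun n => ∫ x, u n x • h x) atTop (𝓝 (∫ x, f x • h x)) := by
  have hfh : Integrable (fun x => f x • h x) :=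
    memLp_one_iff_integrable.1 (hh.smul (p := 1) (r := 1) hf)
  have hbd : ∀ n, eLpNorm ((fun x => u n x • h x) - fun x => f x • h x) 1 volume ≤
      eLpNorm (u n - f) 1 volume * eLpNorm h ∞ volume := fun n => by
    have h1 : ((fun x => u n x • h x) - fun x => f x • h x) = (u n - f) • h := by
      ext x; simp [sub_smul]
    rw [h1]
    exact eLpNorm_smul_le_mul_eLpNorm (p := 1) (q := ∞) (r := 1) hh.1 ((hu n).sub hf.1)
  have hlim' : Tendsto (fun n => eLpNorm (u n - f) 1 volume * eLpNorm h ∞ volume) atTop (𝓝 0) := by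
    simpa using ENNReal.Tendsto.mul_const hlim (Or.inr hh.2.ne)
  have hT := tendsto_of_tendsto_of_tendsto_of_le_of_le tendsto_const_nhds hlim'
    (fun _ => zero_le) hbd
  refine tendsto_integral_of_L1' _ hfh.1 ?_ hT
  have hev : ∀ᶠ n in atTop, eLpNorm ((fun x => u n x • h x) - fun x => f x • h x) 1 volume < 1 :=
    hT.eventually (gt_mem_nhds zero_lt_one)
  filter_upwards [hev] with n hn
  have hd : MemLp ((fun x => u n x • h x) - fun x => f x • h x) 1 volume :=
    ⟨((hu n).smul hh.1).sub (hf.1.smul hh.1), hn.trans ENNReal.one_lt_top⟩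
  have := (memLp_one_iff_integrable.1 hd).add hfh
  rwa [sub_add_cancel] at this

/-- Product rule for a scalar factor of bounded support, by mollification of that factor. -/
theorem HasWeakDeriv.smul_of_vanishesOff [CompleteSpace V] {k : Fin 3} {f f' : R3 → ℝ}
    {g g' : R3 → V} {R : ℝ} (hf : HasWeakDeriv [k] f f') (hR : VanishesOff R f)
    (hg : HasWeakDeriv [k] g g') (hgb : MemLpLoc g ∞) (h : MemLpLoc g' ∞ ∨ MemLpLoc f ∞) :
    HasWeakDeriv [k] (fun x => f x • g x) (fun x => f' x • g x + f x • g' x) := by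
  have hR' := hf.vanishesOff hR
  have hl := (hasWeakDeriv_singleton_iff.1 hf).1
  have hl' := (hasWeakDeriv_singleton_iff.1 hf).2.1
  have hgl := (hasWeakDeriv_singleton_iff.1 hg).1
  have hgl' := (hasWeakDeriv_singleton_iff.1 hg).2.1
  have hfg' : LocallyIntegrable (fun x => f x • g' x) :=
    h.elim (fun h => hl.smul_memLpLoc_top h) fun h => h.smul_locallyIntegrable hgl'
  rw [hasWeakDeriv_singleton_iff]
  refine ⟨hl.smul_memLpLoc_top hgb, (hl'.smul_memLpLoc_top hgb).add hfg', fun φ hφ hc => ?_⟩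
  have hf1 : MemLp f 1 volume := hR.memLp (memLpLoc_one_iff.2 hl)
  have hf1' : MemLp f' 1 volume := hR'.memLp (memLpLoc_one_iff.2 hl')
  have hmm : ∀ {u : R3 → ℝ}, LocallyIntegrable u → ∀ n, AEStronglyMeasurable (mollify n u) volume :=
    fun hu n => (contDiff_mollify n hu).continuous.aestronglyMeasurable
  obtain ⟨S, hS⟩ : ∃ S : ℝ, ∀ x : R3, S < ‖x‖ → φ x = 0 := by
    obtain ⟨S, hS⟩ := hc.isCompact.isBounded.subset_closedBall (0 : R3)
    exact ⟨S, fun x hx => image_eq_zero_of_notMem_tsupport fun h => by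
      have := hS h; simp at this; linarith⟩
  have hS' : VanishesOff S (partialDeriv k φ) :=
    (hasWeakDeriv_of_contDiff (hφ.of_le (by simp)) k).vanishesOff (Eventually.of_forall hS)
  have htop : ∀ {χ : R3 → ℝ} {u : R3 → V}, Continuous χ → VanishesOff S χ → MemLpLoc u ∞ →
      MemLp (fun x => χ x • u x) ∞ volume := fun hχ hχS hu => by
    refine VanishesOff.memLp (R := S) ?_
      (MemLpLoc.bilin ∞ (ContinuousLinearMap.lsmul ℝ ℝ) (hχ.memLpLoc ∞) hu)
    filter_upwards [hχS] with x hx hxS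
    simp [hx hxS]
  have hpc : Continuous (partialDeriv k φ) := (contDiff_partialDeriv hφ k).continuous
  have hφS : VanishesOff S φ := Eventually.of_forall hS
  -- The identity for the mollified factor.
  have hn : ∀ n, ∫ x, mollify n f x • partialDeriv k φ x • g x =
      -((∫ x, mollify n f' x • φ x • g x) + ∫ x, mollify n f x • φ x • g' x) := fun n => by
    have hs := contDiff_mollify n hl
    have h1 := (hasWeakDeriv_singleton_iff.1 (hg.smooth_smul hs)).2.2 φ hφ hc
    have h2 : partialDeriv k (mollify n f) = mollify n f' := funext fun x => fderiv_mollify n hf x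
    rw [h2] at h1
    have i1 : Integrable (fun x => φ x • mollify n f' x • g x) :=
      ((contDiff_mollify n hl').continuous.memLpLoc ∞ |>.smul_locallyIntegrable hgl).integrable_test
        hφ hc
    have i2 : Integrable (fun x => φ x • mollify n f x • g' x) :=
      (hs.continuous.memLpLoc ∞ |>.smul_locallyIntegrable hgl').integrable_test hφ hc
    simp only [smul_add] at h1
    rw [integral_add i1 i2] at h1
    simp only [smul_comm (mollify n f _), smul_comm (mollify n f' _)]
    exact h1
  have l1 := tendsto_integral_smul_of_tendsto_L1 (hmm hl) hf1
    (tendsto_eLpNorm_mollify_sub le_rfl ENNReal.one_ne_top hf1) (htop hpc hS' hgb)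
  have l2 := tendsto_integral_smul_of_tendsto_L1 (hmm hl') hf1'
    (tendsto_eLpNorm_mollify_sub le_rfl ENNReal.one_ne_top hf1') (htop hφ.continuous hφS hgb)
  have l3 : Tendsto (fun n => ∫ x, mollify n f x • φ x • g' x) atTop
      (𝓝 (∫ x, f x • φ x • g' x)) := by
    rcases h with h | h
    · exact tendsto_integral_smul_of_tendsto_L1 (hmm hl) hf1
        (tendsto_eLpNorm_mollify_sub le_rfl ENNReal.one_ne_top hf1) (htop hφ.continuous hφS h)
    · have hft : MemLp f ∞ volume := hR.memLp h
      have hC := ae_le_eLpNormEssSup (f := f) (μ := volume)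
      have hCt : eLpNormEssSup f volume ≠ ⊤ := by
        rw [← eLpNorm_exponent_top]; exact hft.2.ne
      have hC' : ∀ᵐ x, ‖f x‖ ≤ (eLpNormEssSup f volume).toReal := by
        filter_upwards [hC] with x hx
        rw [← toReal_enorm]
        exact ENNReal.toReal_mono hCt hx
      refine tendsto_integral_of_dominated_convergence
        (fun x => (eLpNormEssSup f volume).toReal * ‖φ x • g' x‖)
        (fun n => (hmm hl n).smul (hgl'.integrable_test hφ hc).1)
        ((hgl'.integrable_test hφ hc).norm.const_mul _)
        (fun n => Eventually.of_forall fun x => ?_) ?_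
      · rw [norm_smul]
        exact mul_le_mul_of_nonneg_right (norm_mollify_le n hC' x) (norm_nonneg _)
      · filter_upwards [ae_tendsto_mollify hl] with x hx
        exact hx.smul_const _
  have hlim := tendsto_nhds_unique l1 (((l2.add l3).neg).congr fun n => (hn n).symm)
  have j1 : Integrable (fun x => φ x • f' x • g x) :=
    (hl'.smul_memLpLoc_top hgb).integrable_test hφ hc
  have j2 : Integrable (fun x => φ x • f x • g' x) := hfg'.integrable_test hφ hc
  simp only [smul_add]
  rw [integral_add j1 j2]
  simp only [smul_comm (f _), smul_comm (f' _)] at hlim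
  exact hlim

/-- Product rule for a scalar factor: one factor is bounded, and so is either the other factor or
the derivative of the first. -/
theorem HasWeakDeriv.smul [CompleteSpace V] {k : Fin 3} {f f' : R3 → ℝ} {g g' : R3 → V}
    (hf : HasWeakDeriv [k] f f') (hg : HasWeakDeriv [k] g g') (hgb : MemLpLoc g ∞)
    (h : MemLpLoc g' ∞ ∨ MemLpLoc f ∞) :
    HasWeakDeriv [k] (fun x => f x • g x) (fun x => f' x • g x + f x • g' x) := by
  have hl := (hasWeakDeriv_singleton_iff.1 hf).1
  have hl' := (hasWeakDeriv_singleton_iff.1 hf).2.1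
  have hgl' := (hasWeakDeriv_singleton_iff.1 hg).2.1
  have hfg' : LocallyIntegrable (fun x => f x • g' x) :=
    h.elim (fun h => hl.smul_memLpLoc_top h) fun h => h.smul_locallyIntegrable hgl'
  rw [hasWeakDeriv_singleton_iff]
  refine ⟨hl.smul_memLpLoc_top hgb, (hl'.smul_memLpLoc_top hgb).add hfg', fun φ hφ hc => ?_⟩
  obtain ⟨S, hS⟩ := hc.isCompact.isBounded.subset_closedBall (0 : R3)
  -- A cutoff equal to one near the support of the test function.
  let χ : ContDiffBump (0 : R3) := ⟨|S| + 1, |S| + 2, by positivity, by linarith⟩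
  have hχf : HasWeakDeriv [k] (fun x => χ x • f x)
      (fun x => partialDeriv k χ x • f x + χ x • f' x) := hf.smooth_smul χ.contDiff
  have hχR : VanishesOff (|S| + 2) (fun x => χ x • f x) := Eventually.of_forall fun x hx => by
    have : χ x = 0 := χ.zero_of_le_dist (by simpa using hx.le)
    simp [this]
  have hχb : MemLpLoc g' ∞ ∨ MemLpLoc (fun x => χ x • f x) ∞ := h.imp id fun h =>
    MemLpLoc.bilin ∞ (ContinuousLinearMap.lsmul ℝ ℝ) (χ.continuous.memLpLoc ∞) h
  have h1 := (hasWeakDeriv_singleton_iff.1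
    (hχf.smul_of_vanishesOff hχR hg hgb hχb)).2.2 φ hφ hc
  have hne : ∀ x, x ∉ tsupport φ ∨ (χ x = 1 ∧ partialDeriv k χ x = 0) := fun x => by
    by_cases hx : x ∈ tsupport φ
    · right
      have hxS : ‖x‖ < |S| + 1 := by
        have := hS hx
        rw [mem_closedBall_zero_iff] at this
        linarith [le_abs_self S]
      have hev : (χ : R3 → ℝ) =ᶠ[𝓝 x] fun _ => 1 := by
        have : ball (0 : R3) (|S| + 1) ∈ 𝓝 x := isOpen_ball.mem_nhds (by simpa using hxS)
        filter_upwards [this] with y hy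
        exact χ.one_of_mem_closedBall (ball_subset_closedBall hy)
      exact ⟨hev.self_of_nhds, by simp [partialDeriv, hev.fderiv_eq]⟩
    · exact Or.inl hx
  convert h1 using 2
  · ext x
    rcases hne x with hx | ⟨hx, -⟩
    · have : fderiv ℝ φ x = 0 :=
        image_eq_zero_of_notMem_tsupport (fun h' => hx (tsupport_fderiv_subset ℝ h'))
      simp [partialDeriv, this]
    · simp [hx]
  · congr 1
    ext x
    rcases hne x with hx | ⟨hx, hx'⟩
    · simp [image_eq_zero_of_notMem_tsupport hx]
    · simp [hx, hx']

/-- Product rule for a bilinear map. -/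
theorem HasWeakDeriv.bilin [FiniteDimensional ℝ V₁] [CompleteSpace V₂] [CompleteSpace V₃]
    (B : V₁ →L[ℝ] V₂ →L[ℝ] V₃) {k : Fin 3} {f f' : R3 → V₁} {g g' : R3 → V₂}
    (hf : HasWeakDeriv [k] f f') (hg : HasWeakDeriv [k] g g') (hgb : MemLpLoc g ∞)
    (h : MemLpLoc g' ∞ ∨ MemLpLoc f ∞) :
    HasWeakDeriv [k] (fun x => B (f x) (g x)) (fun x => B (f' x) (g x) + B (f x) (g' x)) := by
  have : CompleteSpace V₁ := FiniteDimensional.complete ℝ V₁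
  let b := Module.finBasis ℝ V₁
  let c : ∀ i, V₁ →L[ℝ] ℝ := fun i => LinearMap.toContinuousLinearMap (b.coord i)
  have hdec : ∀ (v : V₁) (u : V₂), B v u = ∑ i, c i v • B (b i) u := fun v u => by
    conv_lhs => rw [← b.sum_repr v, map_sum]
    simp [c]
  have key := HasWeakDeriv.sum Finset.univ (fun i _ =>
    (hf.clm_comp (c i)).smul (hg.clm_comp (B (b i))) (hgb.clm_comp _)
      (h.imp (fun h => h.clm_comp _) fun h => h.clm_comp _))
  convert key using 1
  · ext x
    exact hdec _ _
  · ext x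
    rw [hdec, hdec, ← Finset.sum_add_distrib]

/-- Product rule for a bilinear map, with the roles of the factors exchanged. -/
theorem HasWeakDeriv.bilin' [CompleteSpace V₁] [FiniteDimensional ℝ V₂] [CompleteSpace V₃]
    (B : V₁ →L[ℝ] V₂ →L[ℝ] V₃) {k : Fin 3} {f f' : R3 → V₁} {g g' : R3 → V₂}
    (hf : HasWeakDeriv [k] f f') (hg : HasWeakDeriv [k] g g') (hfb : MemLpLoc f ∞)
    (h : MemLpLoc f' ∞ ∨ MemLpLoc g ∞) :
    HasWeakDeriv [k] (fun x => B (f x) (g x)) (fun x => B (f' x) (g x) + B (f x) (g' x)) := by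
  simpa [add_comm] using hg.bilin B.flip hf hfb h

/-- The Gagliardo–Nirenberg–Sobolev inequality `W^{1,1} ⊂ L^{3/2}` for weak derivatives. -/
theorem eLpNorm_le_sum_eLpNorm_weakDeriv {v : R3 → ℝ} {v' : Fin 3 → R3 → ℝ} {R : ℝ}
    (hv : ∀ k, HasWeakDeriv [k] v (v' k)) (hR : VanishesOff R v) :
    eLpNorm v (3 / 2 : ℝ≥0) volume ≤
      eLpNormLESNormFDerivOneConst (volume : Measure R3) (3 / 2 : ℝ≥0) *
        ∑ k, eLpNorm (v' k) 1 volume := by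
  have hl := (hasWeakDeriv_singleton_iff.1 (hv 0)).1
  have hl' := fun k => (hasWeakDeriv_singleton_iff.1 (hv k)).2.1
  have hm : ∀ n, AEStronglyMeasurable (mollify n v) volume :=
    fun n => (contDiff_mollify n hl).continuous.aestronglyMeasurable
  refine (Lp.eLpNorm_lim_le_liminf_eLpNorm hm v (ae_tendsto_mollify hl)).trans ?_
  refine liminf_le_of_le (by isBoundedDefault) fun b hb => ?_
  obtain ⟨n, hn⟩ := hb.exists
  refine hn.trans ?_
  have hp : NNReal.HolderConjugate (Module.finrank ℝ R3 : ℝ≥0) (3 / 2 : ℝ≥0) := by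
    rw [NNReal.holderConjugate_iff]
    rw [finrank_euclideanSpace, Fintype.card_fin]
    refine ⟨by norm_num, ?_⟩
    norm_num
  refine (eLpNorm_le_eLpNorm_fderiv_one volume ((contDiff_mollify n hl).of_le (by simp))
    (hR.hasCompactSupport_mollify n) hp).trans ?_
  gcongr
  calc eLpNorm (fderiv ℝ (mollify n v)) 1 volume
      ≤ eLpNorm (fun x => ∑ k, ‖mollify n (v' k) x‖) 1 volume := by
        refine eLpNorm_mono fun x => ?_
        rw [Real.norm_of_nonneg (Finset.sum_nonneg fun _ _ => norm_nonneg _)]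
        refine ContinuousLinearMap.opNorm_le_bound _
          (Finset.sum_nonneg fun _ _ => norm_nonneg _) fun y => ?_
        have hy : y = ∑ k, y k • EuclideanSpace.single k (1 : ℝ) := by
          ext i
          fin_cases i <;> simp [Fin.sum_univ_three]
        conv_lhs => rw [hy]
        rw [map_sum, Finset.sum_mul]
        refine (norm_sum_le _ _).trans (Finset.sum_le_sum fun k _ => ?_)
        rw [map_smul, fderiv_mollify n (hv k), norm_smul, mul_comm]
        gcongr
        exact PiLp.norm_apply_le y k
    _ ≤ ∑ k, eLpNorm (fun x => ‖mollify n (v' k) x‖) 1 volume := by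
        have := eLpNorm_sum_le (μ := (volume : Measure R3)) (s := Finset.univ) (p := 1)
          (f := fun k x => ‖mollify n (v' k) x‖)
          (fun k _ => ((contDiff_mollify n (hl' k)).continuous.norm.aestronglyMeasurable)) le_rfl
        refine le_trans (le_of_eq ?_) this
        congr 1
    _ ≤ ∑ k, eLpNorm (v' k) 1 volume := by
        refine Finset.sum_le_sum fun k _ => ?_
        rw [eLpNorm_norm]
        exact eLpNorm_mollify_le n le_rfl ENNReal.one_ne_top (hl' k).aestronglyMeasurable

end ProductRule

end CovariantPoisson

/-! ### Exchanging two covariant derivatives under the integral -/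

namespace CovariantPoisson

open Filter Topology Metric

section TendstoL2

variable {V V₁ V₂ V₃ : Type*} [NormedAddCommGroup V] [InnerProductSpace ℝ V]
  [NormedAddCommGroup V₁] [NormedSpace ℝ V₁] [NormedAddCommGroup V₂] [NormedSpace ℝ V₂]
  [NormedAddCommGroup V₃] [NormedSpace ℝ V₃]

/-- Convergence in `L²(μ)` of a sequence of square integrable functions. -/
structure TendstoL2 (μ : Measure R3) (f : ℕ → R3 → V₁) (g : R3 → V₁) : Prop where
  memLp : ∀ n, MemLp (f n) 2 μ
  memLp_lim : MemLp g 2 μ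
  tendsto : Tendsto (fun n => eLpNorm (f n - g) 2 μ) atTop (𝓝 0)

variable {μ : Measure R3}

theorem TendstoL2.add {f f' : ℕ → R3 → V₁} {g g' : R3 → V₁} (h : TendstoL2 μ f g)
    (h' : TendstoL2 μ f' g') :
    TendstoL2 μ (fun n x => f n x + f' n x) (fun x => g x + g' x) where
  memLp n := (h.memLp n).add (h'.memLp n)
  memLp_lim := h.memLp_lim.add h'.memLp_lim
  tendsto := by
    have hs := h.tendsto.add h'.tendsto
    rw [add_zero] at hs
    refine tendsto_of_tendsto_of_tendsto_of_le_of_le tendsto_const_nhds hs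
      (fun _ => zero_le) fun n => ?_
    have h1 : ((fun x => f n x + f' n x) - fun x => g x + g' x) = (f n - g) + (f' n - g') := by
      ext x; simp only [Pi.sub_apply, Pi.add_apply]; abel
    rw [h1]
    exact eLpNorm_add_le ((h.memLp n).sub h.memLp_lim).1 ((h'.memLp n).sub h'.memLp_lim).1
      (by norm_num)

theorem TendstoL2.bilin (B : V₂ →L[ℝ] V₁ →L[ℝ] V₃) {c : R3 → V₂} (hc : MemLp c ∞ μ)
    {f : ℕ → R3 → V₁} {g : R3 → V₁} (h : TendstoL2 μ f g) :
    TendstoL2 μ (fun n x => B (c x) (f n x)) (fun x => B (c x) (g x)) where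
  memLp n := B.memLp_of_bilin 2 hc (h.memLp n)
  memLp_lim := B.memLp_of_bilin 2 hc h.memLp_lim
  tendsto := by
    have hs : Tendsto (fun n => ‖B‖₊ * eLpNorm c ∞ μ * eLpNorm (f n - g) 2 μ) atTop (𝓝 0) := by
      have := ENNReal.Tendsto.const_mul (a := ‖B‖₊ * eLpNorm c ∞ μ) h.tendsto
        (Or.inr (ENNReal.mul_ne_top ENNReal.coe_ne_top hc.2.ne))
      rwa [mul_zero] at this
    refine tendsto_of_tendsto_of_tendsto_of_le_of_le tendsto_const_nhds hs
      (fun _ => zero_le) fun n => ?_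
    have h1 : ((fun x => B (c x) (f n x)) - fun x => B (c x) (g x)) =
        fun x => B (c x) ((f n - g) x) := by
      ext x; simp
    rw [h1]
    exact eLpNorm_le_eLpNorm_mul_eLpNorm_of_nnnorm hc.1 ((h.memLp n).sub h.memLp_lim).1
      (fun v u => B v u) ‖B‖₊ (Eventually.of_forall fun x => B.le_opNorm₂ _ _)

theorem integrable_inner_of_memLp_two {f g : R3 → V} (hf : MemLp f 2 μ) (hg : MemLp g 2 μ) :
    Integrable (fun x => inner ℝ (f x) (g x)) μ :=
  memLp_one_iff_integrable.1 ((innerSL ℝ).memLp_of_bilin 1 hf hg)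

theorem TendstoL2.integral_inner {f f' : ℕ → R3 → V} {g g' : R3 → V} (h : TendstoL2 μ f g)
    (h' : TendstoL2 μ f' g') :
    Tendsto (fun n => ∫ x, inner ℝ (f n x) (f' n x) ∂μ) atTop
      (𝓝 (∫ x, inner ℝ (g x) (g' x) ∂μ)) := by
  have h1 := (Lp.tendsto_Lp_iff_tendsto_eLpNorm'' f h.memLp g h.memLp_lim).2 h.tendsto
  have h2 := (Lp.tendsto_Lp_iff_tendsto_eLpNorm'' f' h'.memLp g' h'.memLp_lim).2 h'.tendsto
  have key : ∀ {u v : R3 → V} (hu : MemLp u 2 μ) (hv : MemLp v 2 μ),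
      inner ℝ (hu.toLp u) (hv.toLp v) = ∫ x, inner ℝ (u x) (v x) ∂μ := fun hu hv => by
    rw [L2.inner_def]
    refine integral_congr_ae ?_
    filter_upwards [hu.coeFn_toLp, hv.coeFn_toLp] with x hx hx'
    rw [hx, hx']
  have h3 := h1.inner (𝕜 := ℝ) h2
  simpa only [key] using h3

theorem tendstoL2_mollify [CompleteSpace V₁] {f : R3 → V₁} (hf : MemLp f 2 volume) (s : Set R3) :
    TendstoL2 (volume.restrict s) (fun n => mollify n f) f where
  memLp n := by
    refine MemLp.restrict s ⟨(contDiff_mollify n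
      (hf.locallyIntegrable (by norm_num))).continuous.aestronglyMeasurable, ?_⟩
    exact (eLpNorm_mollify_le n (by norm_num) (by norm_num) hf.1).trans_lt hf.2
  memLp_lim := hf.restrict s
  tendsto := tendsto_of_tendsto_of_tendsto_of_le_of_le tendsto_const_nhds
    (tendsto_eLpNorm_mollify_sub (by norm_num) (by norm_num) hf) (fun _ => zero_le)
    fun _ => eLpNorm_mono_measure _ Measure.restrict_le_self

end TendstoL2

variable {𝔤 : Type*} [NormedLieRing 𝔤] [CompactLieAlgebra 𝔤]

instance : FiniteDimensional ℝ 𝔤 := CompactLieAlgebra.finiteDimensional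

instance : CompleteSpace 𝔤 := FiniteDimensional.complete ℝ 𝔤

variable (𝔤) in
/-- The Lie bracket as a continuous bilinear map. -/
noncomputable def lieCLM : 𝔤 →L[ℝ] 𝔤 →L[ℝ] 𝔤 :=
  (LinearMap.mk₂ ℝ (fun x y : 𝔤 => ⁅x, y⁆) add_lie (fun c m n => smul_lie c m n) lie_add
    (fun c m n => lie_smul c m n)).toContinuousBilinearMap

theorem lieCLM_apply (x y : 𝔤) : lieCLM 𝔤 x y = ⁅x, y⁆ := rfl

theorem inner_lie_left (x y z : 𝔤) : inner ℝ x ⁅y, z⁆ = - inner ℝ ⁅y, x⁆ z :=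
  CompactLieAlgebra.inner_lie x y z

theorem inner_lie_swap (x y z : 𝔤) : inner ℝ x ⁅y, z⁆ = - inner ℝ z ⁅y, x⁆ := by
  rw [inner_lie_left, real_inner_comm]

/-- The integrand of the exchange identity: with `u_k`, `v_k` standing for partial derivatives of
`u`, `v`, and `a`, `b` for the components `A_k`, `A_l` of the potential, it is
`W(⟨∇_k u, ∇_l v⟩ - ⟨∇_l u, ∇_k v⟩) + ∂_k W ⟨u, ∇_l v⟩ - ∂_l W ⟨u, ∇_k v⟩ + W ⟨u, [F, v]⟩`. -/
def exchangeForm (W Wk Wl : ℝ) (a b F u uk ul v vk vl : 𝔤) : ℝ :=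
  inner ℝ (W • (uk + ⁅a, u⁆)) (vl + ⁅b, v⁆) - inner ℝ (W • (ul + ⁅b, u⁆)) (vk + ⁅a, v⁆) +
    inner ℝ (Wk • u) (vl + ⁅b, v⁆) - inner ℝ (Wl • u) (vk + ⁅a, v⁆) + inner ℝ (W • u) ⁅F, v⁆

/-- The exchange integrand is a divergence: `∂_k (W⟨u, v_l⟩ + ⟨b, W[v, u]⟩)` minus the same with
`k, a` and `l, b` exchanged. -/
theorem exchangeForm_eq_divergence (W Wk Wl : ℝ) (a b al bk u uk ul v vk vl vkl : 𝔤) :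
    exchangeForm W Wk Wl a b (bk - al + ⁅a, b⁆) u uk ul v vk vl =
      (Wk • inner ℝ u vl + W • (inner ℝ uk vl + inner ℝ u vkl)) -
      (Wl • inner ℝ u vk + W • (inner ℝ ul vk + inner ℝ u vkl)) +
      (inner ℝ bk (W • ⁅v, u⁆) + inner ℝ b (Wk • ⁅v, u⁆ + W • (⁅vk, u⁆ + ⁅v, uk⁆))) -
      (inner ℝ al (W • ⁅v, u⁆) + inner ℝ a (Wl • ⁅v, u⁆ + W • (⁅vl, u⁆ + ⁅v, ul⁆))) := by
  have cyc : ∀ x y z : 𝔤, inner ℝ x ⁅y, z⁆ = inner ℝ y ⁅z, x⁆ := fun x y z => by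
    rw [← lie_skew, inner_neg_right, inner_lie_swap, neg_neg]
  have h1 : (inner ℝ ⁅a, u⁆ ⁅b, v⁆ : ℝ) - inner ℝ ⁅b, u⁆ ⁅a, v⁆ + inner ℝ u ⁅⁅a, b⁆, v⁆ = 0 := by
    rw [lie_lie, inner_sub_right, inner_lie_left u a, inner_lie_left u b]
    ring
  have h2 := cyc u b v
  have h3 := cyc u a v
  have h4 := cyc u bk v
  have h5 := cyc u al v
  have h6 := cyc uk b v
  have h7 := cyc ul a v
  have h8 : (inner ℝ ⁅a, u⁆ vl : ℝ) = inner ℝ a ⁅u, vl⁆ := by rw [real_inner_comm, cyc]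
  have h9 : (inner ℝ ⁅b, u⁆ vk : ℝ) = inner ℝ b ⁅u, vk⁆ := by rw [real_inner_comm, cyc]
  have h10 : (inner ℝ a ⁅vl, u⁆ : ℝ) = - inner ℝ a ⁅u, vl⁆ := by rw [← lie_skew, inner_neg_right]
  have h11 : (inner ℝ b ⁅vk, u⁆ : ℝ) = - inner ℝ b ⁅u, vk⁆ := by rw [← lie_skew, inner_neg_right]
  simp only [exchangeForm, inner_add_left, inner_add_right, real_inner_smul_left,
    real_inner_smul_right, smul_eq_mul, add_lie, sub_lie, inner_sub_right]
  linear_combination W * h1 + Wk * h2 - Wl * h3 + W * h4 - W * h5 + W * h6 - W * h7 + W * h8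
    - W * h9 + W * h10 - W * h11

section Exchange

variable {k l : Fin 3} {a b al bk F : R3 → 𝔤} {W : R3 → ℝ}

/-- The exchange identity for smooth functions: the integrand is a combination of weak derivatives of
functions of bounded support. -/
theorem integral_exchangeForm_smooth (ha : HasWeakDeriv [l] a al) (hb : HasWeakDeriv [k] b bk)
    (hW : ContDiff ℝ ∞ W) {u v : R3 → 𝔤} (hu : ContDiff ℝ ∞ u) (hv : ContDiff ℝ ∞ v)
    {R : ℝ} (huR : VanishesOff R u) :
    ∫ x, exchangeForm (W x) (partialDeriv k W x) (partialDeriv l W x) (a x) (b x)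
      (bk x - al x + ⁅a x, b x⁆) (u x) (fderiv ℝ u x (EuclideanSpace.single k 1))
      (fderiv ℝ u x (EuclideanSpace.single l 1)) (v x)
      (fderiv ℝ v x (EuclideanSpace.single k 1))
      (fderiv ℝ v x (EuclideanSpace.single l 1)) = 0 := by
  have hsm : ∀ {f : R3 → 𝔤}, ContDiff ℝ ∞ f → ∀ i : Fin 3,
      ContDiff ℝ ∞ (fun x => fderiv ℝ f x (EuclideanSpace.single i 1)) := fun hf i =>
    (hf.fderiv_right (m := ∞) (by simp)).clm_apply contDiff_const
  have hwd : ∀ {f : R3 → 𝔤}, ContDiff ℝ ∞ f → ∀ i : Fin 3,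
      HasWeakDeriv [i] f (fun x => fderiv ℝ f x (EuclideanSpace.single i 1)) := fun hf i =>
    hasWeakDeriv_of_contDiff (hf.of_le (by simp)) i
  have hbd : ∀ {f : R3 → 𝔤}, ContDiff ℝ ∞ f → MemLpLoc f ∞ := fun hf =>
    hf.continuous.memLpLoc ∞
  set dk := fun f : R3 → 𝔤 => fun x => fderiv ℝ f x (EuclideanSpace.single k 1) with hdk
  set dl := fun f : R3 → 𝔤 => fun x => fderiv ℝ f x (EuclideanSpace.single l 1) with hdl
  have hcomm : dk (dl v) =ᵐ[volume] dl (dk v) :=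
    (hwd hv k).comm (hwd hv l) (hwd (hsm hv l) k) (hwd (hsm hv k) l)
  have D1 := ((hwd hu k).bilin (innerSL ℝ) (hwd (hsm hv l) k) (hbd (hsm hv l))
    (Or.inr (hbd hu))).smooth_smul hW
  have D2 := ((hwd hu l).bilin (innerSL ℝ) (hwd (hsm hv k) l) (hbd (hsm hv k))
    (Or.inr (hbd hu))).smooth_smul hW
  have Eψ : ∀ i, HasWeakDeriv [i] (fun x => W x • ⁅v x, u x⁆) (fun x => partialDeriv i W x •
      ⁅v x, u x⁆ + W x • (⁅fderiv ℝ v x (EuclideanSpace.single i 1), u x⁆ +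
        ⁅v x, fderiv ℝ u x (EuclideanSpace.single i 1)⁆)) := fun i =>
    ((hwd hv i).bilin (lieCLM 𝔤) (hwd hu i) (hbd hu) (Or.inr (hbd hv))).smooth_smul hW
  have cl : ∀ {f g : R3 → 𝔤}, Continuous f → Continuous g → Continuous (fun x => ⁅f x, g x⁆) :=
    fun hf hg => ((lieCLM 𝔤).continuous.comp hf).clm_apply hg
  have hψ : MemLpLoc (fun x => W x • ⁅v x, u x⁆) ∞ :=
    (hW.continuous.smul (cl hv.continuous hu.continuous)).memLpLoc ∞
  have hψ' : ∀ i : Fin 3, MemLpLoc (fun x => partialDeriv i W x •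
      ⁅v x, u x⁆ + W x • (⁅fderiv ℝ v x (EuclideanSpace.single i 1), u x⁆ +
        ⁅v x, fderiv ℝ u x (EuclideanSpace.single i 1)⁆)) ∞ := fun i =>
    Continuous.memLpLoc (((contDiff_partialDeriv hW i).continuous.smul
      (cl hv.continuous hu.continuous)).add (hW.continuous.smul
        ((cl (hsm hv i).continuous hu.continuous).add
          (cl hv.continuous (hsm hu i).continuous)))) ∞
  have D3 := hb.bilin (innerSL ℝ) (Eψ k) hψ (Or.inl (hψ' k))
  have D4 := ha.bilin (innerSL ℝ) (Eψ l) hψ (Or.inl (hψ' l))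
  have v1 : VanishesOff R (fun x => W x • (innerSL ℝ (u x)) (dl v x)) := by
    filter_upwards [huR] with x hx hxR; simp [hx hxR]
  have v2 : VanishesOff R (fun x => W x • (innerSL ℝ (u x)) (dk v x)) := by
    filter_upwards [huR] with x hx hxR; simp [hx hxR]
  have v3 : VanishesOff R (fun x => (innerSL ℝ (b x)) (W x • ⁅v x, u x⁆)) := by
    filter_upwards [huR] with x hx hxR; simp [hx hxR]
  have v4 : VanishesOff R (fun x => (innerSL ℝ (a x)) (W x • ⁅v x, u x⁆)) := by
    filter_upwards [huR] with x hx hxR; simp [hx hxR]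
  have hint : ∀ {f g : R3 → ℝ} {i : Fin 3}, HasWeakDeriv [i] f g → VanishesOff R f →
      Integrable g := fun h hv => memLp_one_iff_integrable.1
    ((h.vanishesOff hv).memLp (memLpLoc_one_iff.2 h.locallyIntegrable_right))
  have z1 := D1.integral_eq_zero v1
  have z2 := D2.integral_eq_zero v2
  have z3 := D3.integral_eq_zero v3
  have z4 := D4.integral_eq_zero v4
  have tot : ∀ {f g h j : R3 → ℝ}, Integrable f → Integrable g → Integrable h → Integrable j →
      ∫ x, f x = 0 → ∫ x, g x = 0 → ∫ x, h x = 0 → ∫ x, j x = 0 →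
      ∫ x, (f x - g x + h x - j x) = 0 := fun {f g h j} i1 i2 i3 i4 e1 e2 e3 e4 => by
    have s1 := integral_sub i1 i2
    have s2 := integral_add (i1.sub i2) i3
    have s3 := integral_sub ((i1.sub i2).add i3) i4
    simp only [Pi.add_apply, Pi.sub_apply] at s1 s2 s3
    rw [s3, s2, s1, e1, e2, e3, e4]
    norm_num
  rw [← tot (hint D1 v1) (hint D2 v2) (hint D3 v3) (hint D4 v4) z1 z2 z3 z4]
  refine integral_congr_ae ?_
  filter_upwards [hcomm] with x hx
  rw [exchangeForm_eq_divergence (vkl := dk (dl v) x)]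
  have hx' : (fderiv ℝ (fun x => fderiv ℝ v x (EuclideanSpace.single k 1)) x)
    (EuclideanSpace.single l 1) = dk (dl v) x := hx.symm
  rw [hx']
  rfl

/-- **Exchange of covariant derivatives.** For `H¹` functions of bounded support the integrand
`exchangeForm` is integrable with integral zero. Both functions are mollified: only first
derivatives enter the integrand, and it is continuous in `H¹`. -/
theorem integral_exchangeForm (hab : MemLpLoc a ∞) (hbb : MemLpLoc b ∞)
    (ha : HasWeakDeriv [l] a al) (hb : HasWeakDeriv [k] b bk) (hF : MemLpLoc F ∞)
    (hFeq : F =ᵐ[volume] fun x => bk x - al x + ⁅a x, b x⁆) (hW : ContDiff ℝ ∞ W)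
    {u uk ul v vk vl : R3 → 𝔤}
    (huk : HasWeakDeriv [k] u uk) (hul : HasWeakDeriv [l] u ul)
    (hvk : HasWeakDeriv [k] v vk) (hvl : HasWeakDeriv [l] v vl)
    (lu : MemLpLoc u 2) (luk : MemLpLoc uk 2) (lul : MemLpLoc ul 2)
    (lv : MemLpLoc v 2) (lvk : MemLpLoc vk 2) (lvl : MemLpLoc vl 2)
    {R : ℝ} (huR : VanishesOff R u) (hvR : VanishesOff R v) :
    Integrable (fun x => exchangeForm (W x) (partialDeriv k W x) (partialDeriv l W x) (a x) (b x)
      (F x) (u x) (uk x) (ul x) (v x) (vk x) (vl x)) ∧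
    ∫ x, exchangeForm (W x) (partialDeriv k W x) (partialDeriv l W x) (a x) (b x)
      (F x) (u x) (uk x) (ul x) (v x) (vk x) (vl x) = 0 := by
  set K : Set R3 := closedBall 0 (R + 1) with hK
  have hKc : IsCompact K := isCompact_closedBall _ _
  set μ : Measure R3 := volume.restrict K with hμ
  have hWk := contDiff_partialDeriv hW k
  have hWl := contDiff_partialDeriv hW l
  have bW := hW.continuous.memLpLoc ∞ K hKc
  have bWk := hWk.continuous.memLpLoc ∞ K hKc
  have bWl := hWl.continuous.memLpLoc ∞ K hKc
  have ba := hab K hKc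
  have bb := hbb K hKc
  have bF := hF K hKc
  have tu := tendstoL2_mollify (huR.memLp lu) K
  have tuk := tendstoL2_mollify ((huk.vanishesOff huR).memLp luk) K
  have tul := tendstoL2_mollify ((hul.vanishesOff huR).memLp lul) K
  have tv := tendstoL2_mollify (hvR.memLp lv) K
  have tvk := tendstoL2_mollify ((hvk.vanishesOff hvR).memLp lvk) K
  have tvl := tendstoL2_mollify ((hvl.vanishesOff hvR).memLp lvl) K
  have X1 := (tuk.add (tu.bilin (lieCLM 𝔤) ba)).bilin (ContinuousLinearMap.lsmul ℝ ℝ) bW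
  have X2 := (tul.add (tu.bilin (lieCLM 𝔤) bb)).bilin (ContinuousLinearMap.lsmul ℝ ℝ) bW
  have X3 := tu.bilin (ContinuousLinearMap.lsmul ℝ ℝ) bWk
  have X4 := tu.bilin (ContinuousLinearMap.lsmul ℝ ℝ) bWl
  have X5 := tu.bilin (ContinuousLinearMap.lsmul ℝ ℝ) bW
  have Y1 := tvl.add (tv.bilin (lieCLM 𝔤) bb)
  have Y2 := tvk.add (tv.bilin (lieCLM 𝔤) ba)
  have Y5 := tv.bilin (lieCLM 𝔤) bF
  have expand : ∀ {x1 y1 x2 y2 x3 x4 x5 y5 : R3 → 𝔤}, MemLp x1 2 μ → MemLp y1 2 μ → MemLp x2 2 μ →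
      MemLp y2 2 μ → MemLp x3 2 μ → MemLp x4 2 μ → MemLp x5 2 μ → MemLp y5 2 μ →
      Integrable (fun x => inner ℝ (x1 x) (y1 x) - inner ℝ (x2 x) (y2 x) + inner ℝ (x3 x) (y1 x) -
        inner ℝ (x4 x) (y2 x) + inner ℝ (x5 x) (y5 x)) μ ∧
      ∫ x, (inner ℝ (x1 x) (y1 x) - inner ℝ (x2 x) (y2 x) + inner ℝ (x3 x) (y1 x) -
        inner ℝ (x4 x) (y2 x) + inner ℝ (x5 x) (y5 x)) ∂μ =
      (∫ x, inner ℝ (x1 x) (y1 x) ∂μ) - (∫ x, inner ℝ (x2 x) (y2 x) ∂μ) +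
      (∫ x, inner ℝ (x3 x) (y1 x) ∂μ) - (∫ x, inner ℝ (x4 x) (y2 x) ∂μ) +
      ∫ x, inner ℝ (x5 x) (y5 x) ∂μ := fun {x1 y1 x2 y2 x3 x4 x5 y5} m1 n1 m2 n2 m3 m4 m5 n5 => by
    have i1 := integrable_inner_of_memLp_two m1 n1
    have i2 := integrable_inner_of_memLp_two m2 n2
    have i3 := integrable_inner_of_memLp_two m3 n1
    have i4 := integrable_inner_of_memLp_two m4 n2
    have i5 := integrable_inner_of_memLp_two m5 n5
    refine ⟨(((i1.sub i2).add i3).sub i4).add i5, ?_⟩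
    have s1 := integral_sub i1 i2
    have s2 := integral_add (i1.sub i2) i3
    have s3 := integral_sub ((i1.sub i2).add i3) i4
    have s4 := integral_add (((i1.sub i2).add i3).sub i4) i5
    simp only [Pi.add_apply, Pi.sub_apply] at s1 s2 s3 s4
    rw [s4, s3, s2, s1]
  have hvan : VanishesOff (R + 1) (fun x => exchangeForm (W x) (partialDeriv k W x)
      (partialDeriv l W x) (a x) (b x) (F x) (u x) (uk x) (ul x) (v x) (vk x) (vl x)) := by
    filter_upwards [huR, huk.vanishesOff huR, hul.vanishesOff huR] with x h1 h2 h3 hx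
    have hx' : R < ‖x‖ := by linarith
    simp [exchangeForm, h1 hx', h2 hx', h3 hx']
  obtain ⟨hi, he⟩ := expand X1.memLp_lim Y1.memLp_lim X2.memLp_lim Y2.memLp_lim X3.memLp_lim
    X4.memLp_lim X5.memLp_lim Y5.memLp_lim
  have hcompl : ∀ {f : R3 → ℝ}, VanishesOff (R + 1) f → ∀ᵐ x, x ∉ K → f x = 0 := fun hf => by
    filter_upwards [hf] with x hx hxK
    exact hx (by simpa [hK] using hxK)
  have hset := setIntegral_eq_integral_of_ae_compl_eq_zero (hcompl hvan)
  constructor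
  · exact (IntegrableOn.integrable_of_ae_notMem_eq_zero hi (hcompl hvan))
  rw [← hset]
  -- The same integral for the mollified functions vanishes.
  have hzero : ∀ n, ∫ x in K, exchangeForm (W x) (partialDeriv k W x) (partialDeriv l W x)
      (a x) (b x) (F x) (mollify n u x) (mollify n uk x) (mollify n ul x) (mollify n v x)
      (mollify n vk x) (mollify n vl x) = 0 := fun n => by
    have hs := integral_exchangeForm_smooth ha hb hW (contDiff_mollify n huk.locallyIntegrable_left)
      (contDiff_mollify n hvk.locallyIntegrable_left) (huR.mollify n)
    simp only [fderiv_mollify n huk, fderiv_mollify n hul, fderiv_mollify n hvk,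
      fderiv_mollify n hvl] at hs
    have hvn : VanishesOff (R + 1) (fun x => exchangeForm (W x) (partialDeriv k W x)
        (partialDeriv l W x) (a x) (b x) (F x) (mollify n u x) (mollify n uk x) (mollify n ul x)
        (mollify n v x) (mollify n vk x) (mollify n vl x)) := by
      filter_upwards [huR.mollify n, (huk.vanishesOff huR).mollify n,
        (hul.vanishesOff huR).mollify n] with x h1 h2 h3 hx
      simp [exchangeForm, h1 hx, h2 hx, h3 hx]
    rw [setIntegral_eq_integral_of_ae_compl_eq_zero (hcompl hvn), ← hs]
    refine integral_congr_ae ?_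
    filter_upwards [hFeq] with x hx
    rw [hx]
  have hlim := ((((X1.integral_inner Y1).sub (X2.integral_inner Y2)).add
    (X3.integral_inner Y1)).sub (X4.integral_inner Y2)).add (X5.integral_inner Y5)
  rw [← he] at hlim
  refine tendsto_nhds_unique hlim (tendsto_const_nhds.congr fun n => ?_)
  rw [← (expand (X1.memLp n) (Y1.memLp n) (X2.memLp n) (Y2.memLp n) (X3.memLp n)
    (X4.memLp n) (X5.memLp n) (Y5.memLp n)).2]
  exact (hzero n).symm

end Exchange

end CovariantPoisson

/-! ### A regularity scale and covariant derivatives on it -/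

namespace CovariantPoisson

open Filter Topology Metric

section Reg

variable {V V₁ V₂ V₃ : Type*} [NormedAddCommGroup V] [NormedSpace ℝ V]
  [NormedAddCommGroup V₁] [NormedSpace ℝ V₁] [NormedAddCommGroup V₂] [NormedSpace ℝ V₂]
  [NormedAddCommGroup V₃] [NormedSpace ℝ V₃]

/-- The local integrability exponents of the regularity scale: `r, 2, ∞, ∞, …`. -/
def regExp (r : ℝ≥0∞) : ℕ → ℝ≥0∞
  | 0 => r
  | 1 => 2
  | _ + 2 => ∞

/-- The regularity scale: `Reg r j f` says that `f` has weak derivatives up to order `j`, those of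
order `j` being in `L^r_loc`, those of order `j - 1` in `L²_loc` and all lower ones in
`L^∞_loc`. -/
def Reg (r : ℝ≥0∞) : ℕ → (R3 → V) → Prop
  | 0, f => MemLpLoc f r
  | j + 1, f => MemLpLoc f (regExp r (j + 1)) ∧ ∀ k, ∃ g, HasWeakDeriv [k] f g ∧ Reg r j g

variable {r : ℝ≥0∞}

theorem regExp_mono (hr : r ≤ 2) {i j : ℕ} (h : i ≤ j) : regExp r i ≤ regExp r j := by
  rcases j with _ | _ | j
  · rw [Nat.le_zero.1 h]
  · rcases i with _ | _ | i
    · exact hr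
    · exact le_rfl
    · omega
  · exact le_top

theorem one_le_regExp (hr1 : 1 ≤ r) : ∀ j, 1 ≤ regExp r j
  | 0 => hr1
  | 1 => by norm_num [regExp]
  | _ + 2 => le_top

theorem Reg.memLpLoc {j : ℕ} {f : R3 → V} (h : Reg r j f) : MemLpLoc f (regExp r j) := by
  cases j with
  | zero => exact h
  | succ j => exact h.1

theorem Reg.memLpLoc_top {j : ℕ} {f : R3 → V} (h : Reg r j f) (hj : 2 ≤ j) : MemLpLoc f ∞ := by
  obtain ⟨i, rfl⟩ : ∃ i, j = i + 2 := ⟨j - 2, by omega⟩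
  exact h.1

theorem Reg.memLpLoc_two {j : ℕ} {f : R3 → V} (hr2 : r ≤ 2) (h : Reg r j f) (hj : 1 ≤ j) :
    MemLpLoc f 2 := h.memLpLoc.mono_exponent (regExp_mono hr2 hj)

theorem Reg.locallyIntegrable {j : ℕ} {f : R3 → V} (hr1 : 1 ≤ r) (h : Reg r j f) :
    LocallyIntegrable f := h.memLpLoc.locallyIntegrable (one_le_regExp hr1 j)

theorem Reg.congr {j : ℕ} {f g : R3 → V} (h : Reg r j f) (hfg : f =ᵐ[volume] g) : Reg r j g := by
  cases j with
  | zero => exact MemLpLoc.congr h hfg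
  | succ j =>
    refine ⟨h.1.congr hfg, fun k => ?_⟩
    obtain ⟨f', hf', hf''⟩ := h.2 k
    exact ⟨f', hf'.congr hfg .rfl, hf''⟩

theorem Reg.add {j : ℕ} {f g : R3 → V} (hf : Reg r j f) (hg : Reg r j g) :
    Reg r j (fun x => f x + g x) := by
  induction j generalizing f g with
  | zero => exact MemLpLoc.add hf hg
  | succ j ih =>
    refine ⟨hf.1.add hg.1, fun k => ?_⟩
    obtain ⟨f', hf', hf''⟩ := hf.2 k
    obtain ⟨g', hg', hg''⟩ := hg.2 k
    exact ⟨_, hf'.add hg', ih hf'' hg''⟩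

theorem Reg.clm_comp [CompleteSpace V₁] [CompleteSpace V₂] {j : ℕ} {f : R3 → V₁}
    (L : V₁ →L[ℝ] V₂) (hf : Reg r j f) : Reg r j (fun x => L (f x)) := by
  induction j generalizing f with
  | zero => exact MemLpLoc.clm_comp L hf
  | succ j ih =>
    refine ⟨hf.1.clm_comp L, fun k => ?_⟩
    obtain ⟨f', hf', hf''⟩ := hf.2 k
    exact ⟨_, hf'.clm_comp L, ih hf''⟩

theorem Reg.neg [CompleteSpace V] {j : ℕ} {f : R3 → V} (hf : Reg r j f) :
    Reg r j (fun x => - f x) := hf.clm_comp (-ContinuousLinearMap.id ℝ V)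

theorem Reg.sub [CompleteSpace V] {j : ℕ} {f g : R3 → V} (hf : Reg r j f) (hg : Reg r j g) :
    Reg r j (fun x => f x - g x) := by
  simpa only [sub_eq_add_neg] using hf.add hg.neg

theorem reg_zero (j : ℕ) : Reg r j (fun _ : R3 => (0 : V)) := by
  induction j with
  | zero => exact memLpLoc_zero
  | succ j ih => exact ⟨memLpLoc_zero, fun k => ⟨_, hasWeakDeriv_zero k, ih⟩⟩

theorem Reg.sum {ι : Type*} (s : Finset ι) {j : ℕ} {f : ι → R3 → V}
    (h : ∀ i ∈ s, Reg r j (f i)) : Reg r j (fun x => ∑ i ∈ s, f i x) := by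
  classical
  induction s using Finset.induction_on with
  | empty => simpa using reg_zero j
  | insert a s ha ih =>
    simp only [Finset.sum_insert ha]
    exact (h a (by simp)).add (ih fun i hi => h i (by simp [hi]))

theorem Reg.pred (hr2 : r ≤ 2) {j : ℕ} {f : R3 → V} (hf : Reg r (j + 1) f) : Reg r j f := by
  induction j generalizing f with
  | zero => exact hf.1.mono_exponent (regExp_mono (i := 0) hr2 (by omega))
  | succ j ih =>
    refine ⟨hf.1.mono_exponent (regExp_mono hr2 (by omega)), fun k => ?_⟩
    obtain ⟨f', hf', hf''⟩ := hf.2 k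
    exact ⟨f', hf', ih hf''⟩

theorem Reg.mono (hr2 : r ≤ 2) {i j : ℕ} {f : R3 → V} (hf : Reg r j f) (h : i ≤ j) :
    Reg r i f := by
  induction h with
  | refl => exact hf
  | step _ ih => exact ih (hf.pred hr2)

theorem weakPartial_spec {k : Fin 3} {f g : R3 → V} (h : HasWeakDeriv [k] f g) :
    HasWeakDeriv [k] f (weakPartial k f) := by
  have hex : ∃ g, HasWeakDeriv [k] f g := ⟨g, h⟩
  rw [weakPartial, dif_pos hex]
  exact hex.choose_spec

theorem weakPartial_ae_eq [CompleteSpace V] {k : Fin 3} {f g : R3 → V}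
    (h : HasWeakDeriv [k] f g) : weakPartial k f =ᵐ[volume] g :=
  (weakPartial_spec h).ae_eq h

theorem weakPartial_congr {k : Fin 3} {f g : R3 → V} (h : f =ᵐ[volume] g) :
    weakPartial k f = weakPartial k g := by
  have hp : HasWeakDeriv [k] f = HasWeakDeriv [k] g :=
    funext fun u => propext ⟨fun hu => hu.congr h .rfl, fun hu => hu.congr h.symm .rfl⟩
  unfold weakPartial
  rw [hp]

theorem Reg.hasWeakDeriv {j : ℕ} {f : R3 → V} (hf : Reg r (j + 1) f) (k : Fin 3) :
    HasWeakDeriv [k] f (weakPartial k f) := by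
  obtain ⟨g, hg, -⟩ := hf.2 k
  exact weakPartial_spec hg

theorem Reg.weakPartial [CompleteSpace V] {j : ℕ} {f : R3 → V} (hf : Reg r (j + 1) f)
    (k : Fin 3) : Reg r j (weakPartial k f) := by
  obtain ⟨g, hg, hg'⟩ := hf.2 k
  exact hg'.congr (weakPartial_ae_eq hg).symm

/-- The weak product rule on the regularity scale. The condition `N + 1 ≤ i + j` with `i, j ≤ N` and
`3 ≤ N` forces one factor to be locally bounded, and then the other factor or the derivative of the
first is so too. -/
theorem Reg.hasWeakDeriv_bilin [FiniteDimensional ℝ V₁] [FiniteDimensional ℝ V₂]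
    [CompleteSpace V₃] (B : V₁ →L[ℝ] V₂ →L[ℝ] V₃) {N i j : ℕ} (hN : 3 ≤ N) (hi : i ≤ N)
    (hj : j ≤ N) (hij : N + 1 ≤ i + j) {f f' : R3 → V₁} {g g' : R3 → V₂} {k : Fin 3}
    (hf : Reg r i f) (hg : Reg r j g) (hf' : HasWeakDeriv [k] f f') (hg' : HasWeakDeriv [k] g g')
    (rf' : Reg r (i - 1) f') (rg' : Reg r (j - 1) g') :
    HasWeakDeriv [k] (fun x => B (f x) (g x)) (fun x => B (f' x) (g x) + B (f x) (g' x)) := by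
  have : CompleteSpace V₁ := FiniteDimensional.complete ℝ V₁
  have : CompleteSpace V₂ := FiniteDimensional.complete ℝ V₂
  by_cases h2 : 2 ≤ j
  · refine hf'.bilin B hg' (hg.memLpLoc_top h2) ?_
    by_cases h1 : 2 ≤ i
    · exact Or.inr (hf.memLpLoc_top h1)
    · exact Or.inl (rg'.memLpLoc_top (by omega))
  · exact hf'.bilin' B hg' (hf.memLpLoc_top (by omega)) (Or.inl (rf'.memLpLoc_top (by omega)))

/-- Products on the regularity scale. Think of a function in `Reg r i` as having weight `N - i`;
then weights add. -/
theorem Reg.bilin [FiniteDimensional ℝ V₁] [FiniteDimensional ℝ V₂] [CompleteSpace V₃]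
    (hr2 : r ≤ 2) (B : V₁ →L[ℝ] V₂ →L[ℝ] V₃) {N m i j : ℕ} (hN : 3 ≤ N)
    (hi : i ≤ N) (hj : j ≤ N) (hij : i + j = N + m) {f : R3 → V₁} {g : R3 → V₂}
    (hf : Reg r i f) (hg : Reg r j g) : Reg r m (fun x => B (f x) (g x)) := by
  have hmem : ∀ {m i j : ℕ}, i ≤ N → j ≤ N → i + j = N + m → ∀ {f : R3 → V₁} {g : R3 → V₂},
      Reg r i f → Reg r j g → MemLpLoc (fun x => B (f x) (g x)) (regExp r m) := by
    intro m i j hi hj hij f g hf hg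
    by_cases h : 2 ≤ j
    · exact (MemLpLoc.bilin (regExp r i) B hf.memLpLoc (hg.memLpLoc_top h)).mono_exponent
        (regExp_mono hr2 (by omega))
    · exact (MemLpLoc.bilin (regExp r j) B (hf.memLpLoc_top (by omega)) hg.memLpLoc).mono_exponent
        (regExp_mono hr2 (by omega))
  induction m generalizing i j f g with
  | zero => exact hmem hi hj hij hf hg
  | succ m ih =>
    refine ⟨hmem hi hj hij hf hg, fun k => ?_⟩
    obtain ⟨i, rfl⟩ : ∃ i', i = i' + 1 := ⟨i - 1, by omega⟩
    obtain ⟨j, rfl⟩ : ∃ j', j = j' + 1 := ⟨j - 1, by omega⟩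
    obtain ⟨f', hf', rf'⟩ := hf.2 k
    obtain ⟨g', hg', rg'⟩ := hg.2 k
    exact ⟨_, Reg.hasWeakDeriv_bilin B hN hi hj (by omega) hf hg hf' hg' rf' rg',
      (ih (by omega) hj (by omega) rf' hg).add (ih hi (by omega) (by omega) hf rg')⟩

theorem reg_of_contDiff {m : ℕ} {f : R3 → V} (hf : ContDiff ℝ m f) : Reg r m f := by
  induction m generalizing f with
  | zero => exact hf.continuous.memLpLoc r
  | succ m ih =>
    refine ⟨hf.continuous.memLpLoc _, fun k => ⟨_, hasWeakDeriv_of_contDiff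
      (hf.of_le (by exact_mod_cast Nat.le_add_left 1 m)) k, ih ?_⟩⟩
    exact (hf.fderiv_right (m := m) (by norm_cast)).clm_apply contDiff_const

/-- A `C^M` function whose weak derivatives of orders `M + 1` and `M + 2` lie in `L²_loc` and
`L^r_loc` has regularity `M + 2`. -/
theorem reg_of_contDiff_of_weakDerivs {M : ℕ} {f : R3 → V} (hf : ContDiff ℝ M f)
    (h1 : WeakDerivsMemLpLoc (M + 1) f 2) (h2 : WeakDerivsMemLpLoc (M + 2) f r) :
    Reg r (M + 2) f := by
  induction M generalizing f with
  | zero =>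
    refine ⟨hf.continuous.memLpLoc _, fun k => ?_⟩
    obtain ⟨g, hg, hg'⟩ := h1 [k] rfl
    refine ⟨g, hg, hg', fun l => ?_⟩
    obtain ⟨h, hh, hh'⟩ := h2 [k, l] rfl
    exact ⟨h, hg.of_append (β := [k]) hh, hh'⟩
  | succ M ih =>
    refine ⟨hf.continuous.memLpLoc _, fun k => ?_⟩
    have hd := hasWeakDeriv_of_contDiff (hf.of_le (by exact_mod_cast Nat.le_add_left 1 M)) k
    refine ⟨_, hd, ih ((hf.fderiv_right (m := M) (by norm_cast)).clm_apply contDiff_const)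
      (fun α hα => ?_) (fun α hα => ?_)⟩
    · obtain ⟨g, hg, hg'⟩ := h1 (k :: α) (by simp [hα])
      exact ⟨g, hd.of_cons hg, hg'⟩
    · obtain ⟨g, hg, hg'⟩ := h2 (k :: α) (by simp [hα])
      exact ⟨g, hd.of_cons hg, hg'⟩

end Reg

section Covariant

variable {𝔤 : Type*} [NormedLieRing 𝔤] [CompactLieAlgebra 𝔤]

/-- A potential `A` of regularity `N - 1 ≥ 2` on the scale with exponent `r`. Covariant
differentiation then acts on the scale up to level `N`. -/
structure RegPotential (r : ℝ≥0∞) (N : ℕ) (A : Fin 3 → R3 → 𝔤) : Prop where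
  one_le : 1 ≤ r
  le_two : r ≤ 2
  three_le : 3 ≤ N
  reg : ∀ k, Reg r (N - 1) (A k)

variable {r : ℝ≥0∞} {N : ℕ} {A : Fin 3 → R3 → 𝔤}

theorem covDeriv_ae_eq (A : Fin 3 → R3 → 𝔤) {k : Fin 3} {X X' : R3 → 𝔤}
    (h : HasWeakDeriv [k] X X') :
    covDeriv A k X =ᵐ[volume] fun x => X' x + ⁅A k x, X x⁆ := by
  filter_upwards [weakPartial_ae_eq h] with x hx
  simp only [covDeriv, hx]

theorem covDeriv_congr (A : Fin 3 → R3 → 𝔤) {k : Fin 3} {X Y : R3 → 𝔤} (h : X =ᵐ[volume] Y) :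
    covDeriv A k X =ᵐ[volume] covDeriv A k Y := by
  filter_upwards [h] with x hx
  simp only [covDeriv, hx, weakPartial_congr h]

theorem covDeriv_add (A : Fin 3 → R3 → 𝔤) {k : Fin 3} {X X' Y Y' : R3 → 𝔤}
    (hX : HasWeakDeriv [k] X X') (hY : HasWeakDeriv [k] Y Y') :
    covDeriv A k (fun x => X x + Y x) =ᵐ[volume] fun x => covDeriv A k X x + covDeriv A k Y x := by
  filter_upwards [covDeriv_ae_eq A hX, covDeriv_ae_eq A hY, covDeriv_ae_eq A (hX.add hY)]
    with x h1 h2 h3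
  rw [h1, h2, h3, lie_add]
  abel

theorem covDeriv_sub (A : Fin 3 → R3 → 𝔤) {k : Fin 3} {X X' Y Y' : R3 → 𝔤}
    (hX : HasWeakDeriv [k] X X') (hY : HasWeakDeriv [k] Y Y') :
    covDeriv A k (fun x => X x - Y x) =ᵐ[volume] fun x => covDeriv A k X x - covDeriv A k Y x := by
  filter_upwards [covDeriv_ae_eq A hX, covDeriv_ae_eq A hY, covDeriv_ae_eq A (hX.sub hY)]
    with x h1 h2 h3
  rw [h1, h2, h3, lie_sub]
  abel

theorem covDeriv_zero (A : Fin 3 → R3 → 𝔤) (k : Fin 3) :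
    covDeriv A k (fun _ => 0) =ᵐ[volume] fun _ => 0 := by
  filter_upwards [covDeriv_ae_eq A (hasWeakDeriv_zero k)] with x h
  simp [h]

theorem covDeriv_sum (A : Fin 3 → R3 → 𝔤) {ι : Type*} (s : Finset ι) {k : Fin 3}
    {X X' : ι → R3 → 𝔤} (h : ∀ i ∈ s, HasWeakDeriv [k] (X i) (X' i)) :
    covDeriv A k (fun x => ∑ i ∈ s, X i x) =ᵐ[volume] fun x => ∑ i ∈ s, covDeriv A k (X i) x := by
  classical
  induction s using Finset.induction_on with
  | empty => simpa using covDeriv_zero A k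
  | insert a s ha ih =>
    simp only [Finset.sum_insert ha]
    have h' := fun i hi => h i (Finset.mem_insert_of_mem hi)
    filter_upwards [covDeriv_add A (h a (by simp)) (HasWeakDeriv.sum s h'), ih h'] with x h1 h2
    rw [h1, h2]

theorem RegPotential.reg_covDeriv (hA : RegPotential r N A) {j : ℕ} (hj : j + 1 ≤ N) {X : R3 → 𝔤}
    (hX : Reg r (j + 1) X) (k : Fin 3) : Reg r j (covDeriv A k X) :=
  (hX.weakPartial k).add (Reg.bilin hA.le_two (lieCLM 𝔤) (m := j) hA.three_le (by omega) hj
    (by have := hA.three_le; omega) (hA.reg k) hX)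

theorem RegPotential.reg_covDeriv' (hA : RegPotential r N A) {i j : ℕ} (hi : i ≤ N) (hij : j < i)
    {X : R3 → 𝔤} (hX : Reg r i X) (k : Fin 3) : Reg r j (covDeriv A k X) :=
  hA.reg_covDeriv (by omega) (hX.mono hA.le_two hij) k

theorem RegPotential.reg_curvature (hA : RegPotential r N A) (i : Fin 3 × Fin 3) :
    Reg r (N - 2) (curvature A i) := by
  have h3 := hA.three_le
  have h1 : ∀ k l, Reg r (N - 2) (weakPartial l (A k)) := fun k l =>
    Reg.weakPartial (by have := hA.reg k; rwa [show N - 1 = N - 2 + 1 by omega] at this) l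
  exact ((h1 i.1 i.2).sub (h1 i.2 i.1)).sub (Reg.bilin hA.le_two (lieCLM 𝔤) h3
    (by omega) (by omega) (by omega) (hA.reg i.1) (hA.reg i.2))

theorem RegPotential.reg_divCurvature (hA : RegPotential r N A) (l : Fin 3) :
    Reg r (N - 3) (divCurvature A l) := by
  have h3 := hA.three_le
  exact Reg.sum _ fun j _ => hA.reg_covDeriv' (i := N - 2) (by omega) (by omega)
    (hA.reg_curvature _) j

/-- Leibniz rule for the bracket. -/
theorem RegPotential.covDeriv_lie (hA : RegPotential r N A) {i j : ℕ} (hi : i ≤ N) (hj : j ≤ N)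
    (hij : N + 1 ≤ i + j) {H X : R3 → 𝔤} (hH : Reg r i H) (hX : Reg r j X) (k : Fin 3) :
    covDeriv A k (fun x => ⁅H x, X x⁆) =ᵐ[volume]
      fun x => ⁅covDeriv A k H x, X x⁆ + ⁅H x, covDeriv A k X x⁆ := by
  obtain ⟨i, rfl⟩ : ∃ i', i = i' + 1 := ⟨i - 1, by omega⟩
  obtain ⟨j, rfl⟩ : ∃ j', j = j' + 1 := ⟨j - 1, by omega⟩
  have := Reg.hasWeakDeriv_bilin (lieCLM 𝔤) hA.three_le hi hj hij hH hX (hH.hasWeakDeriv k)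
    (hX.hasWeakDeriv k) (hH.weakPartial k) (hX.weakPartial k)
  filter_upwards [covDeriv_ae_eq A this] with x hx
  simp only [lieCLM_apply] at hx
  rw [hx]
  simp only [covDeriv, add_lie, lie_add]
  rw [leibniz_lie (A k x) (H x) (X x)]
  abel

theorem RegPotential.hasWeakDeriv_lie (hA : RegPotential r N A) {i j : ℕ} (hi : i ≤ N) (hj : j ≤ N)
    (hij : N + 1 ≤ i + j) {H X : R3 → 𝔤} (hH : Reg r i H) (hX : Reg r j X) (k : Fin 3) :
    HasWeakDeriv [k] (fun x => ⁅H x, X x⁆)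
      (fun x => ⁅weakPartial k H x, X x⁆ + ⁅H x, weakPartial k X x⁆) := by
  obtain ⟨i, rfl⟩ : ∃ i', i = i' + 1 := ⟨i - 1, by omega⟩
  obtain ⟨j, rfl⟩ : ∃ j', j = j' + 1 := ⟨j - 1, by omega⟩
  exact Reg.hasWeakDeriv_bilin (lieCLM 𝔤) hA.three_le hi hj hij hH hX (hH.hasWeakDeriv k)
    (hX.hasWeakDeriv k) (hH.weakPartial k) (hX.weakPartial k)

/-- The curvature is the commutator of covariant derivatives: `[∇_k, ∇_l] X = -[G_{kl}, X]`. -/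
theorem RegPotential.covDeriv_comm (hA : RegPotential r N A) {j : ℕ} (hj : j + 2 ≤ N) {X : R3 → 𝔤}
    (hX : Reg r (j + 2) X) (k l : Fin 3) :
    covDeriv A k (covDeriv A l X) =ᵐ[volume]
      fun x => covDeriv A l (covDeriv A k X) x - ⁅curvature A (k, l) x, X x⁆ := by
  have h3 := hA.three_le
  have hd : ∀ k l, HasWeakDeriv [k] (covDeriv A l X) (fun x => weakPartial k (weakPartial l X) x +
      (⁅weakPartial k (A l) x, X x⁆ + ⁅A l x, weakPartial k X x⁆)) := fun k l =>
    ((hX.weakPartial l).hasWeakDeriv k).add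
      (hA.hasWeakDeriv_lie (by omega) hj (by omega) (hA.reg l) hX k)
  have hsymm := (hX.hasWeakDeriv k).comm (hX.hasWeakDeriv l)
    ((hX.weakPartial l).hasWeakDeriv k) ((hX.weakPartial k).hasWeakDeriv l)
  filter_upwards [covDeriv_ae_eq A (hd k l), covDeriv_ae_eq A (hd l k), hsymm] with x h1 h2 h4
  rw [h1, h2, h4]
  simp only [covDeriv, curvature, lie_add, sub_lie]
  rw [leibniz_lie (A k x) (A l x) (X x)]
  abel

/-- `[Δ(A), ∇_l] X = -[(∇·G)_l, X] - 2 ∑ₖ [G_{kl}, ∇_k X]`. -/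
theorem RegPotential.covLaplacian_covDeriv (hA : RegPotential r N A) {j : ℕ} (hj : j + 3 ≤ N)
    {X : R3 → 𝔤} (hX : Reg r (j + 3) X) (l : Fin 3) :
    covLaplacian A (covDeriv A l X) =ᵐ[volume] fun x => covDeriv A l (covLaplacian A X) x -
      (⁅divCurvature A l x, X x⁆ + ∑ k, (⁅curvature A (k, l) x, covDeriv A k X x⁆ +
        ⁅curvature A (k, l) x, covDeriv A k X x⁆)) := by
  have h3 := hA.three_le
  have r1 : ∀ k, Reg r (j + 2) (covDeriv A k X) := fun k => hA.reg_covDeriv (by omega) hX k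
  have r2 : ∀ k l, Reg r (j + 1) (covDeriv A k (covDeriv A l X)) := fun k l =>
    hA.reg_covDeriv (by omega) (r1 l) k
  have hk : ∀ k, covDeriv A k (covDeriv A k (covDeriv A l X)) =ᵐ[volume] fun x =>
      covDeriv A l (covDeriv A k (covDeriv A k X)) x - (⁅covDeriv A k (curvature A (k, l)) x, X x⁆ +
        (⁅curvature A (k, l) x, covDeriv A k X x⁆ +
          ⁅curvature A (k, l) x, covDeriv A k X x⁆)) := fun k => by
    have e1 := covDeriv_congr A (k := k) (hA.covDeriv_comm (by omega) hX k l)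
    have e2 := covDeriv_sub A ((r2 l k).hasWeakDeriv k)
      (hA.hasWeakDeriv_lie (i := N - 2) (by omega) hj (by omega) (hA.reg_curvature (k, l)) hX k)
    have e3 := hA.covDeriv_lie (i := N - 2) (by omega) hj (by omega)
      (hA.reg_curvature (k, l)) hX k
    have e4 := hA.covDeriv_comm (by omega) (r1 k) k l
    filter_upwards [e1, e2, e3, e4] with x h1 h2 h3 h4
    rw [h1, h2, h3, h4]
    abel
  have hs := covDeriv_sum A Finset.univ (fun k (_ : k ∈ Finset.univ) => (r2 k k).hasWeakDeriv l)
  have hall : ∀ᵐ x, ∀ k, covDeriv A k (covDeriv A k (covDeriv A l X)) x =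
      covDeriv A l (covDeriv A k (covDeriv A k X)) x - (⁅covDeriv A k (curvature A (k, l)) x, X x⁆ +
        (⁅curvature A (k, l) x, covDeriv A k X x⁆ +
          ⁅curvature A (k, l) x, covDeriv A k X x⁆)) := ae_all_iff.2 hk
  filter_upwards [hall, hs] with x h1 h2
  have h2' : covDeriv A l (covLaplacian A X) x =
      ∑ k, covDeriv A l (covDeriv A k (covDeriv A k X)) x := h2
  rw [h2']
  simp only [covLaplacian, divCurvature, h1, Finset.sum_sub_distrib, Finset.sum_add_distrib,
    sum_lie]

theorem RegPotential.reg_covLaplacian (hA : RegPotential r N A) {i j : ℕ} (hi : i ≤ N)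
    (hij : j + 2 ≤ i) {X : R3 → 𝔤} (hX : Reg r i X) : Reg r j (covLaplacian A X) :=
  Reg.sum _ fun k _ => hA.reg_covDeriv (j := j) (by omega)
    (hA.reg_covDeriv' (j := j + 1) hi (by omega) hX k) k

/-- The iterated covariant derivative `∇_{k₁} ⋯ ∇_{kₚ} X` for a list of directions. -/
noncomputable def covDerivs (A : Fin 3 → R3 → 𝔤) (I : List (Fin 3)) (X : R3 → 𝔤) : R3 → 𝔤 :=
  I.foldr (covDeriv A) X

theorem RegPotential.reg_covDerivs (hA : RegPotential r N A) {i j : ℕ} (hi : i ≤ N)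
    (I : List (Fin 3)) (hij : j + I.length ≤ i) {X : R3 → 𝔤} (hX : Reg r i X) :
    Reg r j (covDerivs A I X) := by
  induction I generalizing j with
  | nil => exact hX.mono hA.le_two (by simpa using hij)
  | cons k I ih =>
    simp only [List.length_cons] at hij
    exact hA.reg_covDeriv (by omega) (ih (j := j + 1) (by omega)) k

theorem VanishesOff.covDeriv {R : ℝ} {k : Fin 3} {X X' : R3 → 𝔤} (hR : VanishesOff R X)
    (h : HasWeakDeriv [k] X X') : VanishesOff R (covDeriv A k X) := by
  filter_upwards [covDeriv_ae_eq A h, hR, h.vanishesOff hR] with x h1 h2 h3 hx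
  simp [h1, h2 hx, h3 hx]

theorem RegPotential.vanishesOff_covDerivs (hA : RegPotential r N A) {i : ℕ} (hi : i ≤ N)
    (I : List (Fin 3)) (hI : I.length ≤ i) {X : R3 → 𝔤} (hX : Reg r i X) {R : ℝ}
    (hR : VanishesOff R X) : VanishesOff R (covDerivs A I X) := by
  induction I with
  | nil => exact hR
  | cons k I ih =>
    simp only [List.length_cons] at hI
    exact (ih (by omega)).covDeriv ((hA.reg_covDerivs (j := 0 + 1) hi I (by omega) hX).hasWeakDeriv k)

/-- The terms of the commutator of `Δ(A)` with iterated covariant derivatives, as formal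
expressions: `div J l K` stands for `[∇_J (∇·G)_l, ∇_K Φ]` and `curv J (k, l) K` for
`[∇_J G_{kl}, ∇_K Φ]`. -/
inductive CommTerm
  | div (J : List (Fin 3)) (l : Fin 3) (K : List (Fin 3))
  | curv (J : List (Fin 3)) (i : Fin 3 × Fin 3) (K : List (Fin 3))

namespace CommTerm

/-- The function denoted by a formal commutator term. -/
noncomputable def eval (A : Fin 3 → R3 → 𝔤) (Φ : R3 → 𝔤) : CommTerm → R3 → 𝔤
  | div J l K => fun x => ⁅covDerivs A J (divCurvature A l) x, covDerivs A K Φ x⁆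
  | curv J i K => fun x => ⁅covDerivs A J (curvature A i) x, covDerivs A K Φ x⁆

/-- The two terms of `∇_k t` given by the Leibniz rule. -/
def deriv (k : Fin 3) : CommTerm → List CommTerm
  | div J l K => [div (k :: J) l K, div J l (k :: K)]
  | curv J i K => [curv (k :: J) i K, curv J i (k :: K)]

/-- The terms that occur in the commutator with `m` covariant derivatives: `∇·G` counts as one
derivative, and an undifferentiated `Φ` is never paired with `∇_J G`. -/
def Valid (m : ℕ) : CommTerm → Prop
  | div J _ K => J.length + K.length + 1 = m
  | curv J _ K => J.length + K.length = m ∧ 1 ≤ K.length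

end CommTerm

/-- The terms of `∇_I Δ(A) Φ - Δ(A) ∇_I Φ`; the factor `2` of the curvature terms is encoded by
repeating them. -/
def commTerms : List (Fin 3) → List CommTerm
  | [] => []
  | l :: I => (CommTerm.div [] l I :: (List.finRange 3).flatMap fun k =>
      [CommTerm.curv [] (k, l) (k :: I), CommTerm.curv [] (k, l) (k :: I)]) ++
        (commTerms I).flatMap (CommTerm.deriv l)

theorem valid_of_mem_commTerms {I : List (Fin 3)} {t : CommTerm} (ht : t ∈ commTerms I) :
    t.Valid I.length := by
  induction I generalizing t with
  | nil => simp [commTerms] at ht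
  | cons l I ih =>
    simp only [commTerms, List.mem_append, List.mem_cons, List.mem_flatMap] at ht
    rcases ht with (rfl | ⟨k, -, ht⟩) | ⟨s, hs, ht⟩
    · simp [CommTerm.Valid]
    · simp only [List.not_mem_nil, or_false, or_self] at ht
      subst ht
      simp [CommTerm.Valid]
    · have h := ih hs
      cases s <;> simp only [CommTerm.deriv, List.mem_cons, List.not_mem_nil, or_false] at ht <;>
        rcases ht with rfl | rfl <;> simp only [CommTerm.Valid, List.length_cons] at h ⊢ <;> omega

/-- A commutator term of order `m` has the regularity of a function obtained from `Φ` by `m + 2`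
covariant derivatives. -/
theorem RegPotential.reg_eval (hA : RegPotential r N A) {Φ : R3 → 𝔤} (hΦ : Reg r N Φ) {m j : ℕ}
    (hm : m + 2 + j ≤ N) {t : CommTerm} (ht : t.Valid m) : Reg r j (t.eval A Φ) := by
  have h3 := hA.three_le
  suffices h : Reg r (N - 2 - m) (t.eval A Φ) from h.mono hA.le_two (by omega)
  cases t with
  | div J l K =>
    simp only [CommTerm.Valid] at ht
    exact Reg.bilin hA.le_two (lieCLM 𝔤) (i := N - 3 - J.length) (j := N - K.length) h3
      (by omega) (by omega) (by omega)
      (hA.reg_covDerivs (i := N - 3) (by omega) J (by omega) (hA.reg_divCurvature l))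
      (hA.reg_covDerivs le_rfl K (by omega) hΦ)
  | curv J i K =>
    simp only [CommTerm.Valid] at ht
    exact Reg.bilin hA.le_two (lieCLM 𝔤) (i := N - 2 - J.length) (j := N - K.length) h3
      (by omega) (by omega) (by omega)
      (hA.reg_covDerivs (i := N - 2) (by omega) J (by omega) (hA.reg_curvature i))
      (hA.reg_covDerivs le_rfl K (by omega) hΦ)

theorem RegPotential.covDeriv_eval (hA : RegPotential r N A) {Φ : R3 → 𝔤} (hΦ : Reg r N Φ) {m : ℕ}
    (hm : m + 3 ≤ N) {t : CommTerm} (ht : t.Valid m) (k : Fin 3) :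
    covDeriv A k (t.eval A Φ) =ᵐ[volume]
      fun x => ((t.deriv k).map fun s => s.eval A Φ x).sum := by
  have h3 := hA.three_le
  cases t with
  | div J l K =>
    simp only [CommTerm.Valid] at ht
    filter_upwards [hA.covDeriv_lie (i := N - 3 - J.length) (j := N - K.length)
      (by omega) (by omega) (by omega)
      (hA.reg_covDerivs (i := N - 3) (by omega) J (by omega) (hA.reg_divCurvature l))
      (hA.reg_covDerivs le_rfl K (by omega) hΦ) k] with x hx
    refine hx.trans ?_
    simp [CommTerm.deriv, CommTerm.eval, covDerivs]
  | curv J i K =>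
    simp only [CommTerm.Valid] at ht
    filter_upwards [hA.covDeriv_lie (i := N - 2 - J.length) (j := N - K.length)
      (by omega) (by omega) (by omega)
      (hA.reg_covDerivs (i := N - 2) (by omega) J (by omega) (hA.reg_curvature i))
      (hA.reg_covDerivs le_rfl K (by omega) hΦ) k] with x hx
    refine hx.trans ?_
    simp [CommTerm.deriv, CommTerm.eval, covDerivs]

theorem RegPotential.covDeriv_list_sum (hA : RegPotential r N A) {Φ : R3 → 𝔤} (hΦ : Reg r N Φ)
    {m : ℕ} (hm : m + 3 ≤ N) (L : List CommTerm) (hL : ∀ t ∈ L, t.Valid m) (k : Fin 3) :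
    Reg r 1 (fun x => (L.map fun t => t.eval A Φ x).sum) ∧
    covDeriv A k (fun x => (L.map fun t => t.eval A Φ x).sum) =ᵐ[volume]
      fun x => ((L.flatMap (CommTerm.deriv k)).map fun t => t.eval A Φ x).sum := by
  induction L with
  | nil => exact ⟨by simpa using reg_zero 1, by simpa using covDeriv_zero A k⟩
  | cons t L ih =>
    obtain ⟨ih1, ih2⟩ := ih fun s hs => hL s (by simp [hs])
    have ht := hL t (by simp)
    have rt : Reg r 1 (t.eval A Φ) := hA.reg_eval hΦ (by omega) ht
    refine ⟨by simpa using rt.add ih1, ?_⟩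
    simp only [List.map_cons, List.sum_cons, List.flatMap_cons, List.map_append, List.sum_append]
    filter_upwards [covDeriv_add A (rt.hasWeakDeriv k) (ih1.hasWeakDeriv k), ih2,
      hA.covDeriv_eval hΦ hm ht k] with x h1 h2 h3
    rw [h1, h2, h3]

/-- The commutator of the covariant Laplacian with iterated covariant derivatives. -/
theorem RegPotential.covLaplacian_covDerivs (hA : RegPotential r N A) {Φ : R3 → 𝔤}
    (hΦ : Reg r N Φ) (I : List (Fin 3)) (hI : I.length + 2 ≤ N) :
    covLaplacian A (covDerivs A I Φ) =ᵐ[volume] fun x => covDerivs A I (covLaplacian A Φ) x -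
      ((commTerms I).map fun t => t.eval A Φ x).sum := by
  induction I with
  | nil => simp [commTerms, covDerivs]
  | cons l I ih =>
    simp only [List.length_cons] at hI
    have rI : Reg r (N - I.length) (covDerivs A I Φ) :=
      hA.reg_covDerivs le_rfl I (by omega) hΦ
    have e1 := hA.covLaplacian_covDeriv (j := N - I.length - 3) (by omega)
      (by rwa [Nat.sub_add_cancel (by omega)]) l
    have e2 := covDeriv_congr A (k := l) (ih (by omega))
    obtain ⟨rs, e3⟩ := hA.covDeriv_list_sum hΦ (m := I.length) (by omega) (commTerms I)
      (fun t ht => valid_of_mem_commTerms ht) l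
    have rl : Reg r (0 + 1) (covDerivs A I (covLaplacian A Φ)) :=
      hA.reg_covDerivs (i := N - 2) (by omega) I (by omega)
        (hA.reg_covLaplacian (i := N) le_rfl (by omega) hΦ)
    have e4 := covDeriv_sub A (rl.hasWeakDeriv l) (rs.hasWeakDeriv l)
    filter_upwards [e1, e2, e3, e4] with x h1 h2 h3 h4
    change covLaplacian A (covDeriv A l (covDerivs A I Φ)) x = _
    rw [h1, h2, h4, h3]
    simp only [commTerms, List.map_append, List.sum_append, List.map_cons, List.sum_cons]
    have hflat : ∀ f : Fin 3 → 𝔤, ∀ g : Fin 3 → CommTerm,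
        (∀ k, (g k).eval A Φ x = f k) →
        (((List.finRange 3).flatMap fun k => [g k, g k]).map fun t => t.eval A Φ x).sum =
          ∑ k, (f k + f k) := fun f g hg => by
      simp [List.finRange_succ, Fin.sum_univ_three, hg]
      abel
    rw [hflat (fun k => ⁅curvature A (k, l) x, covDeriv A k (covDerivs A I Φ) x⁆)
      (fun k => CommTerm.curv [] (k, l) (k :: I)) (fun k => rfl)]
    have hdiv : (CommTerm.div [] l I).eval A Φ x = ⁅divCurvature A l x, covDerivs A I Φ x⁆ := rfl
    rw [hdiv]
    change covDeriv A l (covDerivs A I (covLaplacian A Φ)) x - _ - _ =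
      covDeriv A l (covDerivs A I (covLaplacian A Φ)) x - _
    abel

end Covariant

end CovariantPoisson

/-! ### Weights, Hardy's inequality and the weighted Sobolev inequality -/

namespace CovariantPoisson

open Filter Topology Metric

section Weights

theorem w_sq (x : R3) : w x ^ 2 = 1 + ‖x‖ ^ 2 := by
  rw [w, ← Real.sqrt_eq_rpow, Real.sq_sqrt (by positivity)]

theorem one_le_w (x : R3) : 1 ≤ w x := by
  rw [w]
  exact Real.one_le_rpow (by nlinarith [sq_nonneg ‖x‖]) (by norm_num)

theorem w_pos (x : R3) : 0 < w x := zero_lt_one.trans_le (one_le_w x)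

theorem norm_le_w (x : R3) : ‖x‖ ≤ w x :=
  abs_le_of_sq_le_sq' (by rw [w_sq]; linarith) (w_pos x).le |>.2

theorem w_rpow_pos (x : R3) (e : ℝ) : 0 < w x ^ e := Real.rpow_pos_of_pos (w_pos x) e

theorem w_rpow_add (x : R3) (e f : ℝ) : w x ^ (e + f) = w x ^ e * w x ^ f :=
  Real.rpow_add (w_pos x) e f

theorem w_rpow_le (x : R3) {e f : ℝ} (h : e ≤ f) : w x ^ e ≤ w x ^ f :=
  Real.rpow_le_rpow_of_exponent_le (one_le_w x) h

theorem w_rpow_two_mul (x : R3) (e : ℝ) : w x ^ (2 * e) = (w x ^ e) ^ 2 := by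
  rw [two_mul, w_rpow_add, sq]

theorem w_rpow_eq (x : R3) (e : ℝ) : w x ^ e = (1 + ‖x‖ ^ 2) ^ (e / 2) := by
  rw [w, ← Real.rpow_mul (by positivity)]
  congr 1
  ring

theorem hasFDerivAt_w_rpow (e : ℝ) (x : R3) :
    HasFDerivAt (fun x => w x ^ e) ((e * w x ^ (e - 2)) • innerSL ℝ x) x := by
  have h1 : HasFDerivAt (fun x : R3 => 1 + ‖x‖ ^ 2) (2 • innerSL ℝ x) x :=
    (hasStrictFDerivAt_norm_sq x).hasFDerivAt.const_add 1
  have h2 := h1.rpow_const (p := e / 2) (Or.inl (by positivity))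
  simp only [← w_rpow_eq] at h2
  refine h2.congr_fderiv ?_
  have h3 : (1 + ‖x‖ ^ 2) ^ (e / 2 - 1) = w x ^ (e - 2) := by
    rw [w_rpow_eq]; congr 1; ring
  rw [h3]
  ext y
  simp only [smul_apply, smul_eq_mul, nsmul_eq_mul]
  push_cast
  ring

theorem contDiff_w_rpow (e : ℝ) : ContDiff ℝ ∞ (fun x => w x ^ e) := by
  simp only [w_rpow_eq]
  exact (contDiff_const.add (contDiff_norm_sq ℝ)).rpow_const_of_ne fun x => by positivity

theorem partialDeriv_w_rpow (e : ℝ) (k : Fin 3) (x : R3) :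
    partialDeriv k (fun x => w x ^ e) x = e * w x ^ (e - 2) * x k := by
  rw [partialDeriv, (hasFDerivAt_w_rpow e x).fderiv]
  simp [EuclideanSpace.inner_single_right]

theorem abs_partialDeriv_w_rpow_le (e : ℝ) (k : Fin 3) (x : R3) :
    |partialDeriv k (fun x => w x ^ e) x| ≤ |e| * w x ^ (e - 1) := by
  rw [partialDeriv_w_rpow, abs_mul, abs_mul, abs_of_pos (w_rpow_pos x _), mul_assoc]
  refine mul_le_mul_of_nonneg_left ?_ (abs_nonneg e)
  have h : w x ^ (e - 1) = w x ^ (e - 2) * w x := by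
    rw [show e - 1 = (e - 2) + 1 by ring, w_rpow_add, Real.rpow_one]
  rw [h]
  exact mul_le_mul_of_nonneg_left ((PiLp.norm_apply_le x k).trans (norm_le_w x)) (w_rpow_pos x _).le

/-- The weighted square integral `∫ w^e |f|²`. -/
noncomputable def weightedSq {V : Type*} [NormedAddCommGroup V] (e : ℝ) (f : R3 → V) : ℝ≥0∞ :=
  ∫⁻ x, ENNReal.ofReal (w x ^ e * ‖f x‖ ^ 2)

theorem weightedSq_mono {V : Type*} [NormedAddCommGroup V] {e e' : ℝ} (h : e ≤ e') (f : R3 → V) :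
    weightedSq e f ≤ weightedSq e' f :=
  lintegral_mono fun x => ENNReal.ofReal_le_ofReal
    (mul_le_mul_of_nonneg_right (w_rpow_le x h) (sq_nonneg _))

theorem aemeasurable_weightedSq {V : Type*} [NormedAddCommGroup V] (e : ℝ) {f : R3 → V}
    (hf : AEStronglyMeasurable f volume) :
    AEMeasurable (fun x => ENNReal.ofReal (w x ^ e * ‖f x‖ ^ 2)) volume :=
  ((contDiff_w_rpow e).continuous.aemeasurable.mul
    (hf.norm.aemeasurable.pow_const 2)).ennreal_ofReal

theorem lintegral_const_mul_weightedSq {V : Type*} [NormedAddCommGroup V] {c : ℝ} (hc : 0 ≤ c)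
    (e : ℝ) (f : R3 → V) : ∫⁻ x, ENNReal.ofReal (c * (w x ^ e * ‖f x‖ ^ 2)) =
      ENNReal.ofReal c * weightedSq e f := by
  simp only [ENNReal.ofReal_mul hc]
  exact lintegral_const_mul' _ _ ENNReal.ofReal_ne_top

end Weights

/-- If `f ≤ g + D` with `∫ D = 0`, then `∫ f ≤ ∫ g`, where `g` need not be integrable. -/
theorem lintegral_le_of_integral_eq_zero {f D g : R3 → ℝ} (hf0 : ∀ x, 0 ≤ f x) (hf : Integrable f)
    (hD : Integrable D) (hD0 : ∫ x, D x = 0) (h : ∀ᵐ x, f x ≤ g x + D x) :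
    ∫⁻ x, ENNReal.ofReal (f x) ≤ ∫⁻ x, ENNReal.ofReal (g x) := by
  have h1 : ∫ x, f x ≤ ∫ x, max (f x - D x) 0 := by
    calc ∫ x, f x = ∫ x, (f x - D x) := by rw [integral_sub hf hD, hD0, sub_zero]
      _ ≤ _ := integral_mono (hf.sub hD) (hf.sub hD).pos_part fun x => le_max_left _ _
  rw [← ofReal_integral_eq_lintegral_ofReal hf (Eventually.of_forall hf0)]
  refine (ENNReal.ofReal_le_ofReal h1).trans ?_
  have h2 := ofReal_integral_eq_lintegral_ofReal (hf.sub hD).pos_part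
    (Eventually.of_forall fun x => le_max_right _ _)
  simp only [Pi.sub_apply] at h2
  rw [h2]
  refine lintegral_mono_ae ?_
  filter_upwards [h] with x hx
  rcases le_total (f x - D x) 0 with h0 | h0
  · simp [max_eq_right h0]
  · rw [max_eq_left h0]
    exact ENNReal.ofReal_le_ofReal (by linarith)

section Inequalities

variable {𝔤 : Type*} [NormedLieRing 𝔤] [CompactLieAlgebra 𝔤]

theorem inner_lie_self (a x : 𝔤) : inner ℝ x ⁅a, x⁆ = 0 := by
  have h := inner_lie_left x a x
  rw [real_inner_comm x ⁅a, x⁆] at h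
  have h' : (inner ℝ x ⁅a, x⁆ : ℝ) = - inner ℝ x ⁅a, x⁆ := by
    rw [real_inner_comm] at h ⊢; linarith
  linarith

theorem HasWeakDeriv.normSq {k : Fin 3} {u u' : R3 → 𝔤} (h : HasWeakDeriv [k] u u')
    (hu : MemLpLoc u ∞) :
    HasWeakDeriv [k] (fun x => ‖u x‖ ^ 2) (fun x => 2 * inner ℝ (u x) (u' x)) := by
  have := h.bilin (innerSL ℝ) h hu (Or.inr hu)
  refine this.congr (Eventually.of_forall fun x => ?_) (Eventually.of_forall fun x => ?_)
  · exact real_inner_self_eq_norm_sq (u x)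
  · change inner ℝ (u' x) (u x) + inner ℝ (u x) (u' x) = 2 * inner ℝ (u x) (u' x)
    rw [real_inner_comm]
    ring

/-- **Weighted Hardy inequality** in three dimensions, covariant form:
`∫ w^{-s-2}|Φ|² ≤ C ∫ w^{-s}|∇Φ|²` for `s < 1`. It follows by integrating the divergence of
`w^{-s-2}|Φ|² x`. -/
theorem weightedSq_hardy (σ : ℝ) (hσ₀ : 0 < σ) (hσ₁ : σ ≤ 1) (A : Fin 3 → R3 → 𝔤) {R : ℝ}
    {Φ : R3 → 𝔤} {Φ' : Fin 3 → R3 → 𝔤} (hΦ : ∀ k, HasWeakDeriv [k] Φ (Φ' k))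
    (hΦb : MemLpLoc Φ ∞) (hR : VanishesOff R Φ)
    (hm : ∀ k, AEStronglyMeasurable (covDeriv A k Φ) volume) :
    weightedSq (-(1 - σ) - 2) Φ ≤ ENNReal.ofReal (12 / σ ^ 2) *
      ∑ k, weightedSq (-(1 - σ)) (covDeriv A k Φ) := by
  set s := 1 - σ with hs
  let c : Fin 3 → R3 → ℝ := fun k x => x k * w x ^ (-s - 2)
  have hcoord : ∀ k : Fin 3, ContDiff ℝ ∞ (fun x : R3 => x k) := fun k =>
    (EuclideanSpace.proj (𝕜 := ℝ) k : R3 →L[ℝ] ℝ).contDiff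
  have hc : ∀ k, ContDiff ℝ ∞ (c k) := fun k => (hcoord k).mul (contDiff_w_rpow _)
  have hcd : ∀ k x, partialDeriv k (c k) x = w x ^ (-s - 2) - (s + 2) * w x ^ (-s - 4) * x k ^ 2 :=
    fun k x => by
    have h1 : partialDeriv k (fun x : R3 => x k) x = 1 := by
      have : HasFDerivAt (fun x : R3 => x k) (EuclideanSpace.proj (𝕜 := ℝ) k : R3 →L[ℝ] ℝ) x :=
        (EuclideanSpace.proj (𝕜 := ℝ) k : R3 →L[ℝ] ℝ).hasFDerivAt
      rw [partialDeriv, this.fderiv]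
      simp
    rw [partialDeriv_mul (hcoord k) (contDiff_w_rpow _), h1, partialDeriv_w_rpow]
    rw [show -s - 2 - 2 = -s - 4 by ring]
    ring
  have hD : ∀ k, HasWeakDeriv [k] (fun x => c k x • ‖Φ x‖ ^ 2)
      (fun x => partialDeriv k (c k) x • ‖Φ x‖ ^ 2 + c k x • (2 * inner ℝ (Φ x) (Φ' k x))) :=
    fun k => ((hΦ k).normSq hΦb).smooth_smul (hc k)
  have hDR : ∀ k, VanishesOff R (fun x => c k x • ‖Φ x‖ ^ 2) := fun k => by
    filter_upwards [hR] with x hx hxR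
    simp [hx hxR]
  have hint : ∀ k, Integrable (fun x => partialDeriv k (c k) x • ‖Φ x‖ ^ 2 +
      c k x • (2 * inner ℝ (Φ x) (Φ' k x))) := fun k => memLp_one_iff_integrable.1
    (((hD k).vanishesOff (hDR k)).memLp (memLpLoc_one_iff.2 (hD k).locallyIntegrable_right))
  have hzero := fun k => (hD k).integral_eq_zero (hDR k)
  have hfi : Integrable (fun x => σ / 2 * (w x ^ (-s - 2) * ‖Φ x‖ ^ 2)) := by
    refine Integrable.const_mul ?_ _
    refine memLp_one_iff_integrable.1 (VanishesOff.memLp (R := R) ?_ ?_)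
    · filter_upwards [hR] with x hx hxR
      simp [hx hxR]
    · exact memLpLoc_one_iff.2 (((contDiff_w_rpow _).continuous.memLpLoc ∞).smul_locallyIntegrable
        ((hΦ 0).normSq hΦb).locallyIntegrable_left)
  have key := lintegral_le_of_integral_eq_zero
    (f := fun x => σ / 2 * (w x ^ (-s - 2) * ‖Φ x‖ ^ 2))
    (D := fun x => ∑ k, (partialDeriv k (c k) x • ‖Φ x‖ ^ 2 +
      c k x • (2 * inner ℝ (Φ x) (Φ' k x))))
    (g := fun x => ∑ k, 6 / σ * (w x ^ (-s) * ‖covDeriv A k Φ x‖ ^ 2))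
    (fun x => by have := w_rpow_pos x (-s - 2); positivity) hfi
    (integrable_finsetSum _ fun k _ => hint k)
    (by rw [integral_finsetSum _ fun k _ => hint k]; simp only [hzero, Finset.sum_const_zero]) ?_
  · rw [lintegral_const_mul_weightedSq (by positivity)] at key
    have e2 : ∫⁻ x, ENNReal.ofReal (∑ k, 6 / σ * (w x ^ (-s) * ‖covDeriv A k Φ x‖ ^ 2)) =
        ENNReal.ofReal (6 / σ) * ∑ k, weightedSq (-s) (covDeriv A k Φ) := by
      rw [Finset.mul_sum]
      simp only [← lintegral_const_mul_weightedSq (show 0 ≤ 6 / σ by positivity)]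
      rw [← lintegral_finsetSum' _ fun k _ => ?_]
      · refine lintegral_congr fun x => ENNReal.ofReal_sum_of_nonneg fun k _ => ?_
        have := w_rpow_pos x (-s)
        positivity
      · simp only [ENNReal.ofReal_mul (show 0 ≤ 6 / σ by positivity)]
        exact (aemeasurable_weightedSq _ (hm k)).const_mul _
    rw [e2] at key
    calc weightedSq (-s - 2) Φ
        = ENNReal.ofReal (2 / σ) * (ENNReal.ofReal (σ / 2) * weightedSq (-s - 2) Φ) := by
          rw [← mul_assoc, ← ENNReal.ofReal_mul (by positivity),
            show 2 / σ * (σ / 2) = 1 by field_simp]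
          simp
      _ ≤ ENNReal.ofReal (2 / σ) * (ENNReal.ofReal (6 / σ) *
          ∑ k, weightedSq (-s) (covDeriv A k Φ)) := by gcongr
      _ = _ := by
          rw [← mul_assoc, ← ENNReal.ofReal_mul (by positivity),
            show 2 / σ * (6 / σ) = 12 / σ ^ 2 by field_simp; norm_num]
  · have hae : ∀ᵐ x, ∀ k, covDeriv A k Φ x = Φ' k x + ⁅A k x, Φ x⁆ :=
      ae_all_iff.2 fun k => covDeriv_ae_eq A (hΦ k)
    filter_upwards [hae] with x hx
    have hin : ∀ k, (inner ℝ (Φ x) (Φ' k x) : ℝ) = inner ℝ (Φ x) (covDeriv A k Φ x) := fun k => by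
      rw [hx, inner_add_right, inner_lie_self, add_zero]
    set P := w x ^ (-s - 2) with hP
    have hPpos : 0 < P := w_rpow_pos x _
    have hPw : P * w x ^ 2 = w x ^ (-s) := by
      rw [hP, ← Real.rpow_natCast, ← w_rpow_add]
      congr 1
      push_cast
      ring
    -- Young's inequality, with a factor for which the three terms give half of `σ w^{-s-2}|Φ|²`.
    have hterm : ∀ k, -(σ / 6 * (P * ‖Φ x‖ ^ 2)) - 6 / σ * (w x ^ (-s) * ‖covDeriv A k Φ x‖ ^ 2) ≤
        c k x * (2 * inner ℝ (Φ x) (covDeriv A k Φ x)) := fun k => by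
      have h1 := abs_real_inner_le_norm (Φ x) (covDeriv A k Φ x)
      have h2 : |x k| ≤ w x := (PiLp.norm_apply_le x k).trans (norm_le_w x)
      set d := ‖covDeriv A k Φ x‖ with hd
      have hd0 : 0 ≤ d := norm_nonneg _
      have h3 : |c k x * (2 * inner ℝ (Φ x) (covDeriv A k Φ x))| ≤
          2 * P * (‖Φ x‖ * (w x * d)) := by
        rw [abs_mul, abs_mul, abs_mul, abs_of_pos hPpos, abs_two]
        calc |x k| * P * (2 * |inner ℝ (Φ x) (covDeriv A k Φ x)|)
            ≤ w x * P * (2 * (‖Φ x‖ * d)) := by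
              have := w_pos x
              gcongr
          _ = _ := by ring
      have h4 : 2 * (‖Φ x‖ * (w x * d)) ≤ σ / 6 * ‖Φ x‖ ^ 2 + 6 / σ * (w x * d) ^ 2 := by
        have h5 : 0 ≤ (σ * ‖Φ x‖ - 6 * (w x * d)) ^ 2 / (6 * σ) := by positivity
        have h6 : (σ * ‖Φ x‖ - 6 * (w x * d)) ^ 2 / (6 * σ) =
            σ / 6 * ‖Φ x‖ ^ 2 + 6 / σ * (w x * d) ^ 2 - 2 * (‖Φ x‖ * (w x * d)) := by
          field_simp
          ring
        linarith
      have h7 := mul_le_mul_of_nonneg_left h4 hPpos.le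
      have h8 := neg_le_of_abs_le h3
      rw [← hPw]
      nlinarith [h7, h8]
    have hsum := Finset.sum_le_sum fun k (_ : k ∈ Finset.univ) => hterm k
    have hx2 : ∑ k, x k ^ 2 = w x ^ 2 - 1 := by
      rw [w_sq, EuclideanSpace.norm_sq_eq]
      simp
    have hP4 : w x ^ (-s - 4) * w x ^ 2 = P := by
      rw [hP, ← Real.rpow_natCast, ← w_rpow_add]
      congr 1
      push_cast
      ring
    -- The divergence of the vector field `w^{-s-2} x` is at least `(3 - (s + 2)) w^{-s-2}`.
    have hdiv : σ * P ≤ ∑ k, partialDeriv k (c k) x := by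
      simp only [hcd, Finset.sum_sub_distrib, ← Finset.mul_sum]
      rw [hx2]
      have h4 := w_rpow_pos x (-s - 4)
      simp only [Finset.sum_const, Finset.card_univ, Fintype.card_fin, nsmul_eq_mul]
      push_cast
      have : (s + 2) * w x ^ (-s - 4) * (w x ^ 2 - 1) = (s + 2) * P - (s + 2) * w x ^ (-s - 4) := by
        rw [← hP4]; ring
      rw [this]
      have : 0 ≤ (s + 2) * w x ^ (-s - 4) := mul_nonneg (by linarith) h4.le
      have hσs : σ = 1 - s := by rw [hs]; ring
      rw [hσs]
      linarith
    have hdiv' := mul_le_mul_of_nonneg_right hdiv (sq_nonneg ‖Φ x‖)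
    simp only [smul_eq_mul, hin, Finset.sum_add_distrib, ← Finset.sum_mul]
    simp only [Finset.sum_sub_distrib, Finset.sum_const, Finset.card_univ, Fintype.card_fin,
      nsmul_eq_mul] at hsum
    push_cast at hsum
    linarith

end Inequalities

end CovariantPoisson

namespace CovariantPoisson

open Filter Topology Metric

section Sobolev

variable {𝔤 : Type*} [NormedLieRing 𝔤] [CompactLieAlgebra 𝔤]

theorem memLpLoc_top_normSq {u : R3 → 𝔤} (hu : MemLpLoc u ∞) :
    MemLpLoc (fun x => ‖u x‖ ^ 2) ∞ := by
  have h := MemLpLoc.bilin ∞ (innerSL ℝ) hu hu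
  exact h.congr (Eventually.of_forall fun x => real_inner_self_eq_norm_sq (u x))

/-- Solving `M^{2/3} ≤ K M^{1/2} T^{1/2}` for `M^{1/3}`. -/
theorem rpow_third_le_of_rpow_two_thirds_le {M K T : ℝ≥0∞} (hM : M ≠ ⊤)
    (h : M ^ (2 / 3 : ℝ) ≤ K * (M ^ (1 / 2 : ℝ) * T ^ (1 / 2 : ℝ))) :
    M ^ (1 / 3 : ℝ) ≤ K ^ 2 * T := by
  rcases eq_or_ne M 0 with rfl | h0
  · simp
  have h1 : M ^ (1 / 6 : ℝ) ≤ K * T ^ (1 / 2 : ℝ) := by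
    have h2 : M ^ (2 / 3 : ℝ) = M ^ (1 / 2 : ℝ) * M ^ (1 / 6 : ℝ) := by
      rw [← ENNReal.rpow_add _ _ h0 hM]; norm_num
    rw [h2, show K * (M ^ (1 / 2 : ℝ) * T ^ (1 / 2 : ℝ)) =
      M ^ (1 / 2 : ℝ) * (K * T ^ (1 / 2 : ℝ)) by ring] at h
    exact (ENNReal.mul_le_mul_iff_right (by simp [h0, hM])
      (ENNReal.rpow_ne_top_of_nonneg (by norm_num) hM)).1 h
  have h3 := ENNReal.rpow_le_rpow h1 (show (0 : ℝ) ≤ 2 by norm_num)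
  rw [← ENNReal.rpow_mul, ENNReal.mul_rpow_of_nonneg _ _ (by norm_num), ← ENNReal.rpow_mul] at h3
  norm_num at h3 ⊢
  exact h3

/-- **Weighted covariant Sobolev inequality** `H¹ ⊂ L⁶`. With `u = w^e X`, the inequality
`W^{1,1} ⊂ L^{3/2}` is applied to `|u|⁴`, whose derivative `4|u|²⟨u, ∇_k u⟩` does not see the
potential. -/
theorem exists_weighted_sobolev (e : ℝ) : ∃ C : ℝ≥0, ∀ (A : Fin 3 → R3 → 𝔤) (R : ℝ) (X : R3 → 𝔤)
    (X' : Fin 3 → R3 → 𝔤), (∀ k, HasWeakDeriv [k] X (X' k)) → MemLpLoc X ∞ → VanishesOff R X →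
    (∀ k, AEStronglyMeasurable (covDeriv A k X) volume) →
    (∫⁻ x, ENNReal.ofReal (w x ^ e * ‖X x‖) ^ (6 : ℝ)) ^ (1 / 3 : ℝ) ≤
      C * (∑ k, weightedSq (2 * e) (covDeriv A k X) + weightedSq (2 * e - 2) X) := by
  set S := eLpNormLESNormFDerivOneConst (volume : Measure R3) (3 / 2 : ℝ≥0) with hS
  refine ⟨(12 * S) ^ 2 * (2 + 6 * (Real.nnabs e) ^ 2), fun A R X X' hX hXb hR hm => ?_⟩
  have hwe : ContDiff ℝ ∞ (fun x => w x ^ e) := contDiff_w_rpow e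
  set u : R3 → 𝔤 := fun x => w x ^ e • X x with hu
  have hnu : ∀ x, ‖u x‖ = w x ^ e * ‖X x‖ := fun x => by
    rw [hu, norm_smul, Real.norm_of_nonneg (w_rpow_pos x e).le]
  have hu' : ∀ k, HasWeakDeriv [k] u
      (fun x => partialDeriv k (fun x => w x ^ e) x • X x + w x ^ e • X' k x) :=
    fun k => (hX k).smooth_smul hwe
  have hub : MemLpLoc u ∞ :=
    MemLpLoc.bilin ∞ (ContinuousLinearMap.lsmul ℝ ℝ) (hwe.continuous.memLpLoc ∞) hXb
  have huR : VanishesOff R u := by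
    filter_upwards [hR] with x hx hxR
    simp [hu, hx hxR]
  have hv : ∀ k, HasWeakDeriv [k] (fun x => ‖u x‖ ^ 2 • ‖u x‖ ^ 2) _ := fun k =>
    ((hu' k).normSq hub).smul ((hu' k).normSq hub) (memLpLoc_top_normSq hub)
      (Or.inr (memLpLoc_top_normSq hub))
  have hvR : VanishesOff R (fun x => ‖u x‖ ^ 2 • ‖u x‖ ^ 2) := by
    filter_upwards [huR] with x hx hxR
    simp [hx hxR]
  have hsob := eLpNorm_le_sum_eLpNorm_weakDeriv hv hvR
  set U : R3 → ℝ≥0∞ := fun x => ENNReal.ofReal (w x ^ e * ‖X x‖) with hU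
  have hUu : ∀ x, U x = ‖u x‖ₑ := fun x => by rw [hU, ← ofReal_norm, hnu]
  set M := ∫⁻ x, U x ^ (6 : ℝ) with hM
  have hMtop : M ≠ ⊤ := by
    have h6 : MemLp u 6 volume := huR.memLp (hub.mono_exponent le_top)
    have := lintegral_rpow_enorm_lt_top_of_eLpNorm_lt_top (by norm_num) (by norm_num) h6.2
    rw [hM]
    simp only [hUu]
    convert this.ne using 4
    norm_num
  have hlhs : eLpNorm (fun x => ‖u x‖ ^ 2 • ‖u x‖ ^ 2) (3 / 2 : ℝ≥0) volume = M ^ (2 / 3 : ℝ) := by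
    rw [eLpNorm_nnreal_eq_lintegral (by norm_num)]
    rw [hM]
    congr 1
    · refine lintegral_congr fun x => ?_
      rw [hUu, smul_eq_mul, enorm_mul, enorm_pow, enorm_norm, ← pow_add, ← ENNReal.rpow_natCast,
        ← ENNReal.rpow_mul]
      norm_num
    · norm_num
  -- The weighted derivative `|∇_k u|` is dominated by `H k`.
  set H : Fin 3 → R3 → ℝ≥0∞ := fun k x => ENNReal.ofReal
    (|e| * w x ^ (e - 1) * ‖X x‖ + w x ^ e * ‖covDeriv A k X x‖) with hH
  have hXm : AEStronglyMeasurable X volume := hXb.aestronglyMeasurable le_top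
  have hUm : AEMeasurable U volume :=
    (hwe.continuous.aemeasurable.mul hXm.norm.aemeasurable).ennreal_ofReal
  have hHm : ∀ k, AEMeasurable (H k) volume := fun k =>
    ((((contDiff_w_rpow (e - 1)).continuous.aemeasurable.const_mul _).mul
      hXm.norm.aemeasurable).add
      (hwe.continuous.aemeasurable.mul (hm k).norm.aemeasurable)).ennreal_ofReal
  set T := ∑ k, weightedSq (2 * e) (covDeriv A k X) + weightedSq (2 * e - 2) X with hT
  have hH2 : ∀ k, ∫⁻ x, H k x ^ (2 : ℝ) ≤ (2 + 2 * (Real.nnabs e) ^ 2 : ℝ≥0) * T := fun k => by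
    calc ∫⁻ x, H k x ^ (2 : ℝ)
        ≤ ∫⁻ x, (ENNReal.ofReal (2 * (w x ^ (2 * e) * ‖covDeriv A k X x‖ ^ 2)) +
            ENNReal.ofReal (2 * |e| ^ 2 * (w x ^ (2 * e - 2) * ‖X x‖ ^ 2))) := by
          refine lintegral_mono fun x => ?_
          have p1 := (w_rpow_pos x e).le
          have p2 := (w_rpow_pos x (e - 1)).le
          have p3 := (w_rpow_pos x (2 * e)).le
          have p4 := (w_rpow_pos x (2 * e - 2)).le
          rw [hH]
          simp only
          rw [ENNReal.ofReal_rpow_of_nonneg (by positivity) (by norm_num),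
            ← ENNReal.ofReal_add (by positivity) (by positivity)]
          refine ENNReal.ofReal_le_ofReal ?_
          rw [w_rpow_two_mul, show 2 * e - 2 = 2 * (e - 1) by ring, w_rpow_two_mul,
            Real.rpow_two]
          nlinarith [sq_nonneg (|e| * w x ^ (e - 1) * ‖X x‖ - w x ^ e * ‖covDeriv A k X x‖)]
      _ = ENNReal.ofReal 2 * weightedSq (2 * e) (covDeriv A k X) +
            ENNReal.ofReal (2 * |e| ^ 2) * weightedSq (2 * e - 2) X := by
          rw [lintegral_add_left', lintegral_const_mul_weightedSq (by norm_num),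
            lintegral_const_mul_weightedSq (by positivity)]
          simp only [ENNReal.ofReal_mul (show (0 : ℝ) ≤ 2 by norm_num)]
          exact (aemeasurable_weightedSq _ (hm k)).const_mul _
      _ ≤ ((2 : ℝ≥0) : ℝ≥0∞) * T + ((2 * (Real.nnabs e) ^ 2 : ℝ≥0) : ℝ≥0∞) * T := by
          refine add_le_add (mul_le_mul' (by simp) ?_) (mul_le_mul' (le_of_eq ?_) ?_)
          · exact (Finset.single_le_sum (f := fun k => weightedSq (2 * e) (covDeriv A k X))
              (fun _ _ => zero_le) (Finset.mem_univ k)).trans le_self_add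
          · rw [ENNReal.ofReal, Real.toNNReal_mul (by norm_num), Real.toNNReal_pow (abs_nonneg e)]
            congr 2
            · simp
            · congr 1
              ext
              simp
          · exact le_add_self
      _ = _ := by rw [← add_mul]; push_cast; rfl
  have hae : ∀ᵐ x, ∀ k, covDeriv A k X x = X' k x + ⁅A k x, X x⁆ :=
    ae_all_iff.2 fun k => covDeriv_ae_eq A (hX k)
  have hrhs : ∀ k, eLpNorm (fun x => (2 * inner ℝ (u x)
      (partialDeriv k (fun x => w x ^ e) x • X x + w x ^ e • X' k x)) • ‖u x‖ ^ 2 +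
      ‖u x‖ ^ 2 • (2 * inner ℝ (u x)
      (partialDeriv k (fun x => w x ^ e) x • X x + w x ^ e • X' k x))) 1 volume ≤
      4 * (M ^ (1 / 2 : ℝ) * ((2 + 2 * (Real.nnabs e) ^ 2 : ℝ≥0) * T) ^ (1 / 2 : ℝ)) := fun k => by
    rw [eLpNorm_one_eq_lintegral_enorm]
    calc _ ≤ ∫⁻ x, 4 * (U x ^ (3 : ℝ) * H k x) := by
          refine lintegral_mono_ae ?_
          filter_upwards [hae] with x hx
          have hin : (inner ℝ (u x) (partialDeriv k (fun x => w x ^ e) x • X x + w x ^ e • X' k x)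
              : ℝ) = inner ℝ (u x) (partialDeriv k (fun x => w x ^ e) x • X x +
                w x ^ e • covDeriv A k X x) := by
            have h0 : (inner ℝ (u x) (w x ^ e • ⁅A k x, X x⁆) : ℝ) = 0 := by
              rw [real_inner_smul_right, hu, real_inner_smul_left, inner_lie_self, mul_zero,
                mul_zero]
            rw [hx, smul_add, ← add_assoc, inner_add_right (u x) _ (w x ^ e • ⁅A k x, X x⁆), h0,
              add_zero]
          rw [hin]
          set d := partialDeriv k (fun x => w x ^ e) x • X x + w x ^ e • covDeriv A k X x with hd
          have hdn : ‖d‖ ≤ |e| * w x ^ (e - 1) * ‖X x‖ + w x ^ e * ‖covDeriv A k X x‖ := by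
            refine (norm_add_le _ _).trans ?_
            rw [norm_smul, norm_smul, Real.norm_of_nonneg (w_rpow_pos x e).le, Real.norm_eq_abs]
            gcongr
            exact abs_partialDeriv_w_rpow_le e k x
          have h1 : ‖(2 * inner ℝ (u x) d) • ‖u x‖ ^ 2 + ‖u x‖ ^ 2 • (2 * inner ℝ (u x) d)‖ ≤
              4 * (‖u x‖ ^ 3 * ‖d‖) := by
            have h2 := abs_real_inner_le_norm (u x) d
            rw [smul_eq_mul, smul_eq_mul, show (2 * inner ℝ (u x) d) * ‖u x‖ ^ 2 +
              ‖u x‖ ^ 2 * (2 * inner ℝ (u x) d) = 4 * (‖u x‖ ^ 2 * inner ℝ (u x) d) by ring,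
              Real.norm_eq_abs, abs_mul, abs_mul, abs_of_nonneg (sq_nonneg ‖u x‖)]
            rw [abs_of_pos (show (0 : ℝ) < 4 by norm_num)]
            have := mul_le_mul_of_nonneg_left h2 (sq_nonneg ‖u x‖)
            nlinarith
          have h3 : U x ^ (3 : ℝ) = ENNReal.ofReal (‖u x‖ ^ 3) := by
            rw [hUu, ← ofReal_norm, ENNReal.ofReal_rpow_of_nonneg (norm_nonneg _) (by norm_num)]
            norm_cast
          rw [← ofReal_norm]
          refine (ENNReal.ofReal_le_ofReal h1).trans ?_
          rw [ENNReal.ofReal_mul (by norm_num), ENNReal.ofReal_mul (by positivity), h3]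
          gcongr
          · norm_num
          · exact ENNReal.ofReal_le_ofReal hdn
      _ = 4 * ∫⁻ x, U x ^ (3 : ℝ) * H k x := lintegral_const_mul' _ _ (by norm_num)
      _ ≤ 4 * ((∫⁻ x, (U x ^ (3 : ℝ)) ^ (2 : ℝ)) ^ (1 / 2 : ℝ) *
          (∫⁻ x, H k x ^ (2 : ℝ)) ^ (1 / 2 : ℝ)) := by
          gcongr
          exact ENNReal.lintegral_mul_le_Lp_mul_Lq volume Real.HolderConjugate.two_two
            (hUm.pow_const _) (hHm k)
      _ ≤ _ := by
          gcongr
          · refine le_of_eq (lintegral_congr fun x => ?_)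
            rw [← ENNReal.rpow_mul]
            norm_num
          · exact hH2 k
  have hfin : M ^ (2 / 3 : ℝ) ≤ (12 * S : ℝ≥0) *
      (M ^ (1 / 2 : ℝ) * ((2 + 2 * (Real.nnabs e) ^ 2 : ℝ≥0) * T) ^ (1 / 2 : ℝ)) := by
    rw [← hlhs]
    refine hsob.trans ?_
    calc _ ≤ (S : ℝ≥0∞) * ∑ _k : Fin 3, 4 * (M ^ (1 / 2 : ℝ) *
          ((2 + 2 * (Real.nnabs e) ^ 2 : ℝ≥0) * T) ^ (1 / 2 : ℝ)) := by
          gcongr with k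
          exact hrhs k
      _ = _ := by
          rw [Finset.sum_const, Finset.card_univ, Fintype.card_fin, nsmul_eq_mul]
          push_cast
          ring
  refine (rpow_third_le_of_rpow_two_thirds_le hMtop hfin).trans ?_
  rw [← mul_assoc]
  gcongr
  norm_cast
  gcongr
  norm_num

end Sobolev

end CovariantPoisson

/-! ### The weighted Bochner inequality -/

namespace CovariantPoisson

open Filter Topology Metric

section Bochner

variable {𝔤 : Type*} [NormedLieRing 𝔤] [CompactLieAlgebra 𝔤]

theorem norm_lie_le (x y : 𝔤) : ‖⁅x, y⁆‖ ≤ ‖lieCLM 𝔤‖ * ‖x‖ * ‖y‖ :=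
  (lieCLM 𝔤).le_opNorm₂ x y

/-- The algebraic Bochner identity at a point, with `p k l` in the role of `∇_k ∇_l Y`, `u l` of
`∇_l Y` and `dW` of the gradient of the weight `W`. -/
theorem bochner_identity (W : ℝ) (dW : Fin 3 → ℝ) (u : Fin 3 → 𝔤) (p G : Fin 3 → Fin 3 → 𝔤) (Y : 𝔤)
    (hp : ∀ k l, p k l = p l k - ⁅G k l, Y⁆) :
    ∑ k, ∑ l, W * ‖p k l‖ ^ 2 =
      (∑ k, ∑ l, (inner ℝ (W • p k l) (p l k) - inner ℝ (W • p l l) (p k k) +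
        inner ℝ (dW k • u l) (p l k) - inner ℝ (dW l • u l) (p k k) +
        inner ℝ (W • u l) ⁅-G k l, u k⁆)) + W * ‖∑ k, p k k‖ ^ 2 +
      (∑ k, ∑ l, (-(dW k * inner ℝ (u l) (p l k)) + dW l * inner ℝ (u l) (p k k) +
        W * inner ℝ (u l) ⁅G k l, u k⁆)) -
      ∑ k, ∑ l, W * inner ℝ (p k l) ⁅G k l, Y⁆ := by
  have h1 : W * ‖∑ k, p k k‖ ^ 2 = ∑ k, ∑ l, W * inner ℝ (p l l) (p k k) := by
    rw [← real_inner_self_eq_norm_sq, inner_sum, Finset.mul_sum]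
    refine Finset.sum_congr rfl fun k _ => ?_
    rw [sum_inner, Finset.mul_sum]
  rw [h1]
  simp only [← Finset.sum_add_distrib, ← Finset.sum_sub_distrib]
  refine Finset.sum_congr rfl fun k _ => Finset.sum_congr rfl fun l _ => ?_
  have h2 : ‖p k l‖ ^ 2 = inner ℝ (p k l) (p l k) - inner ℝ (p k l) ⁅G k l, Y⁆ := by
    rw [← inner_sub_right, ← hp k l, real_inner_self_eq_norm_sq]
  rw [h2, neg_lie, inner_neg_right]
  simp only [real_inner_smul_left]
  ring

/-- The lower order terms of the Bochner identity are absorbed by Young's inequality. Here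
`m, q, z` stand for `w^{e/2}`, `w^{e/2-1}`, `w^{e-2s}`. -/
theorem bochner_lower_order_le {m q z e a : ℝ} {dW : Fin 3 → ℝ} {u : Fin 3 → 𝔤}
    {p G : Fin 3 → Fin 3 → 𝔤} (hm : 0 ≤ m) (hq : 0 ≤ q) (hqz : q ^ 2 ≤ z)
    (hdW : ∀ k, |dW k| ≤ |e| * (m * q)) (hG : ∀ k l, m ^ 2 * ‖G k l‖ ≤ a * z) :
    ∑ k, ∑ l, (-(dW k * inner ℝ (u l) (p l k)) + dW l * inner ℝ (u l) (p k k) +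
        m ^ 2 * inner ℝ (u l) ⁅G k l, u k⁆) ≤
      1 / 4 * (∑ k, ∑ l, m ^ 2 * ‖p k l‖ ^ 2) +
        (24 * e ^ 2 + 3 * ‖lieCLM 𝔤‖ * a) * (z * ∑ l, ‖u l‖ ^ 2) := by
  have hyoung : ∀ (c : ℝ) (v b : 𝔤), |c| ≤ |e| * (m * q) →
      |c * inner ℝ v b| ≤ 1 / 16 * (m ^ 2 * ‖b‖ ^ 2) + 4 * e ^ 2 * (z * ‖v‖ ^ 2) :=
    fun c v b hc => by
      have h1 := abs_real_inner_le_norm v b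
      have h2 : |c * inner ℝ v b| ≤ (|e| * (m * q)) * (‖v‖ * ‖b‖) := by
        rw [abs_mul]
        exact mul_le_mul hc h1 (abs_nonneg _) (by positivity)
      have h3 : (|e| * (m * q)) * (‖v‖ * ‖b‖) ≤
          1 / 16 * (m * ‖b‖) ^ 2 + 4 * (|e| * (q * ‖v‖)) ^ 2 := by
        nlinarith [sq_nonneg (1 / 4 * (m * ‖b‖) - 2 * (|e| * (q * ‖v‖)))]
      have h4 : 4 * (|e| * (q * ‖v‖)) ^ 2 ≤ 4 * e ^ 2 * (z * ‖v‖ ^ 2) := by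
        rw [mul_pow, mul_pow, sq_abs]
        have := mul_le_mul_of_nonneg_right hqz (sq_nonneg ‖v‖)
        have := mul_le_mul_of_nonneg_left this (sq_nonneg e)
        linarith
      rw [mul_pow] at h3
      linarith
  have hz : 0 ≤ z := (sq_nonneg q).trans hqz
  have hlie : ∀ k l, m ^ 2 * inner ℝ (u l) ⁅G k l, u k⁆ ≤
      ‖lieCLM 𝔤‖ * a / 2 * (z * ‖u l‖ ^ 2 + z * ‖u k‖ ^ 2) := fun k l => by
    have h1 := real_inner_le_norm (u l) ⁅G k l, u k⁆
    have h2 := norm_lie_le (G k l) (u k)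
    have haz : 0 ≤ a * z := le_trans (by positivity) (hG k l)
    calc m ^ 2 * inner ℝ (u l) ⁅G k l, u k⁆
        ≤ m ^ 2 * (‖u l‖ * (‖lieCLM 𝔤‖ * ‖G k l‖ * ‖u k‖)) := by
          gcongr
          exact h1.trans (mul_le_mul_of_nonneg_left h2 (norm_nonneg _))
      _ = (m ^ 2 * ‖G k l‖) * (‖lieCLM 𝔤‖ * (‖u l‖ * ‖u k‖)) := by ring
      _ ≤ (a * z) * (‖lieCLM 𝔤‖ * (‖u l‖ * ‖u k‖)) :=
          mul_le_mul_of_nonneg_right (hG k l) (by positivity)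
      _ ≤ (a * z) * (‖lieCLM 𝔤‖ * ((‖u l‖ ^ 2 + ‖u k‖ ^ 2) / 2)) :=
          mul_le_mul_of_nonneg_left (mul_le_mul_of_nonneg_left
            (by nlinarith [sq_nonneg (‖u l‖ - ‖u k‖)]) (ContinuousLinearMap.opNorm_nonneg _)) haz
      _ = _ := by ring
  have hterm : ∀ k l, -(dW k * inner ℝ (u l) (p l k)) + dW l * inner ℝ (u l) (p k k) +
      m ^ 2 * inner ℝ (u l) ⁅G k l, u k⁆ ≤ 1 / 16 * (m ^ 2 * ‖p l k‖ ^ 2) +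
        1 / 16 * (m ^ 2 * ‖p k k‖ ^ 2) + 8 * e ^ 2 * (z * ‖u l‖ ^ 2) +
        ‖lieCLM 𝔤‖ * a / 2 * (z * ‖u l‖ ^ 2 + z * ‖u k‖ ^ 2) := fun k l => by
    have h1 := hyoung (dW k) (u l) (p l k) (hdW k)
    have h2 := hyoung (dW l) (u l) (p k k) (hdW l)
    have h3 := hlie k l
    have h4 := neg_le_of_abs_le h1
    have h5 := le_of_abs_le h2
    linarith
  refine (Finset.sum_le_sum fun k _ => Finset.sum_le_sum fun l _ => hterm k l).trans ?_
  have hpos : ∀ k l, 0 ≤ m ^ 2 * ‖p k l‖ ^ 2 := fun k l => by positivity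
  simp only [Fin.sum_univ_three]
  linarith [hpos 0 0, hpos 0 1, hpos 0 2, hpos 1 0, hpos 1 1, hpos 1 2, hpos 2 0, hpos 2 1, hpos 2 2]

variable {r : ℝ≥0∞} {N : ℕ} {A : Fin 3 → R3 → 𝔤}

theorem RegPotential.memLpLoc_curvature (hA : RegPotential r N A) {s a : ℝ} (hs : 0 ≤ s)
    (i : Fin 3 × Fin 3) (ha : ∀ᵐ x, w x ^ (2 * s) * ‖curvature A i x‖ ≤ a) :
    MemLpLoc (curvature A i) ∞ := by
  refine memLpLoc_top_of_ae_bound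
    ((hA.reg_curvature i).locallyIntegrable hA.one_le).aestronglyMeasurable a ?_
  filter_upwards [ha] with x hx
  refine le_trans ?_ hx
  exact le_mul_of_one_le_left (norm_nonneg _)
    (Real.one_le_rpow (one_le_w x) (by positivity))

/-- The exchange integrand for `u = ∇_l Y`, `v = ∇_k Y`. -/
noncomputable def exchangeTerm (A : Fin 3 → R3 → 𝔤) (e : ℝ) (Y : R3 → 𝔤) (k l : Fin 3) (x : R3) : ℝ :=
  exchangeForm (w x ^ e) (partialDeriv k (fun x => w x ^ e) x) (partialDeriv l (fun x => w x ^ e) x)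
    (A k x) (A l x) (-curvature A (k, l) x) (covDeriv A l Y x) (weakPartial k (covDeriv A l Y) x)
    (weakPartial l (covDeriv A l Y) x) (covDeriv A k Y x) (weakPartial k (covDeriv A k Y) x)
    (weakPartial l (covDeriv A k Y) x)

theorem RegPotential.integral_exchangeTerm (hA : RegPotential r N A) {s a e : ℝ} (hs : 0 ≤ s)
    (ha : ∀ i, ∀ᵐ x, w x ^ (2 * s) * ‖curvature A i x‖ ≤ a) {t : ℕ} (ht : t + 2 ≤ N)
    (h2 : 2 ≤ regExp r t) {Y : R3 → 𝔤} (hY : Reg r (t + 2) Y) {R : ℝ} (hR : VanishesOff R Y)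
    (k l : Fin 3) : Integrable (exchangeTerm A e Y k l) ∧ ∫ x, exchangeTerm A e Y k l x = 0 := by
  have h3 := hA.three_le
  have hu : ∀ l, Reg r (t + 1) (covDeriv A l Y) := fun l => hA.reg_covDeriv ht hY l
  have hd : ∀ k l, HasWeakDeriv [k] (covDeriv A l Y) (weakPartial k (covDeriv A l Y)) :=
    fun k l => (hu l).hasWeakDeriv k
  have m1 : ∀ l, MemLpLoc (covDeriv A l Y) 2 := fun l =>
    (hu l).memLpLoc_two hA.le_two (by omega)
  have m2 : ∀ k l, MemLpLoc (weakPartial k (covDeriv A l Y)) 2 := fun k l =>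
    ((hu l).weakPartial k).memLpLoc.mono_exponent h2
  have hAb : ∀ k, MemLpLoc (A k) ∞ := fun k => (hA.reg k).memLpLoc_top (by omega)
  have hAd : ∀ k l, HasWeakDeriv [l] (A k) (weakPartial l (A k)) := fun k l =>
    Reg.hasWeakDeriv (r := r) (j := N - 2) (by
      have := hA.reg k; rwa [show N - 1 = N - 2 + 1 by omega] at this) l
  have hv : ∀ l, VanishesOff R (covDeriv A l Y) := fun l => hR.covDeriv (hY.hasWeakDeriv l)
  exact integral_exchangeForm (hAb k) (hAb l) (hAd k l) (hAd l k)
    (hA.memLpLoc_curvature hs (k, l) (ha (k, l))).neg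
    (Eventually.of_forall fun x => by simp only [curvature]; abel) (contDiff_w_rpow e)
    (hd k l) (hd l l) (hd k k) (hd l k) (m1 l) (m2 k l) (m2 l l) (m1 k) (m2 k k) (m2 l k)
    (hv l) (hv k)

theorem exchangeTerm_eq (A : Fin 3 → R3 → 𝔤) (e : ℝ) (Y : R3 → 𝔤) (k l : Fin 3) (x : R3) :
    exchangeTerm A e Y k l x =
      inner ℝ (w x ^ e • covDeriv A k (covDeriv A l Y) x) (covDeriv A l (covDeriv A k Y) x) -
      inner ℝ (w x ^ e • covDeriv A l (covDeriv A l Y) x) (covDeriv A k (covDeriv A k Y) x) +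
      inner ℝ (partialDeriv k (fun x => w x ^ e) x • covDeriv A l Y x)
        (covDeriv A l (covDeriv A k Y) x) -
      inner ℝ (partialDeriv l (fun x => w x ^ e) x • covDeriv A l Y x)
        (covDeriv A k (covDeriv A k Y) x) +
      inner ℝ (w x ^ e • covDeriv A l Y x) ⁅-curvature A (k, l) x, covDeriv A k Y x⁆ := rfl

/-- The Bochner inequality before integration: up to the divergences `exchangeTerm`, second
covariant derivatives are controlled by the Laplacian, first derivatives, and the term pairing
`∇_k ∇_l Y` with the curvature. -/
theorem RegPotential.bochner_ae (hA : RegPotential r N A) {s a : ℝ} (e : ℝ) (hs1 : s ≤ 1)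
    (ha : ∀ i, ∀ᵐ x, w x ^ (2 * s) * ‖curvature A i x‖ ≤ a) {t : ℕ} (ht : t + 2 ≤ N)
    {Y : R3 → 𝔤} (hY : Reg r (t + 2) Y) :
    ∀ᵐ x, 3 / 4 * ∑ k, ∑ l, w x ^ e * ‖covDeriv A k (covDeriv A l Y) x‖ ^ 2 ≤
      (∑ k, ∑ l, exchangeTerm A e Y k l x) + w x ^ e * ‖covLaplacian A Y x‖ ^ 2 +
      (24 * e ^ 2 + 3 * ‖lieCLM 𝔤‖ * a) * (w x ^ (e - 2 * s) * ∑ l, ‖covDeriv A l Y x‖ ^ 2) -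
      ∑ k, ∑ l, w x ^ e * inner ℝ (covDeriv A k (covDeriv A l Y) x) ⁅curvature A (k, l) x, Y x⁆ := by
  have hcomm : ∀ᵐ x, ∀ k l, covDeriv A k (covDeriv A l Y) x =
      covDeriv A l (covDeriv A k Y) x - ⁅curvature A (k, l) x, Y x⁆ :=
    ae_all_iff.2 fun k => ae_all_iff.2 fun l => hA.covDeriv_comm ht hY k l
  filter_upwards [hcomm, ae_all_iff.2 ha] with x hx hax
  have hW : w x ^ e = (w x ^ (e / 2)) ^ 2 := by rw [← w_rpow_two_mul]; congr 1; ring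
  have h1 := bochner_identity (w x ^ e) (fun k => partialDeriv k (fun x => w x ^ e) x)
    (fun l => covDeriv A l Y x) (fun k l => covDeriv A k (covDeriv A l Y) x)
    (fun k l => curvature A (k, l) x) (Y x) hx
  have h2 := bochner_lower_order_le (m := w x ^ (e / 2)) (q := w x ^ (e / 2 - 1))
    (z := w x ^ (e - 2 * s)) (e := e) (a := a) (dW := fun k => partialDeriv k (fun x => w x ^ e) x)
    (u := fun l => covDeriv A l Y x) (p := fun k l => covDeriv A k (covDeriv A l Y) x)
    (G := fun k l => curvature A (k, l) x) (w_rpow_pos x _).le (w_rpow_pos x _).le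
    (by rw [← w_rpow_two_mul]; exact w_rpow_le x (by linarith))
    (fun k => by
      refine (abs_partialDeriv_w_rpow_le e k x).trans (le_of_eq ?_)
      rw [← w_rpow_add]
      congr 2
      ring)
    (fun k l => by
      rw [← hW, show e = (e - 2 * s) + 2 * s by ring, w_rpow_add, mul_assoc, mul_comm a]
      rw [show e - 2 * s + 2 * s - 2 * s = e - 2 * s by ring]
      exact mul_le_mul_of_nonneg_left (hax (k, l)) (w_rpow_pos x _).le)
  rw [← hW] at h2
  simp only [exchangeTerm_eq, covLaplacian]
  linarith

theorem RegPotential.integrable_sq_covDeriv (hA : RegPotential r N A) (e : ℝ) {t : ℕ}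
    (ht : t + 2 ≤ N) (h2 : 2 ≤ regExp r t) {Y : R3 → 𝔤} (hY : Reg r (t + 2) Y) {R : ℝ}
    (hR : VanishesOff R Y) (k l : Fin 3) :
    Integrable (fun x => w x ^ e * ‖covDeriv A k (covDeriv A l Y) x‖ ^ 2) := by
  have hu := hA.reg_covDeriv ht hY l
  have hp : MemLpLoc (covDeriv A k (covDeriv A l Y)) 2 :=
    (hA.reg_covDeriv (by omega) hu k).memLpLoc.mono_exponent h2
  have hv : VanishesOff R (covDeriv A k (covDeriv A l Y)) :=
    (hR.covDeriv (hY.hasWeakDeriv l)).covDeriv (hu.hasWeakDeriv k)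
  have hsq : LocallyIntegrable (fun x => ‖covDeriv A k (covDeriv A l Y) x‖ ^ 2) :=
    memLpLoc_one_iff.1 ((MemLpLoc.bilin 1 (innerSL ℝ) hp hp).congr
      (Eventually.of_forall fun x => real_inner_self_eq_norm_sq _))
  refine memLp_one_iff_integrable.1 (VanishesOff.memLp (R := R) ?_ (memLpLoc_one_iff.2
    (((contDiff_w_rpow e).continuous.memLpLoc ∞).smul_locallyIntegrable hsq)))
  filter_upwards [hv] with x hx hxR
  simp [hx hxR]

end Bochner

end CovariantPoisson

/-! ### Second covariant derivatives in weighted `L²` -/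

namespace CovariantPoisson

open Filter Topology Metric

section SecondDerivatives

variable {𝔤 : Type*} [NormedLieRing 𝔤] [CompactLieAlgebra 𝔤]
variable {r : ℝ≥0∞} {N : ℕ} {A : Fin 3 → R3 → 𝔤}

theorem RegPotential.aestronglyMeasurable_covDeriv (hA : RegPotential r N A) {t : ℕ}
    (ht : t + 1 ≤ N) {Y : R3 → 𝔤} (hY : Reg r (t + 1) Y) (k : Fin 3) :
    AEStronglyMeasurable (covDeriv A k Y) volume :=
  ((hA.reg_covDeriv ht hY k).locallyIntegrable hA.one_le).aestronglyMeasurable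

/-- Integration of a pointwise bound for the second covariant derivatives, up to a sum of
divergences: the divergences of the exchange identity and a further one, `E`. -/
theorem RegPotential.sum_weightedSq_le (hA : RegPotential r N A) {s a : ℝ} (e : ℝ) (hs : 0 ≤ s)
    (ha : ∀ i, ∀ᵐ x, w x ^ (2 * s) * ‖curvature A i x‖ ≤ a) {t : ℕ} (ht : t + 2 ≤ N)
    (h2 : 2 ≤ regExp r t) {Y : R3 → 𝔤} (hY : Reg r (t + 2) Y) {R : ℝ} (hR : VanishesOff R Y)
    {E g : R3 → ℝ} (hE : Integrable E) (hE0 : ∫ x, E x = 0)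
    (h : ∀ᵐ x, 1 / 2 * ∑ k, ∑ l, w x ^ e * ‖covDeriv A k (covDeriv A l Y) x‖ ^ 2 ≤
      g x + ((∑ k, ∑ l, exchangeTerm A e Y k l x) + E x)) :
    ∑ k, ∑ l, weightedSq e (covDeriv A k (covDeriv A l Y)) ≤
      2 * ∫⁻ x, ENNReal.ofReal (g x) := by
  have hex := fun k l => hA.integral_exchangeTerm (e := e) hs ha ht h2 hY hR k l
  have hI : Integrable (fun x => ∑ k, ∑ l, exchangeTerm A e Y k l x) :=
    integrable_finsetSum _ fun k _ => integrable_finsetSum _ fun l _ => (hex k l).1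
  have hI0 : ∫ x, ∑ k, ∑ l, exchangeTerm A e Y k l x = 0 := by
    rw [integral_finsetSum _ fun k _ => integrable_finsetSum _ fun l _ => (hex k l).1]
    refine Finset.sum_eq_zero fun k _ => ?_
    rw [integral_finsetSum _ fun l _ => (hex k l).1]
    exact Finset.sum_eq_zero fun l _ => (hex k l).2
  have hsq := fun k l => hA.integrable_sq_covDeriv e ht h2 hY hR k l
  have h1 := lintegral_le_of_integral_eq_zero
    (fun x => by have := w_rpow_pos x e; positivity)
    ((integrable_finsetSum _ fun k _ => integrable_finsetSum _ fun l _ => hsq k l).const_mul _)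
    (hI.add hE) (by rw [integral_add' hI hE, hI0, hE0, add_zero]) h
  have hnn : ∀ k l x, 0 ≤ w x ^ e * ‖covDeriv A k (covDeriv A l Y) x‖ ^ 2 := fun k l x =>
    mul_nonneg (w_rpow_pos x e).le (sq_nonneg _)
  have h3 : ∑ k, ∑ l, weightedSq e (covDeriv A k (covDeriv A l Y)) =
      2 * ∫⁻ x, ENNReal.ofReal
        (1 / 2 * ∑ k, ∑ l, w x ^ e * ‖covDeriv A k (covDeriv A l Y) x‖ ^ 2) := by
    rw [← lintegral_const_mul' _ _ (by norm_num)]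
    simp only [weightedSq]
    have hm : ∀ k l, AEMeasurable (fun x => ENNReal.ofReal
        (w x ^ e * ‖covDeriv A k (covDeriv A l Y) x‖ ^ 2)) volume := fun k l =>
      (hsq k l).aestronglyMeasurable.aemeasurable.ennreal_ofReal
    rw [Finset.sum_congr rfl fun k _ => (lintegral_finsetSum' _ fun l _ => hm k l).symm,
      ← lintegral_finsetSum' _ fun k _ => Finset.aemeasurable_fun_sum _ fun l _ => hm k l]
    refine lintegral_congr fun x => ?_
    rw [show (2 : ℝ≥0∞) = ENNReal.ofReal 2 by norm_num, ← ENNReal.ofReal_mul (by norm_num),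
      ← mul_assoc, show (2 : ℝ) * (1 / 2) = 1 by norm_num, one_mul,
      ENNReal.ofReal_sum_of_nonneg fun k _ => Finset.sum_nonneg fun l _ => hnn k l x]
    exact Finset.sum_congr rfl fun k _ =>
      (ENNReal.ofReal_sum_of_nonneg fun l _ => hnn k l x).symm
  rw [h3]
  gcongr

/-- The pairing with the curvature is bounded by `d^{-2}` when `d²|g| ≤ c`. -/
theorem abs_inner_lie_le {c d : ℝ} (p g y : 𝔤) (hg : d ^ 2 * ‖g‖ ≤ c) :
    |inner ℝ p ⁅g, y⁆| * d ^ 2 ≤ ‖lieCLM 𝔤‖ * c * (‖p‖ * ‖y‖) := by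
  have h1 := abs_real_inner_le_norm p ⁅g, y⁆
  have h2 := mul_le_mul_of_nonneg_left (norm_lie_le g y) (norm_nonneg p)
  have h3 : 0 ≤ ‖lieCLM 𝔤‖ := ContinuousLinearMap.opNorm_nonneg _
  calc _ ≤ (‖p‖ * (‖lieCLM 𝔤‖ * ‖g‖ * ‖y‖)) * d ^ 2 :=
        mul_le_mul_of_nonneg_right (h1.trans h2) (sq_nonneg d)
    _ = (‖lieCLM 𝔤‖ * (‖p‖ * ‖y‖)) * (d ^ 2 * ‖g‖) := by ring
    _ ≤ (‖lieCLM 𝔤‖ * (‖p‖ * ‖y‖)) * c := mul_le_mul_of_nonneg_left hg (by positivity)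
    _ = _ := by ring

theorem lintegral_ofReal_add_le {f g : R3 → ℝ} (hf : AEMeasurable f volume) :
    ∫⁻ x, ENNReal.ofReal (f x + g x) ≤
      (∫⁻ x, ENNReal.ofReal (f x)) + ∫⁻ x, ENNReal.ofReal (g x) := by
  rw [← lintegral_add_left' hf.ennreal_ofReal (fun x => ENNReal.ofReal (g x))]
  exact lintegral_mono fun x => ENNReal.ofReal_add_le

theorem lintegral_const_mul_sum_weightedSq {V ι : Type*} [NormedAddCommGroup V] [Fintype ι]
    {c : ℝ} (hc : 0 ≤ c) (e : ℝ) {u : ι → R3 → V}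
    (hu : ∀ l, AEStronglyMeasurable (u l) volume) :
    ∫⁻ x, ENNReal.ofReal (c * (w x ^ e * ∑ l, ‖u l x‖ ^ 2)) =
      ENNReal.ofReal c * ∑ l, weightedSq e (u l) := by
  simp only [weightedSq]
  rw [← lintegral_finsetSum' _ fun l _ => aemeasurable_weightedSq e (hu l),
    ← lintegral_const_mul' _ _ ENNReal.ofReal_ne_top]
  refine lintegral_congr fun x => ?_
  rw [ENNReal.ofReal_mul hc, Finset.mul_sum, ENNReal.ofReal_sum_of_nonneg fun l _ =>
    mul_nonneg (w_rpow_pos x e).le (sq_nonneg _)]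

theorem aemeasurable_const_mul_sum_weightedSq (c e : ℝ) {u : Fin 3 → R3 → 𝔤}
    (hu : ∀ l, AEStronglyMeasurable (u l) volume) :
    AEMeasurable (fun x => c * (w x ^ e * ∑ l, ‖u l x‖ ^ 2)) volume :=
  ((contDiff_w_rpow e).continuous.aemeasurable.mul
    (Finset.aemeasurable_fun_sum _ fun l _ => (hu l).norm.aemeasurable.pow_const 2)).const_mul c

theorem aemeasurable_w_rpow_mul_sq (e : ℝ) {u : R3 → 𝔤} (hu : AEStronglyMeasurable u volume) :
    AEMeasurable (fun x => w x ^ e * ‖u x‖ ^ 2) volume :=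
  (contDiff_w_rpow e).continuous.aemeasurable.mul (hu.norm.aemeasurable.pow_const 2)

/-- The weighted second derivative estimate in which the curvature is put on `Y` without
differentiating it. -/
theorem RegPotential.sum_weightedSq_le_of_curvature_sq (hA : RegPotential r N A) {s a : ℝ} (e : ℝ)
    (hs : 0 ≤ s) (hs1 : s ≤ 1) (ha0 : 0 ≤ a)
    (ha : ∀ i, ∀ᵐ x, w x ^ (2 * s) * ‖curvature A i x‖ ≤ a) {t : ℕ} (ht : t + 2 ≤ N)
    (h2 : 2 ≤ regExp r t) {Y : R3 → 𝔤} (hY : Reg r (t + 2) Y) {R : ℝ} (hR : VanishesOff R Y) :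
    ∑ k, ∑ l, weightedSq e (covDeriv A k (covDeriv A l Y)) ≤
      2 * (weightedSq e (covLaplacian A Y) +
        (ENNReal.ofReal (24 * e ^ 2 + 3 * ‖lieCLM 𝔤‖ * a) *
          ∑ l, weightedSq (e - 2 * s) (covDeriv A l Y) +
        ENNReal.ofReal (9 * (‖lieCLM 𝔤‖ * a) ^ 2) * weightedSq (e - 4 * s) Y)) := by
  have h3 : 0 ≤ ‖lieCLM 𝔤‖ := ContinuousLinearMap.opNorm_nonneg _
  have hm1 : ∀ l, AEStronglyMeasurable (covDeriv A l Y) volume := fun l =>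
    hA.aestronglyMeasurable_covDeriv ht hY l
  have hm2 : AEStronglyMeasurable (covLaplacian A Y) volume :=
    ((hA.reg_covLaplacian ht le_rfl hY).locallyIntegrable hA.one_le).aestronglyMeasurable
  refine (hA.sum_weightedSq_le (E := fun _ => 0) (g := fun x =>
    w x ^ e * ‖covLaplacian A Y x‖ ^ 2 + ((24 * e ^ 2 + 3 * ‖lieCLM 𝔤‖ * a) *
      (w x ^ (e - 2 * s) * ∑ l, ‖covDeriv A l Y x‖ ^ 2) +
      (9 * (‖lieCLM 𝔤‖ * a) ^ 2) * (w x ^ (e - 4 * s) * ‖Y x‖ ^ 2))) e hs ha ht h2 hY hR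
    (integrable_zero _ _ _) (by simp) ?_).trans ?_
  · filter_upwards [hA.bochner_ae e hs1 ha ht hY, ae_all_iff.2 ha] with x hx hax
    have hterm : ∀ k l, -(w x ^ e * inner ℝ (covDeriv A k (covDeriv A l Y) x)
        ⁅curvature A (k, l) x, Y x⁆) ≤ 1 / 4 * (w x ^ e * ‖covDeriv A k (covDeriv A l Y) x‖ ^ 2) +
          (‖lieCLM 𝔤‖ * a) ^ 2 * (w x ^ (e - 4 * s) * ‖Y x‖ ^ 2) := fun k l => by
      have h4 := abs_inner_lie_le (c := a) (d := w x ^ s) (covDeriv A k (covDeriv A l Y) x)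
        (curvature A (k, l) x) (Y x) (by rw [← w_rpow_two_mul]; exact hax (k, l))
      set P := ‖covDeriv A k (covDeriv A l Y) x‖
      have h5 : w x ^ e = (w x ^ (e / 2)) * (w x ^ (e / 2 - 2 * s)) * (w x ^ s) ^ 2 := by
        rw [← w_rpow_two_mul, ← w_rpow_add, ← w_rpow_add]; ring_nf
      have h6 : w x ^ e = (w x ^ (e / 2)) ^ 2 := by rw [← w_rpow_two_mul]; congr 1; ring
      have h7 : w x ^ (e - 4 * s) = (w x ^ (e / 2 - 2 * s)) ^ 2 := by
        rw [← w_rpow_two_mul]; congr 1; ring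
      have h8 := w_rpow_pos x (e / 2)
      have h9 := w_rpow_pos x (e / 2 - 2 * s)
      refine (neg_le_abs _).trans ?_
      rw [abs_mul, abs_of_pos (w_rpow_pos x e)]
      calc _ = (w x ^ (e / 2) * w x ^ (e / 2 - 2 * s)) * (|inner ℝ
            (covDeriv A k (covDeriv A l Y) x) ⁅curvature A (k, l) x, Y x⁆| * (w x ^ s) ^ 2) := by
            rw [h5]; ring
        _ ≤ (w x ^ (e / 2) * w x ^ (e / 2 - 2 * s)) * (‖lieCLM 𝔤‖ * a * (P * ‖Y x‖)) :=
            mul_le_mul_of_nonneg_left h4 (by positivity)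
        _ ≤ _ := by
            rw [h6, h7]
            nlinarith [sq_nonneg (1 / 2 * (w x ^ (e / 2) * P) -
              ‖lieCLM 𝔤‖ * a * (w x ^ (e / 2 - 2 * s) * ‖Y x‖))]
    have hsum := Finset.sum_le_sum fun k (_ : k ∈ Finset.univ) =>
      Finset.sum_le_sum fun l (_ : l ∈ Finset.univ) => hterm k l
    simp only [Finset.sum_add_distrib, ← Finset.mul_sum, Finset.sum_neg_distrib,
      Finset.sum_const, Finset.card_univ, Fintype.card_fin, nsmul_eq_mul] at hsum
    simp only [← Finset.mul_sum] at hx ⊢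
    push_cast at hsum
    linarith
  · gcongr
    refine (lintegral_ofReal_add_le (aemeasurable_w_rpow_mul_sq e hm2)).trans ?_
    refine add_le_add le_rfl ((lintegral_ofReal_add_le
      (aemeasurable_const_mul_sum_weightedSq _ _ hm1)).trans ?_)
    refine add_le_add ?_ ?_
    · exact (lintegral_const_mul_sum_weightedSq (by positivity) _ hm1).le
    · exact (lintegral_const_mul_weightedSq (by positivity) _ _).le

/-- The divergence `∂_k (w^e ⟨∇_l Φ, [G_{kl}, Φ]⟩)`. -/
noncomputable def curvatureFlux (A : Fin 3 → R3 → 𝔤) (e : ℝ) (Φ : R3 → 𝔤) (k l : Fin 3) (x : R3) : ℝ :=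
  partialDeriv k (fun x => w x ^ e) x * inner ℝ (covDeriv A l Φ x) ⁅curvature A (k, l) x, Φ x⁆ +
  w x ^ e * (inner ℝ (covDeriv A k (covDeriv A l Φ) x) ⁅curvature A (k, l) x, Φ x⁆ +
    inner ℝ (covDeriv A l Φ x) (⁅covDeriv A k (curvature A (k, l)) x, Φ x⁆ +
      ⁅curvature A (k, l) x, covDeriv A k Φ x⁆))

theorem RegPotential.integral_curvatureFlux (hA : RegPotential r N A) {s a : ℝ} (e : ℝ)
    (hs : 0 ≤ s) (ha : ∀ i, ∀ᵐ x, w x ^ (2 * s) * ‖curvature A i x‖ ≤ a)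
    {Φ : R3 → 𝔤} (hΦ : Reg r N Φ) {R : ℝ} (hR : VanishesOff R Φ) (k l : Fin 3) :
    Integrable (curvatureFlux A e Φ k l) ∧ ∫ x, curvatureFlux A e Φ k l x = 0 := by
  have h3 := hA.three_le
  have ru : Reg r (N - 1) (covDeriv A l Φ) := hA.reg_covDeriv' le_rfl (by omega) hΦ l
  have rG := hA.reg_curvature (k, l)
  have hu : HasWeakDeriv [k] (covDeriv A l Φ) (weakPartial k (covDeriv A l Φ)) :=
    Reg.hasWeakDeriv (r := r) (j := N - 2) (by rwa [show N - 1 = N - 2 + 1 by omega] at ru) k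
  have hub : MemLpLoc (covDeriv A l Φ) ∞ := ru.memLpLoc_top (by omega)
  have hH := hA.hasWeakDeriv_lie (i := N - 2) (by omega) le_rfl (by omega) rG hΦ k
  have hH' := hA.covDeriv_lie (i := N - 2) (by omega) le_rfl (by omega) rG hΦ k
  have hHb : MemLpLoc (fun x => ⁅curvature A (k, l) x, Φ x⁆) ∞ :=
    MemLpLoc.bilin (p := ∞) (q := ∞) ∞ (lieCLM 𝔤) (hA.memLpLoc_curvature hs _ (ha (k, l)))
      (hΦ.memLpLoc_top (by omega))
  have hF := (hu.bilin (innerSL ℝ) hH hHb (Or.inr hub)).smooth_smul (contDiff_w_rpow e)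
  have hF' := hF.congr (g' := curvatureFlux A e Φ k l) .rfl (by
    filter_upwards [covDeriv_ae_eq A hH, hH'] with x h1 h2
    rw [h2] at h1
    have h4 : covDeriv A k (covDeriv A l Φ) x =
      weakPartial k (covDeriv A l Φ) x + ⁅A k x, covDeriv A l Φ x⁆ := rfl
    rw [curvatureFlux, h1, h4, inner_add_left, inner_add_right _ (_ + _), inner_lie_left _ (A k x)]
    change _ * inner ℝ _ _ + _ * (inner ℝ _ _ + inner ℝ _ _) = _
    ring)
  have hv : VanishesOff R (fun x => w x ^ e • innerSL ℝ (covDeriv A l Φ x)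
      ⁅curvature A (k, l) x, Φ x⁆) := by
    filter_upwards [hR] with x hx hxR
    simp [hx hxR]
  exact ⟨memLp_one_iff_integrable.1 ((hF'.vanishesOff hv).memLp
    (memLpLoc_one_iff.2 hF'.locallyIntegrable_right)), hF'.integral_eq_zero hv⟩

/-- The weighted second derivative estimate in which one derivative of the term pairing `∇_k ∇_l Φ`
with the curvature is moved to the other factors; the divergence of the curvature appears. -/
theorem RegPotential.sum_weightedSq_le_of_divCurvature (hA : RegPotential r N A) {s a : ℝ}
    (hs : 0 ≤ s) (hs1 : s ≤ 1) (ha0 : 0 ≤ a)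
    (ha : ∀ i, ∀ᵐ x, w x ^ (2 * s) * ‖curvature A i x‖ ≤ a) (h2 : 2 ≤ regExp r (N - 2))
    {Φ : R3 → 𝔤} (hΦ : Reg r N Φ) {R : ℝ} (hR : VanishesOff R Φ) :
    ∑ k, ∑ l, weightedSq s (covDeriv A k (covDeriv A l Φ)) ≤
      2 * (weightedSq s (covLaplacian A Φ) +
        (ENNReal.ofReal (25 + 9 * ‖lieCLM 𝔤‖ * a) * ∑ l, weightedSq (-s) (covDeriv A l Φ) +
        (ENNReal.ofReal (9 * ‖lieCLM 𝔤‖ * a) * weightedSq (-s - 2) Φ +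
        ENNReal.ofReal (‖lieCLM 𝔤‖ ^ 2) *
          ∑ l, weightedSq (3 * s) (fun x => ‖divCurvature A l x‖ * ‖Φ x‖)))) := by
  have h3 : 0 ≤ ‖lieCLM 𝔤‖ := ContinuousLinearMap.opNorm_nonneg _
  have hN := hA.three_le
  obtain ⟨t, rfl⟩ : ∃ t, N = t + 2 := ⟨N - 2, by omega⟩
  have hm1 : ∀ l, AEStronglyMeasurable (covDeriv A l Φ) volume := fun l =>
    hA.aestronglyMeasurable_covDeriv le_rfl hΦ l
  have hm0 : AEStronglyMeasurable Φ volume := (hΦ.locallyIntegrable hA.one_le).aestronglyMeasurable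
  have hm2 : AEStronglyMeasurable (covLaplacian A Φ) volume :=
    ((hA.reg_covLaplacian le_rfl le_rfl hΦ).locallyIntegrable hA.one_le).aestronglyMeasurable
  have hm3 : ∀ l, AEStronglyMeasurable (fun x => ‖divCurvature A l x‖ * ‖Φ x‖) volume := fun l =>
    ((hA.reg_divCurvature l).locallyIntegrable hA.one_le).aestronglyMeasurable.norm.mul hm0.norm
  have hfl := fun k l => hA.integral_curvatureFlux s hs ha hΦ hR k l
  refine (hA.sum_weightedSq_le (E := fun x => -∑ k, ∑ l, curvatureFlux A s Φ k l x) (g := fun x =>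
    w x ^ s * ‖covLaplacian A Φ x‖ ^ 2 + ((25 + 9 * ‖lieCLM 𝔤‖ * a) *
      (w x ^ (-s) * ∑ l, ‖covDeriv A l Φ x‖ ^ 2) +
      ((9 * ‖lieCLM 𝔤‖ * a) * (w x ^ (-s - 2) * ‖Φ x‖ ^ 2) +
      ‖lieCLM 𝔤‖ ^ 2 * (w x ^ (3 * s) * ∑ l, ‖‖divCurvature A l x‖ * ‖Φ x‖‖ ^ 2)))) s hs ha le_rfl
      h2 hΦ hR (integrable_finsetSum _ fun k _ => integrable_finsetSum _ fun l _ => (hfl k l).1).neg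
      ?_ ?_).trans ?_
  · rw [integral_neg, integral_finsetSum _ fun k _ => integrable_finsetSum _ fun l _ => (hfl k l).1]
    refine neg_eq_zero.2 (Finset.sum_eq_zero fun k _ => ?_)
    rw [integral_finsetSum _ fun l _ => (hfl k l).1]
    exact Finset.sum_eq_zero fun l _ => (hfl k l).2
  · filter_upwards [hA.bochner_ae s hs1 ha le_rfl hΦ, ae_all_iff.2 ha] with x hx hax
    -- Solving the definition of `curvatureFlux` for the term with `∇_k ∇_l Φ`; all other terms but
    -- the one with the derivative of the curvature are bounded.
    have hterm : ∀ k l, -(w x ^ s * inner ℝ (covDeriv A k (covDeriv A l Φ) x)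
        ⁅curvature A (k, l) x, Φ x⁆) ≤ -curvatureFlux A s Φ k l x +
          w x ^ s * inner ℝ (covDeriv A l Φ x) ⁅covDeriv A k (curvature A (k, l)) x, Φ x⁆ +
          ‖lieCLM 𝔤‖ * a / 2 * (2 * (w x ^ (-s) * ‖covDeriv A l Φ x‖ ^ 2) +
            w x ^ (-s) * ‖covDeriv A k Φ x‖ ^ 2 + w x ^ (-s - 2) * ‖Φ x‖ ^ 2) := fun k l => by
      have hg : (w x ^ s) ^ 2 * ‖curvature A (k, l) x‖ ≤ a := by
        rw [← w_rpow_two_mul]; exact hax (k, l)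
      have b1 := abs_inner_lie_le (covDeriv A l Φ x) (curvature A (k, l) x) (Φ x) hg
      have b2 := abs_inner_lie_le (covDeriv A l Φ x) (curvature A (k, l) x) (covDeriv A k Φ x) hg
      have hd := abs_partialDeriv_w_rpow_le s k x
      have hm := w_rpow_pos x (-s / 2)
      have hq := w_rpow_pos x (-s / 2 - 1)
      have c1 : w x ^ (-s) = (w x ^ (-s / 2)) ^ 2 := by rw [← w_rpow_two_mul]; ring_nf
      have c2 : w x ^ (-s - 2) = (w x ^ (-s / 2 - 1)) ^ 2 := by rw [← w_rpow_two_mul]; ring_nf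
      have c3 : w x ^ s = (w x ^ (-s / 2)) ^ 2 * (w x ^ s) ^ 2 := by
        rw [← w_rpow_two_mul, ← w_rpow_two_mul, ← w_rpow_add]; ring_nf
      have c4 : w x ^ (s - 1) = w x ^ (-s / 2) * w x ^ (-s / 2 - 1) * (w x ^ s) ^ 2 := by
        rw [← w_rpow_two_mul, ← w_rpow_add, ← w_rpow_add]; ring_nf
      have t1 : partialDeriv k (fun x => w x ^ s) x * inner ℝ (covDeriv A l Φ x)
          ⁅curvature A (k, l) x, Φ x⁆ ≤ w x ^ (-s / 2) * w x ^ (-s / 2 - 1) *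
            (‖lieCLM 𝔤‖ * a * (‖covDeriv A l Φ x‖ * ‖Φ x‖)) := by
        refine (le_abs_self _).trans ?_
        rw [abs_mul]
        have hd' : |partialDeriv k (fun x => w x ^ s) x| ≤ w x ^ (s - 1) := by
          refine hd.trans ?_
          rw [abs_of_nonneg hs]
          exact mul_le_of_le_one_left (w_rpow_pos x _).le hs1
        refine (mul_le_mul_of_nonneg_right hd' (abs_nonneg _)).trans ?_
        rw [c4, mul_assoc (w x ^ (-s / 2) * _), mul_comm ((w x ^ s) ^ 2)]
        exact mul_le_mul_of_nonneg_left b1 (by positivity)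
      have t2 : w x ^ s * inner ℝ (covDeriv A l Φ x) ⁅curvature A (k, l) x, covDeriv A k Φ x⁆ ≤
          (w x ^ (-s / 2)) ^ 2 *
            (‖lieCLM 𝔤‖ * a * (‖covDeriv A l Φ x‖ * ‖covDeriv A k Φ x‖)) := by
        refine (mul_le_mul_of_nonneg_left (le_abs_self _) (w_rpow_pos x s).le).trans ?_
        rw [c3, mul_assoc, mul_comm ((w x ^ s) ^ 2)]
        exact mul_le_mul_of_nonneg_left b2 (by positivity)
      have t3 : w x ^ (-s / 2) * w x ^ (-s / 2 - 1) *
            (‖lieCLM 𝔤‖ * a * (‖covDeriv A l Φ x‖ * ‖Φ x‖)) ≤ ‖lieCLM 𝔤‖ * a *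
            (((w x ^ (-s / 2) * ‖covDeriv A l Φ x‖) ^ 2 + (w x ^ (-s / 2 - 1) * ‖Φ x‖) ^ 2) / 2) := by
        have := mul_le_mul_of_nonneg_left (two_mul_le_add_sq (w x ^ (-s / 2) * ‖covDeriv A l Φ x‖)
          (w x ^ (-s / 2 - 1) * ‖Φ x‖)) (mul_nonneg h3 ha0)
        linarith
      have t4 : (w x ^ (-s / 2)) ^ 2 *
            (‖lieCLM 𝔤‖ * a * (‖covDeriv A l Φ x‖ * ‖covDeriv A k Φ x‖)) ≤ ‖lieCLM 𝔤‖ * a *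
            (((w x ^ (-s / 2) * ‖covDeriv A l Φ x‖) ^ 2 +
              (w x ^ (-s / 2) * ‖covDeriv A k Φ x‖) ^ 2) / 2) := by
        have := mul_le_mul_of_nonneg_left (two_mul_le_add_sq (w x ^ (-s / 2) * ‖covDeriv A l Φ x‖)
          (w x ^ (-s / 2) * ‖covDeriv A k Φ x‖)) (mul_nonneg h3 ha0)
        linarith
      rw [curvatureFlux, inner_add_right]
      simp only [mul_pow] at t3 t4
      rw [c1, c2]
      linarith
    -- Summation over `k` turns `∇_k G_{kl}` into the divergence `(∇·G)_l`.
    have hdiv : ∀ l, ∑ k, w x ^ s * inner ℝ (covDeriv A l Φ x)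
        ⁅covDeriv A k (curvature A (k, l)) x, Φ x⁆ ≤ w x ^ (-s) * ‖covDeriv A l Φ x‖ ^ 2 / 4 +
          ‖lieCLM 𝔤‖ ^ 2 * (w x ^ (3 * s) * ‖‖divCurvature A l x‖ * ‖Φ x‖‖ ^ 2) := fun l => by
      rw [← Finset.mul_sum, ← inner_sum, ← sum_lie]
      change w x ^ s * inner ℝ _ ⁅divCurvature A l x, Φ x⁆ ≤ _
      have hm := w_rpow_pos x (-s / 2)
      have hb := w_rpow_pos x (3 * s / 2)
      have c1 : w x ^ (-s) = (w x ^ (-s / 2)) ^ 2 := by rw [← w_rpow_two_mul]; ring_nf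
      have c2 : w x ^ (3 * s) = (w x ^ (3 * s / 2)) ^ 2 := by rw [← w_rpow_two_mul]; ring_nf
      have c3 : w x ^ s = w x ^ (-s / 2) * w x ^ (3 * s / 2) := by rw [← w_rpow_add]; ring_nf
      have h4 := (real_inner_le_norm (covDeriv A l Φ x) ⁅divCurvature A l x, Φ x⁆).trans
        (mul_le_mul_of_nonneg_left (norm_lie_le _ _) (norm_nonneg _))
      refine (mul_le_mul_of_nonneg_left h4 (w_rpow_pos x s).le).trans ?_
      rw [c1, c2, c3, Real.norm_of_nonneg (by positivity)]
      nlinarith [sq_nonneg (1 / 2 * (w x ^ (-s / 2) * ‖covDeriv A l Φ x‖) -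
        ‖lieCLM 𝔤‖ * (w x ^ (3 * s / 2) * (‖divCurvature A l x‖ * ‖Φ x‖)))]
    have hsum := Finset.sum_le_sum fun k (_ : k ∈ Finset.univ) =>
      Finset.sum_le_sum fun l (_ : l ∈ Finset.univ) => hterm k l
    have hsum' := Finset.sum_le_sum fun l (_ : l ∈ Finset.univ) => hdiv l
    rw [Finset.sum_comm] at hsum'
    simp only [Finset.sum_add_distrib, ← Finset.mul_sum, Finset.sum_neg_distrib, ← Finset.sum_div,
      Finset.sum_const, Finset.card_univ, Fintype.card_fin, nsmul_eq_mul] at hsum hsum'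
    simp only [← Finset.mul_sum] at hx ⊢
    push_cast at hsum hsum'
    rw [show s - 2 * s = -s by ring] at hx
    have hu0 : 0 ≤ w x ^ (-s) * ∑ l, ‖covDeriv A l Φ x‖ ^ 2 :=
      mul_nonneg (w_rpow_pos x _).le (Finset.sum_nonneg fun l _ => sq_nonneg _)
    have hΦ0 : 0 ≤ w x ^ (-s - 2) * ‖Φ x‖ ^ 2 := mul_nonneg (w_rpow_pos x _).le (sq_nonneg _)
    have hpp : 0 ≤ w x ^ s * ∑ k, ∑ l, ‖covDeriv A k (covDeriv A l Φ) x‖ ^ 2 :=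
      mul_nonneg (w_rpow_pos x _).le (Finset.sum_nonneg fun k _ =>
        Finset.sum_nonneg fun l _ => sq_nonneg _)
    have e1 := mul_nonneg (mul_nonneg h3 ha0) hu0
    have e2 := mul_nonneg (mul_nonneg h3 ha0) hΦ0
    have e3 : s ^ 2 ≤ 1 := by nlinarith
    have e4 := mul_le_mul_of_nonneg_right e3 hu0
    linarith
  · gcongr
    refine (lintegral_ofReal_add_le (aemeasurable_w_rpow_mul_sq s hm2)).trans ?_
    refine add_le_add le_rfl ((lintegral_ofReal_add_le
      (aemeasurable_const_mul_sum_weightedSq _ _ hm1)).trans ?_)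
    refine add_le_add ?_ ((lintegral_ofReal_add_le
      ((aemeasurable_w_rpow_mul_sq _ hm0).const_mul _)).trans ?_)
    · exact (lintegral_const_mul_sum_weightedSq (by positivity) _ hm1).le
    refine add_le_add ?_ ?_
    · exact (lintegral_const_mul_weightedSq (by positivity) _ _).le
    · exact (lintegral_const_mul_sum_weightedSq (by positivity) _ hm3).le

end SecondDerivatives

end CovariantPoisson

/-! ### The commutator terms in weighted `L²` -/

namespace CovariantPoisson

open Filter Topology Metric

section CommutatorBounds

variable {𝔤 : Type*} [NormedLieRing 𝔤] [CompactLieAlgebra 𝔤]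
variable {r : ℝ≥0∞} {N : ℕ} {A : Fin 3 → R3 → 𝔤}

theorem covDerivs_ofFn (A : Fin 3 → R3 → 𝔤) {p : ℕ} (α : Fin p → Fin 3) (X : R3 → 𝔤) :
    covDerivs A (List.ofFn α) X = iterCovDeriv A α X := rfl

theorem covDerivs_eq_iterCovDeriv (A : Fin 3 → R3 → 𝔤) {p : ℕ} {I : List (Fin 3)}
    (hI : I.length = p) (X : R3 → 𝔤) : ∃ α : Fin p → Fin 3, covDerivs A I X = iterCovDeriv A α X := by
  subst hI
  exact ⟨I.get, by rw [← covDerivs_ofFn, List.ofFn_get]⟩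

/-- The square of `‖Φ‖_{n,2}`. -/
noncomputable def sobolevSq (s : ℝ) (A : Fin 3 → R3 → 𝔤) (n : ℕ) (Φ : R3 → 𝔤) : ℝ≥0∞ :=
  ∑ p ∈ Finset.Icc 1 n, ∑ α : Fin p → Fin 3,
    weightedSq ((2 * (p : ℝ) - 3) * s) (iterCovDeriv A α Φ)

/-- The square of `‖w^{(n-3/2)s} ∇^{n-2} Δ(A) Φ‖₂`. -/
noncomputable def laplacianSq (s : ℝ) (A : Fin 3 → R3 → 𝔤) (n : ℕ) (Φ : R3 → 𝔤) : ℝ≥0∞ :=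
  ∑ α : Fin (n - 2) → Fin 3,
    weightedSq ((2 * (n : ℝ) - 3) * s) (iterCovDeriv A α (covLaplacian A Φ))

theorem weightedSq_le_sobolevSq (s : ℝ) (A : Fin 3 → R3 → 𝔤) (Φ : R3 → 𝔤) {n : ℕ}
    {I : List (Fin 3)} (h1 : 1 ≤ I.length) (hn : I.length ≤ n) {e : ℝ}
    (he : e ≤ (2 * (I.length : ℝ) - 3) * s) :
    weightedSq e (covDerivs A I Φ) ≤ sobolevSq s A n Φ := by
  refine (weightedSq_mono he _).trans ?_
  obtain ⟨α, hα⟩ := covDerivs_eq_iterCovDeriv A rfl (I := I) Φ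
  rw [hα]
  refine le_trans ?_ (Finset.single_le_sum (f := fun p : ℕ => ∑ α : Fin p → Fin 3,
    weightedSq ((2 * (p : ℝ) - 3) * s) (iterCovDeriv A α Φ)) (fun _ _ => zero_le)
    (Finset.mem_Icc.2 ⟨h1, hn⟩))
  exact Finset.single_le_sum (f := fun α : Fin I.length → Fin 3 =>
    weightedSq ((2 * (I.length : ℝ) - 3) * s) (iterCovDeriv A α Φ)) (fun _ _ => zero_le)
    (Finset.mem_univ α)

theorem weightedSq_le_laplacianSq (s : ℝ) (A : Fin 3 → R3 → 𝔤) (Φ : R3 → 𝔤) {n : ℕ}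
    {I : List (Fin 3)} (hn : I.length = n - 2) :
    weightedSq ((2 * (n : ℝ) - 3) * s) (covDerivs A I (covLaplacian A Φ)) ≤
      laplacianSq s A n Φ := by
  obtain ⟨α, hα⟩ := covDerivs_eq_iterCovDeriv A hn (covLaplacian A Φ)
  rw [hα]
  exact Finset.single_le_sum (f := fun α : Fin (n - 2) → Fin 3 =>
    weightedSq ((2 * (n : ℝ) - 3) * s) (iterCovDeriv A α (covLaplacian A Φ))) (fun _ _ => zero_le)
    (Finset.mem_univ α)

/-- Hölder's inequality `‖H X‖₂ ≤ ‖H‖₃ ‖X‖₆` with weights. -/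
theorem weightedSq_mul_le {V₁ V₂ : Type*} [NormedAddCommGroup V₁] [NormedAddCommGroup V₂]
    (c d : ℝ) {H : R3 → V₁} {X : R3 → V₂} (hH : AEStronglyMeasurable H volume)
    (hX : AEStronglyMeasurable X volume) :
    weightedSq (2 * c + 2 * d) (fun x => ‖H x‖ * ‖X x‖) ≤
      (∫⁻ x, ENNReal.ofReal (w x ^ c * ‖H x‖) ^ (3 : ℝ)) ^ (2 / 3 : ℝ) *
        (∫⁻ x, ENNReal.ofReal (w x ^ d * ‖X x‖) ^ (6 : ℝ)) ^ (1 / 3 : ℝ) := by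
  have hpq : Real.HolderConjugate (3 / 2) 3 := by
    rw [Real.holderConjugate_iff]; norm_num
  have m1 : AEMeasurable (fun x => ENNReal.ofReal (w x ^ c * ‖H x‖) ^ (2 : ℝ)) volume :=
    ((contDiff_w_rpow c).continuous.aemeasurable.mul hH.norm.aemeasurable).ennreal_ofReal.pow_const _
  have m2 : AEMeasurable (fun x => ENNReal.ofReal (w x ^ d * ‖X x‖) ^ (2 : ℝ)) volume :=
    ((contDiff_w_rpow d).continuous.aemeasurable.mul hX.norm.aemeasurable).ennreal_ofReal.pow_const _
  have h := ENNReal.lintegral_mul_le_Lp_mul_Lq volume hpq m1 m2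
  refine le_trans (le_of_eq (lintegral_congr fun x => ?_)) (h.trans (le_of_eq ?_))
  · have h1 := (w_rpow_pos x c).le
    have h2 := (w_rpow_pos x d).le
    rw [Pi.mul_apply, ENNReal.rpow_two, ENNReal.rpow_two, ← mul_pow,
      ← ENNReal.ofReal_mul (by positivity), ← ENNReal.ofReal_pow (by positivity), w_rpow_add,
      w_rpow_two_mul, w_rpow_two_mul, Real.norm_of_nonneg (by positivity)]
    ring_nf
  · simp only [← ENNReal.rpow_mul]
    norm_num

theorem weightedSq_lie_le (e : ℝ) (H X : R3 → 𝔤) : weightedSq e (fun x => ⁅H x, X x⁆) ≤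
    ENNReal.ofReal (‖lieCLM 𝔤‖ ^ 2) * weightedSq e (fun x => ‖H x‖ * ‖X x‖) := by
  rw [← lintegral_const_mul_weightedSq (sq_nonneg _)]
  refine lintegral_mono fun x => ENNReal.ofReal_le_ofReal ?_
  have h1 := pow_le_pow_left₀ (norm_nonneg _) (norm_lie_le (H x) (X x)) 2
  rw [Real.norm_of_nonneg (by positivity)]
  calc _ ≤ _ := mul_le_mul_of_nonneg_left h1 (w_rpow_pos x e).le
    _ = _ := by ring

/-- A bound for `w^c|H|` lowers the weight exponent of the bracket by `2c`. -/
theorem weightedSq_lie_le_of_bound {e c a : ℝ} {H X : R3 → 𝔤} (h : ∀ᵐ x, w x ^ c * ‖H x‖ ≤ a) :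
    weightedSq e (fun x => ⁅H x, X x⁆) ≤
      ENNReal.ofReal ((‖lieCLM 𝔤‖ * a) ^ 2) * weightedSq (e - 2 * c) X := by
  rw [← lintegral_const_mul_weightedSq (sq_nonneg _)]
  refine lintegral_mono_ae ?_
  filter_upwards [h] with x hx
  refine ENNReal.ofReal_le_ofReal ?_
  have h0 : 0 ≤ ‖lieCLM 𝔤‖ := ContinuousLinearMap.opNorm_nonneg _
  have h1 := norm_lie_le (H x) (X x)
  have h2 := (w_rpow_pos x c).le
  have h3 : w x ^ c * ‖⁅H x, X x⁆‖ ≤ ‖lieCLM 𝔤‖ * a * ‖X x‖ := by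
    calc _ ≤ w x ^ c * (‖lieCLM 𝔤‖ * ‖H x‖ * ‖X x‖) := mul_le_mul_of_nonneg_left h1 h2
      _ = ‖lieCLM 𝔤‖ * (w x ^ c * ‖H x‖) * ‖X x‖ := by ring
      _ ≤ _ := by gcongr
  have h4 := pow_le_pow_left₀ (by positivity) h3 2
  rw [show e = (e - 2 * c) + 2 * c by ring, w_rpow_add, w_rpow_two_mul]
  rw [show e - 2 * c + 2 * c - 2 * c = e - 2 * c by ring]
  have := mul_le_mul_of_nonneg_left h4 (w_rpow_pos x (e - 2 * c)).le
  linarith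

/-- Hardy's inequality, in terms of `‖Φ‖_{n,2}`. -/
theorem RegPotential.weightedSq_le_sobolevSq_of_hardy (hA : RegPotential r N A) (σ : ℝ)
    (hσ₀ : 0 < σ) (hσ₁ : σ ≤ 1) {Φ : R3 → 𝔤} (hΦ : Reg r N Φ) {R : ℝ} (hR : VanishesOff R Φ)
    {n : ℕ} (hn : 1 ≤ n) : weightedSq (-(1 - σ) - 2) Φ ≤
      ENNReal.ofReal (12 / σ ^ 2) * 3 * sobolevSq (1 - σ) A n Φ := by
  have h3 := hA.three_le
  obtain ⟨i, rfl⟩ : ∃ i, N = i + 1 := ⟨N - 1, by omega⟩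
  refine (weightedSq_hardy σ hσ₀ hσ₁ A hΦ.hasWeakDeriv (hΦ.memLpLoc_top (by omega)) hR
    fun k => hA.aestronglyMeasurable_covDeriv le_rfl hΦ k).trans ?_
  rw [mul_assoc]
  gcongr
  refine (Finset.sum_le_sum fun k _ => weightedSq_le_sobolevSq (1 - σ) A Φ (I := [k]) (n := n)
    (by simp) (by simpa using hn) (e := -(1 - σ)) (le_of_eq (by simp; ring))).trans ?_
  simp

/-- Weighted `L⁶` control of the derivatives of order at most `n - 2` by `‖Φ‖_{n-1,2}`. -/
theorem exists_sixth_power_le (σ : ℝ) (hσ₀ : 0 < σ) (hσ₁ : σ ≤ 1) (j : ℕ) :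
    ∃ C : ℝ≥0, ∀ {r : ℝ≥0∞} {N : ℕ} {A : Fin 3 → R3 → 𝔤}, RegPotential r N A →
      ∀ {Φ : R3 → 𝔤}, Reg r N Φ → ∀ {R : ℝ}, VanishesOff R Φ → ∀ {n : ℕ}, j + 2 ≤ n → n ≤ N →
      ∀ {K : List (Fin 3)}, K.length = j →
      (∫⁻ x, ENNReal.ofReal (w x ^ (((j : ℝ) - 1 / 2) * (1 - σ)) *
        ‖covDerivs A K Φ x‖) ^ (6 : ℝ)) ^ (1 / 3 : ℝ) ≤ C * sobolevSq (1 - σ) A (n - 1) Φ := by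
  obtain ⟨C, hC⟩ := exists_weighted_sobolev (𝔤 := 𝔤) (((j : ℝ) - 1 / 2) * (1 - σ))
  refine ⟨C * (3 + max 1 (Real.toNNReal (12 / σ ^ 2) * 3)),
    fun {r N A} hA {Φ} hΦ {R} hR {n} hn hN {K} hK => ?_⟩
  have hX : Reg r (N - j) (covDerivs A K Φ) := hA.reg_covDerivs le_rfl K (by omega) hΦ
  obtain ⟨i, hi⟩ : ∃ i, N - j = i + 1 := ⟨N - j - 1, by omega⟩
  have hX' : Reg r (i + 1) (covDerivs A K Φ) := by rwa [hi] at hX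
  have hm := fun k => hA.aestronglyMeasurable_covDeriv (t := i) (by omega) hX' k
  refine (hC A R _ _ hX'.hasWeakDeriv (hX.memLpLoc_top (by omega))
    (hA.vanishesOff_covDerivs le_rfl K (by omega) hΦ hR) hm).trans ?_
  push_cast
  rw [mul_assoc]
  gcongr (C : ℝ≥0∞) * ?_
  rw [add_mul]
  have h1 : ∀ k, weightedSq (2 * (((j : ℝ) - 1 / 2) * (1 - σ))) (covDeriv A k (covDerivs A K Φ)) ≤
      sobolevSq (1 - σ) A (n - 1) Φ := fun k =>
    weightedSq_le_sobolevSq (1 - σ) A Φ (I := k :: K) (by simp) (by simp; omega)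
      (le_of_eq (by simp [hK]; ring))
  refine add_le_add ?_ ?_
  · refine (Finset.sum_le_sum fun k _ => h1 k).trans ?_
    simp
  · rcases Nat.eq_zero_or_pos j with rfl | hj
    · -- There is no term of order zero in `‖Φ‖_{n-1,2}`, so that Hardy's inequality is needed.
      rw [List.length_eq_zero_iff] at hK
      subst hK
      have h2 := hA.weightedSq_le_sobolevSq_of_hardy σ hσ₀ hσ₁ hΦ hR (n := n - 1) (by omega)
      rw [show 2 * ((((0 : ℕ) : ℝ) - 1 / 2) * (1 - σ)) - 2 = -(1 - σ) - 2 by push_cast; ring]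
      refine h2.trans ?_
      gcongr
      exact le_max_right _ _
    · refine (weightedSq_le_sobolevSq (1 - σ) A Φ (n := n - 1) (by omega) (by omega) ?_).trans ?_
      · rw [hK]; nlinarith
      · refine le_mul_of_one_le_left zero_le ?_
        simp

/-- Bounds for the curvature and its divergence up to order `q`: the weighted sup norms are at
most `a` and the cubes of the weighted `L³` norms at most `b`. -/
structure CurvatureBounds (s : ℝ) (A : Fin 3 → R3 → 𝔤) (q : ℕ) (a b : ℝ≥0) : Prop where
  curvature_le : ∀ J : List (Fin 3), J.length ≤ q → ∀ i, ∀ᵐ x,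
    w x ^ (((J.length : ℝ) + 2) * s) * ‖covDerivs A J (curvature A i) x‖ ≤ a
  divCurvature_le : ∀ J : List (Fin 3), J.length ≤ q → ∀ l, ∫⁻ x, ENNReal.ofReal
    (w x ^ (((J.length : ℝ) + 2) * s) * ‖covDerivs A J (divCurvature A l) x‖) ^ (3 : ℝ) ≤ b

/-- Products of a derivative of `∇·G` and a derivative of `Φ`, by Hölder's inequality. -/
theorem exists_weightedSq_divCurvature_mul_le (σ : ℝ) (hσ₀ : 0 < σ) (hσ₁ : σ ≤ 1) (b : ℝ≥0) (n : ℕ) :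
    ∃ C : ℝ≥0, ∀ {r : ℝ≥0∞} {N : ℕ} {A : Fin 3 → R3 → 𝔤}, RegPotential r N A →
      ∀ {a : ℝ≥0} {q : ℕ}, CurvatureBounds (1 - σ) A q a b → ∀ {Φ : R3 → 𝔤}, Reg r N Φ →
      ∀ {R : ℝ}, VanishesOff R Φ → n ≤ N → ∀ {J K : List (Fin 3)}, J.length ≤ q →
      J.length + 3 ≤ N → K.length + 2 ≤ n → ∀ l {e : ℝ},
      e = (2 * ((J.length : ℝ) + K.length) + 3) * (1 - σ) →
      weightedSq e (fun x => ‖covDerivs A J (divCurvature A l) x‖ * ‖covDerivs A K Φ x‖) ≤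
        C * sobolevSq (1 - σ) A (n - 1) Φ := by
  choose C hC using exists_sixth_power_le (𝔤 := 𝔤) σ hσ₀ hσ₁
  refine ⟨b ^ (2 / 3 : ℝ) * ∑ j ∈ Finset.range n, C j,
    fun {r N A} hA {a q} hG {Φ} hΦ {R} hR hN {J K} hJ hJN hK l {e} he => ?_⟩
  have rJ : Reg r 0 (covDerivs A J (divCurvature A l)) :=
    hA.reg_covDerivs (i := N - 3) (by omega) J (by omega) (hA.reg_divCurvature l)
  have rK : Reg r 0 (covDerivs A K Φ) := hA.reg_covDerivs le_rfl K (by omega) hΦ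
  have h1 := weightedSq_mul_le (((J.length : ℝ) + 2) * (1 - σ))
    (((K.length : ℝ) - 1 / 2) * (1 - σ)) (rJ.locallyIntegrable hA.one_le).aestronglyMeasurable
    (rK.locallyIntegrable hA.one_le).aestronglyMeasurable
  rw [show 2 * (((J.length : ℝ) + 2) * (1 - σ)) + 2 * (((K.length : ℝ) - 1 / 2) * (1 - σ)) = e by
    rw [he]; ring] at h1
  refine h1.trans ?_
  rw [ENNReal.coe_mul, mul_assoc, ENNReal.coe_rpow_of_nonneg _ (by norm_num)]
  refine mul_le_mul' (ENNReal.rpow_le_rpow (hG.divCurvature_le J hJ l) (by norm_num)) ?_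
  refine (hC K.length hA hΦ hR (n := n) hK hN rfl).trans ?_
  gcongr
  exact Finset.single_le_sum (f := C) (fun _ _ => zero_le) (Finset.mem_range.2 (by omega))

/-- Each commutator term of order `n - 2` is controlled by `‖Φ‖_{n-1,2}`. -/
theorem exists_weightedSq_eval_le (σ : ℝ) (hσ₀ : 0 < σ) (hσ₁ : σ ≤ 1) (a b : ℝ≥0) {n : ℕ}
    (hn : 3 ≤ n) : ∃ C : ℝ≥0, ∀ {r : ℝ≥0∞} {A : Fin 3 → R3 → 𝔤}, RegPotential r n A →
      CurvatureBounds (1 - σ) A (n - 3) a b → ∀ {Φ : R3 → 𝔤}, Reg r n Φ →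
      ∀ {R : ℝ}, VanishesOff R Φ → ∀ {t : CommTerm}, t.Valid (n - 2) →
      weightedSq ((2 * (n : ℝ) - 3) * (1 - σ)) (t.eval A Φ) ≤
        C * sobolevSq (1 - σ) A (n - 1) Φ := by
  obtain ⟨C, hC⟩ := exists_weightedSq_divCurvature_mul_le (𝔤 := 𝔤) σ hσ₀ hσ₁ b n
  refine ⟨max (Real.toNNReal (‖lieCLM 𝔤‖ ^ 2) * C) (Real.toNNReal ((‖lieCLM 𝔤‖ * a) ^ 2)),
    fun {r A} hA hG {Φ} hΦ {R} hR {t} ht => ?_⟩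
  cases t with
  | div J l K =>
    simp only [CommTerm.Valid] at ht
    have hlen : (J.length : ℝ) + K.length = n - 3 := by
      have : J.length + K.length + 3 = n := by omega
      rw [← this]; push_cast; ring
    refine (weightedSq_lie_le _ _ _).trans ?_
    have := hC hA hG hΦ hR le_rfl (J := J) (K := K) (by omega) (by omega) (by omega) l
      (e := (2 * (n : ℝ) - 3) * (1 - σ)) (by rw [hlen]; ring)
    refine (mul_le_mul_right this _).trans ?_
    rw [← mul_assoc]
    gcongr
    rw [ENNReal.ofReal, ← ENNReal.coe_mul]
    exact ENNReal.coe_le_coe.2 (le_max_left _ _)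
  | curv J i K =>
    simp only [CommTerm.Valid] at ht
    have hlen : (n : ℝ) = J.length + K.length + 2 := by
      have : J.length + K.length + 2 = n := by omega
      rw [← this]; push_cast; ring
    refine (weightedSq_lie_le_of_bound (hG.curvature_le J (by omega) i)).trans ?_
    refine mul_le_mul' (ENNReal.coe_le_coe.2 (le_max_right _ _))
      (weightedSq_le_sobolevSq _ _ _ (by omega) (by omega) (le_of_eq ?_))
    rw [hlen]
    ring

theorem weightedSq_sub_le {e : ℝ} {f g : R3 → 𝔤} (hf : AEStronglyMeasurable f volume) :
    weightedSq e (fun x => f x - g x) ≤ 2 * (weightedSq e f + weightedSq e g) := by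
  rw [weightedSq, weightedSq, weightedSq, ← lintegral_add_left' (aemeasurable_weightedSq e hf),
    ← lintegral_const_mul' _ _ (by norm_num)]
  refine lintegral_mono fun x => ?_
  have hw := (w_rpow_pos x e).le
  rw [← ENNReal.ofReal_add (by positivity) (by positivity), show (2 : ℝ≥0∞) = ENNReal.ofReal 2 by
    norm_num, ← ENNReal.ofReal_mul (by norm_num)]
  refine ENNReal.ofReal_le_ofReal ?_
  have h1 : ‖f x - g x‖ ^ 2 ≤ 2 * (‖f x‖ ^ 2 + ‖g x‖ ^ 2) := by
    have := pow_le_pow_left₀ (norm_nonneg _) (norm_sub_le (f x) (g x)) 2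
    nlinarith [sq_nonneg (‖f x‖ - ‖g x‖)]
  have := mul_le_mul_of_nonneg_left h1 hw
  linarith

theorem weightedSq_neg (e : ℝ) (f : R3 → 𝔤) : weightedSq e (fun x => - f x) = weightedSq e f := by
  simp [weightedSq]

theorem weightedSq_list_sum_le {ι : Type*} {e : ℝ} {B : ℝ≥0∞} (L : List ι) {f : ι → R3 → 𝔤}
    (hf : ∀ t ∈ L, AEStronglyMeasurable (f t) volume) (hB : ∀ t ∈ L, weightedSq e (f t) ≤ B) :
    weightedSq e (fun x => (L.map fun t => f t x).sum) ≤ 4 ^ L.length * B := by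
  induction L with
  | nil => simp [weightedSq]
  | cons t L ih =>
    have ih := ih (fun s hs => hf s (by simp [hs])) (fun s hs => hB s (by simp [hs]))
    have h1 := weightedSq_sub_le (e := e) (g := fun x => -(L.map fun t => f t x).sum)
      (hf t (by simp))
    simp only [sub_neg_eq_add] at h1
    rw [weightedSq_neg] at h1
    simp only [List.map_cons, List.sum_cons, List.length_cons]
    refine h1.trans ?_
    calc _ ≤ 2 * (4 ^ L.length * B + 4 ^ L.length * B) := by
          gcongr
          exact (hB t (by simp)).trans (le_mul_of_one_le_left zero_le (one_le_pow₀ (by norm_num)))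
      _ = _ := by ring

end CommutatorBounds

end CovariantPoisson

/-! ### The top order derivatives and the norms -/

namespace CovariantPoisson

open Filter Topology Metric

section TopOrder

variable {𝔤 : Type*} [NormedLieRing 𝔤] [CompactLieAlgebra 𝔤]
variable {r : ℝ≥0∞} {N : ℕ} {A : Fin 3 → R3 → 𝔤}

theorem CurvatureBounds.curvature_zero {s : ℝ} {q : ℕ} {a b : ℝ≥0}
    (h : CurvatureBounds s A q a b) (i : Fin 3 × Fin 3) :
    ∀ᵐ x, w x ^ (2 * s) * ‖curvature A i x‖ ≤ a := by
  simpa [covDerivs] using h.curvature_le [] (Nat.zero_le _) i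

/-- The top order estimate for `n ≥ 3`, for one multi-index of order `n - 2`. -/
theorem exists_sum_weightedSq_le_of_three_le (σ : ℝ) (hσ₀ : 0 < σ) (hσ₁ : σ ≤ 1) (a b : ℝ≥0)
    {n : ℕ} (hn : 3 ≤ n) {J : List (Fin 3)} (hJ : J.length = n - 2) :
    ∃ C : ℝ≥0, ∀ {A : Fin 3 → R3 → 𝔤}, RegPotential 2 n A →
      CurvatureBounds (1 - σ) A (n - 3) a b → ∀ {Φ : R3 → 𝔤}, Reg 2 n Φ →
      ∀ {R : ℝ}, VanishesOff R Φ →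
      ∑ k, ∑ l, weightedSq ((2 * (n : ℝ) - 3) * (1 - σ))
        (covDeriv A k (covDeriv A l (covDerivs A J Φ))) ≤
      C * (sobolevSq (1 - σ) A (n - 1) Φ + laplacianSq (1 - σ) A n Φ) := by
  obtain ⟨C, hC⟩ := exists_weightedSq_eval_le (𝔤 := 𝔤) σ hσ₀ hσ₁ a b hn
  set e := (2 * (n : ℝ) - 3) * (1 - σ) with he
  refine ⟨2 * (2 * (1 + 4 ^ (commTerms J).length * C) +
    (Real.toNNReal (24 * e ^ 2 + 3 * ‖lieCLM 𝔤‖ * a) * 3 +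
      Real.toNNReal (9 * (‖lieCLM 𝔤‖ * a) ^ 2))), fun {A} hA hG {Φ} hΦ {R} hR => ?_⟩
  have hY : Reg 2 (0 + 2) (covDerivs A J Φ) := hA.reg_covDerivs le_rfl J (by omega) hΦ
  have hcast : ((n - 2 : ℕ) : ℝ) = n - 2 := by rw [Nat.cast_sub (by omega)]; norm_num
  refine (hA.sum_weightedSq_le_of_curvature_sq (s := 1 - σ) (a := a) e (by linarith) (by linarith)
    a.2 hG.curvature_zero (by omega) le_rfl hY
    (hA.vanishesOff_covDerivs le_rfl J (by omega) hΦ hR)).trans ?_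
  set S := sobolevSq (1 - σ) A (n - 1) Φ
  set L := laplacianSq (1 - σ) A n Φ
  have h1 : ∀ l, weightedSq (e - 2 * (1 - σ)) (covDeriv A l (covDerivs A J Φ)) ≤ S := fun l =>
    weightedSq_le_sobolevSq (1 - σ) A Φ (I := l :: J) (by simp) (by simp; omega)
      (le_of_eq (by simp only [List.length_cons, hJ, he]; push_cast [hcast]; ring))
  have h2 : weightedSq (e - 4 * (1 - σ)) (covDerivs A J Φ) ≤ S :=
    weightedSq_le_sobolevSq (1 - σ) A Φ (by omega) (by omega)
      (le_of_eq (by rw [hJ, hcast, he]; ring))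
  have hval : ∀ t ∈ commTerms J, t.Valid (n - 2) := fun t ht => hJ ▸ valid_of_mem_commTerms ht
  have h3 : weightedSq e (covLaplacian A (covDerivs A J Φ)) ≤
      2 * (L + 4 ^ (commTerms J).length * (C * S)) := by
    have h4 : weightedSq e (covLaplacian A (covDerivs A J Φ)) =
        weightedSq e (fun x => covDerivs A J (covLaplacian A Φ) x -
          ((commTerms J).map fun t => t.eval A Φ x).sum) := by
      refine lintegral_congr_ae ?_
      filter_upwards [hA.covLaplacian_covDerivs hΦ J (by omega)] with x hx
      rw [hx]
    have hm : Reg 2 0 (covDerivs A J (covLaplacian A Φ)) :=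
      hA.reg_covDerivs (i := n - 2) (by omega) J (by omega)
        (hA.reg_covLaplacian (i := n) le_rfl (by omega) hΦ)
    rw [h4]
    refine (weightedSq_sub_le (hm.locallyIntegrable hA.one_le).aestronglyMeasurable).trans ?_
    gcongr
    · exact weightedSq_le_laplacianSq _ _ _ hJ
    · exact weightedSq_list_sum_le _ (fun t ht => ((hA.reg_eval (j := 0) hΦ (by omega)
        (hval t ht)).locallyIntegrable hA.one_le).aestronglyMeasurable)
        fun t ht => hC hA hG hΦ hR (hval t ht)
  rw [ENNReal.coe_mul]
  refine (mul_le_mul' le_rfl ?_).trans (mul_assoc _ _ _).ge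
  calc _ ≤ 2 * (L + 4 ^ (commTerms J).length * (C * S)) +
        (ENNReal.ofReal (24 * e ^ 2 + 3 * ‖lieCLM 𝔤‖ * a) * ∑ _l : Fin 3, S +
          ENNReal.ofReal (9 * (‖lieCLM 𝔤‖ * a) ^ 2) * S) := by
        gcongr with l
        exact h1 l
    _ ≤ 2 * ((S + L) + 4 ^ (commTerms J).length * (C * (S + L))) +
        (ENNReal.ofReal (24 * e ^ 2 + 3 * ‖lieCLM 𝔤‖ * a) * ∑ _l : Fin 3, (S + L) +
          ENNReal.ofReal (9 * (‖lieCLM 𝔤‖ * a) ^ 2) * (S + L)) := by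
        gcongr
        · exact le_add_self
        all_goals exact le_self_add
    _ = _ := by
        simp only [Finset.sum_const, Finset.card_univ, Fintype.card_fin, nsmul_eq_mul,
          ENNReal.ofReal]
        push_cast
        ring

/-- The top order estimate for `n = 2`, where the potential has the lower regularity with `r = 1`. -/
theorem exists_sum_weightedSq_le_of_two (σ : ℝ) (hσ₀ : 0 < σ) (hσ₁ : σ ≤ 1) (a b : ℝ≥0) :
    ∃ C : ℝ≥0, ∀ {A : Fin 3 → R3 → 𝔤}, RegPotential 1 3 A →
      CurvatureBounds (1 - σ) A 0 a b → ∀ {Φ : R3 → 𝔤}, Reg 1 3 Φ →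
      ∀ {R : ℝ}, VanishesOff R Φ →
      ∑ k, ∑ l, weightedSq (1 - σ) (covDeriv A k (covDeriv A l Φ)) ≤
      C * (sobolevSq (1 - σ) A 1 Φ + laplacianSq (1 - σ) A 2 Φ) := by
  obtain ⟨C, hC⟩ := exists_weightedSq_divCurvature_mul_le (𝔤 := 𝔤) σ hσ₀ hσ₁ b 2
  refine ⟨2 * (1 + (Real.toNNReal (25 + 9 * ‖lieCLM 𝔤‖ * a) * 3 +
    (Real.toNNReal (9 * ‖lieCLM 𝔤‖ * a) * (Real.toNNReal (12 / σ ^ 2) * 3) +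
      Real.toNNReal (‖lieCLM 𝔤‖ ^ 2) * (3 * C)))), fun {A} hA hG {Φ} hΦ {R} hR => ?_⟩
  refine (hA.sum_weightedSq_le_of_divCurvature (s := 1 - σ) (a := a) (by linarith) (by linarith)
    a.2 hG.curvature_zero le_rfl hΦ hR).trans ?_
  set S := sobolevSq (1 - σ) A 1 Φ
  set L := laplacianSq (1 - σ) A 2 Φ
  have h1 : ∀ l, weightedSq (-(1 - σ)) (covDeriv A l Φ) ≤ S := fun l =>
    weightedSq_le_sobolevSq (1 - σ) A Φ (I := [l]) (by simp) (by simp)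
      (le_of_eq (by simp; ring))
  have h2 : weightedSq (-(1 - σ) - 2) Φ ≤ ENNReal.ofReal (12 / σ ^ 2) * 3 * S :=
    hA.weightedSq_le_sobolevSq_of_hardy σ hσ₀ hσ₁ hΦ hR le_rfl
  have h3 : ∀ l, weightedSq (3 * (1 - σ)) (fun x => ‖divCurvature A l x‖ * ‖Φ x‖) ≤ C * S :=
    fun l => hC hA hG hΦ hR (by omega) (J := []) (K := []) le_rfl (by simp) (by simp) l (by simp)
  have h4 : weightedSq (1 - σ) (covLaplacian A Φ) ≤ L := by
    have := weightedSq_le_laplacianSq (1 - σ) A Φ (n := 2) (I := []) rfl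
    rwa [show (2 * ((2 : ℕ) : ℝ) - 3) * (1 - σ) = 1 - σ by push_cast; ring] at this
  rw [ENNReal.coe_mul]
  refine (mul_le_mul' le_rfl ?_).trans (mul_assoc _ _ _).ge
  calc _ ≤ L + (ENNReal.ofReal (25 + 9 * ‖lieCLM 𝔤‖ * a) * ∑ _l : Fin 3, S +
        (ENNReal.ofReal (9 * ‖lieCLM 𝔤‖ * a) * (ENNReal.ofReal (12 / σ ^ 2) * 3 * S) +
          ENNReal.ofReal (‖lieCLM 𝔤‖ ^ 2) * ∑ _l : Fin 3, C * S)) := by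
        gcongr with l _ l
        · exact h1 l
        · exact h3 l
    _ ≤ (S + L) + (ENNReal.ofReal (25 + 9 * ‖lieCLM 𝔤‖ * a) * ∑ _l : Fin 3, (S + L) +
        (ENNReal.ofReal (9 * ‖lieCLM 𝔤‖ * a) * (ENNReal.ofReal (12 / σ ^ 2) * 3 * (S + L)) +
          ENNReal.ofReal (‖lieCLM 𝔤‖ ^ 2) * ∑ _l : Fin 3, C * (S + L))) := by
        gcongr
        · exact le_add_self
        all_goals exact le_self_add
    _ = _ := by
        simp only [Finset.sum_const, Finset.card_univ, Fintype.card_fin, nsmul_eq_mul,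
          ENNReal.ofReal]
        push_cast
        ring

theorem sum_iterCovDeriv_le (A : Fin 3 → R3 → 𝔤) (Φ : R3 → 𝔤) (e : ℝ) (m : ℕ) {B : ℝ≥0∞}
    (h : ∀ β : Fin m → Fin 3,
      ∑ k, ∑ l, weightedSq e (covDeriv A k (covDeriv A l (iterCovDeriv A β Φ))) ≤ B) :
    ∑ α : Fin (m + 2) → Fin 3, weightedSq e (iterCovDeriv A α Φ) ≤ 3 ^ (m + 2) * B := by
  have h1 : ∀ α : Fin (m + 2) → Fin 3, weightedSq e (iterCovDeriv A α Φ) ≤ B := fun α => by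
    refine le_trans ?_ (h fun i => α i.succ.succ)
    have h2 : iterCovDeriv A α Φ = covDeriv A (α 0) (covDeriv A (α 1)
        (iterCovDeriv A (fun i => α i.succ.succ) Φ)) := by
      simp only [iterCovDeriv, List.ofFn_succ, List.foldr_cons]
      rfl
    rw [h2]
    refine le_trans ?_ (Finset.single_le_sum (f := fun k => ∑ l, weightedSq e (covDeriv A k
      (covDeriv A l (iterCovDeriv A (fun i => α i.succ.succ) Φ)))) (fun _ _ => zero_le)
      (Finset.mem_univ (α 0)))
    exact Finset.single_le_sum (f := fun l => weightedSq e (covDeriv A (α 0)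
      (covDeriv A l (iterCovDeriv A (fun i => α i.succ.succ) Φ)))) (fun _ _ => zero_le)
      (Finset.mem_univ (α 1))
  refine (Finset.sum_le_sum fun α _ => h1 α).trans ?_
  simp

/-- The exponent `r` of the regularity scale on which the local assumptions of order `n` live. -/
noncomputable def potentialExp (n : ℕ) : ℝ≥0∞ := if n = 2 then 1 else 2

theorem LocalAssumptions.regPotential {n : ℕ} (hn : 2 ≤ n) (hA : LocalAssumptions n A) :
    RegPotential (potentialExp n) (max n 3) A := by
  unfold LocalAssumptions at hA
  unfold potentialExp
  split_ifs at hA ⊢ with h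
  · subst h
    refine ⟨le_rfl, by norm_num, le_rfl, fun k => ?_⟩
    exact reg_of_contDiff_of_weakDerivs (M := 0) (contDiff_zero.2 (hA.1 k))
      (fun α hα => (hA.2.1 k α hα).imp fun g hg => ⟨hg.1, hg.2.mono_exponent (by norm_num)⟩)
      (hA.2.2.1 k)
  · obtain ⟨m, rfl⟩ : ∃ m, n = m + 3 := ⟨n - 3, by omega⟩
    obtain ⟨h1, ⟨q, hq, h2⟩, h3, -⟩ := hA
    rw [max_eq_left (by omega)]
    refine ⟨by norm_num, le_rfl, by omega, fun k => ?_⟩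
    -- Of the integrability exponent `q > 3` only `q ≥ 2` matters.
    have hq2 : (2 : ℝ≥0∞) ≤ q := le_trans (by norm_num) hq.le
    exact reg_of_contDiff_of_weakDerivs (M := m) (h1 k)
      (fun α hα => (h2 k α hα).imp fun g hg => ⟨hg.1, hg.2.mono_exponent hq2⟩) (h3 k)

/-- The inequality between the squares of the norms. -/
theorem exists_sobolevSq_le (σ : ℝ) (hσ₀ : 0 < σ) (hσ₁ : σ ≤ 1) {n : ℕ} (hn : 2 ≤ n) (a b : ℝ≥0) :
    ∃ C : ℝ≥0, ∀ {A : Fin 3 → R3 → 𝔤}, RegPotential (potentialExp n) (max n 3) A →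
      CurvatureBounds (1 - σ) A (curvatureOrder n) a b →
      ∀ {Φ : R3 → 𝔤}, Reg (potentialExp n) (max n 3) Φ → ∀ {R : ℝ}, VanishesOff R Φ →
      sobolevSq (1 - σ) A n Φ ≤
        C * (sobolevSq (1 - σ) A (n - 1) Φ + laplacianSq (1 - σ) A n Φ) := by
  obtain ⟨m, rfl⟩ : ∃ m, n = m + 2 := ⟨n - 2, by omega⟩
  suffices h : ∃ C : ℝ≥0, ∀ {A : Fin 3 → R3 → 𝔤},
      RegPotential (potentialExp (m + 2)) (max (m + 2) 3) A →
      CurvatureBounds (1 - σ) A (curvatureOrder (m + 2)) a b →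
      ∀ {Φ : R3 → 𝔤}, Reg (potentialExp (m + 2)) (max (m + 2) 3) Φ → ∀ {R : ℝ}, VanishesOff R Φ →
      ∀ β : Fin m → Fin 3, ∑ k, ∑ l, weightedSq ((2 * ((m + 2 : ℕ) : ℝ) - 3) * (1 - σ))
        (covDeriv A k (covDeriv A l (iterCovDeriv A β Φ))) ≤
        C * (sobolevSq (1 - σ) A (m + 1) Φ + laplacianSq (1 - σ) A (m + 2) Φ) by
    obtain ⟨C, hC⟩ := h
    refine ⟨1 + 3 ^ (m + 2) * C, fun {A} hA hG {Φ} hΦ {R} hR => ?_⟩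
    have h1 := sum_iterCovDeriv_le A Φ _ m (hC hA hG hΦ hR)
    have h2 : sobolevSq (1 - σ) A (m + 2) Φ = sobolevSq (1 - σ) A (m + 1) Φ +
        ∑ α : Fin (m + 2) → Fin 3,
          weightedSq ((2 * ((m + 2 : ℕ) : ℝ) - 3) * (1 - σ)) (iterCovDeriv A α Φ) :=
      Finset.sum_Icc_succ_top (by omega) _
    rw [h2]
    rw [ENNReal.coe_add, ENNReal.coe_mul, ENNReal.coe_one, add_mul, one_mul, mul_assoc]
    exact add_le_add le_self_add h1
  rcases Nat.eq_zero_or_pos m with rfl | hm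
  · obtain ⟨C, hC⟩ := exists_sum_weightedSq_le_of_two (𝔤 := 𝔤) σ hσ₀ hσ₁ a b
    refine ⟨C, fun {A} hA hG {Φ} hΦ {R} hR β => ?_⟩
    simp only [potentialExp, curvatureOrder, zero_add, if_true] at hA hG hΦ
    have := hC hA hG hΦ hR
    rw [show (2 * ((0 + 2 : ℕ) : ℝ) - 3) * (1 - σ) = 1 - σ by push_cast; ring]
    simpa [iterCovDeriv] using this
  · have h2 : m + 2 ≠ 2 := by omega
    simp only [potentialExp, curvatureOrder, h2, if_false, max_eq_left (show 3 ≤ m + 2 by omega)]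
    have h := fun β : Fin m → Fin 3 => exists_sum_weightedSq_le_of_three_le (𝔤 := 𝔤) σ hσ₀ hσ₁ a b
      (n := m + 2) (by omega) (J := List.ofFn β) (by simp)
    choose C hC using h
    refine ⟨∑ β, C β, fun {A} hA hG {Φ} hΦ {R} hR β => ?_⟩
    refine (hC β hA hG hΦ hR).trans ?_
    exact mul_le_mul' (ENNReal.coe_le_coe.2
      (Finset.single_le_sum (f := C) (fun _ _ => zero_le) (Finset.mem_univ β))) le_rfl

end TopOrder

end CovariantPoisson

/-! ### Conclusion -/

namespace CovariantPoisson

open Filter Topology Metric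

section Norms

variable {𝔤 : Type*} [NormedLieRing 𝔤] [CompactLieAlgebra 𝔤]
variable {r : ℝ≥0∞} {N : ℕ} {A : Fin 3 → R3 → 𝔤}

theorem covNorm_nonneg (A : Fin 3 → R3 → 𝔤) (p : ℕ) {ι : Type} [Fintype ι] (X : ι → R3 → 𝔤) (x : R3) :
    0 ≤ covNorm A p X x := Real.sqrt_nonneg _

theorem covNorm_unit_sq (A : Fin 3 → R3 → 𝔤) (p : ℕ) (X : R3 → 𝔤) (x : R3) :
    covNorm A p (fun _ : Unit => X) x ^ 2 = ∑ α : Fin p → Fin 3, ‖iterCovDeriv A α X x‖ ^ 2 := by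
  rw [covNorm, Real.sq_sqrt (by positivity)]
  simp

theorem norm_covDerivs_le_covNorm (A : Fin 3 → R3 → 𝔤) {ι : Type} [Fintype ι] (X : ι → R3 → 𝔤)
    (J : List (Fin 3)) (i : ι) (x : R3) : ‖covDerivs A J (X i) x‖ ≤ covNorm A J.length X x := by
  obtain ⟨α, hα⟩ := covDerivs_eq_iterCovDeriv A rfl (I := J) (X i)
  rw [hα]
  refine Real.le_sqrt_of_sq_le ?_
  refine le_trans ?_ (Finset.single_le_sum (f := fun α : Fin J.length → Fin 3 =>
    ∑ i, ‖iterCovDeriv A α (X i) x‖ ^ 2) (fun _ _ => by positivity) (Finset.mem_univ α))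
  exact Finset.single_le_sum (f := fun i => ‖iterCovDeriv A α (X i) x‖ ^ 2)
    (fun _ _ => sq_nonneg _) (Finset.mem_univ i)

theorem lintegral_w_rpow_mul_covNorm_sq (e : ℝ) (p : ℕ) {X : R3 → 𝔤}
    (h : ∀ α : Fin p → Fin 3, AEStronglyMeasurable (iterCovDeriv A α X) volume) :
    ∫⁻ x, ENNReal.ofReal (w x ^ e * covNorm A p (fun _ : Unit => X) x ^ 2) =
      ∑ α : Fin p → Fin 3, weightedSq e (iterCovDeriv A α X) := by
  simp only [covNorm_unit_sq]
  simpa using lintegral_const_mul_sum_weightedSq zero_le_one e h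

theorem RegPotential.aestronglyMeasurable_iterCovDeriv (hA : RegPotential r N A) {i p : ℕ}
    (hi : i ≤ N) (hp : p ≤ i) {X : R3 → 𝔤} (hX : Reg r i X) (α : Fin p → Fin 3) :
    AEStronglyMeasurable (iterCovDeriv A α X) volume :=
  ((hA.reg_covDerivs (j := 0) hi (List.ofFn α) (by simpa using hp) hX).locallyIntegrable
    hA.one_le).aestronglyMeasurable

theorem RegPotential.sobolevNorm_eq (hA : RegPotential r N A) (σ : ℝ) {n : ℕ} (hn : n ≤ N)
    {Φ : R3 → 𝔤} (hΦ : Reg r N Φ) :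
    sobolevNorm σ A n Φ = sobolevSq (1 - σ) A n Φ ^ (1 / 2 : ℝ) := by
  rw [sobolevNorm, sobolevSq]
  congr 1
  refine Finset.sum_congr rfl fun p hp => lintegral_w_rpow_mul_covNorm_sq _ p fun α =>
    hA.aestronglyMeasurable_iterCovDeriv le_rfl ?_ hΦ α
  exact (Finset.mem_Icc.1 hp).2.trans hn

theorem RegPotential.laplacianNorm_eq (hA : RegPotential r N A) (σ : ℝ) {n : ℕ} (hn : n ≤ N)
    {Φ : R3 → 𝔤} (hΦ : Reg r N Φ) :
    laplacianNorm σ A n Φ = laplacianSq (1 - σ) A n Φ ^ (1 / 2 : ℝ) := by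
  have h3 := hA.three_le
  rw [laplacianNorm, laplacianSq, eLpNorm_eq_lintegral_rpow_enorm_toReal (by norm_num) (by norm_num),
    ← lintegral_w_rpow_mul_covNorm_sq _ _ fun α => hA.aestronglyMeasurable_iterCovDeriv
      (i := N - 2) (by omega) (by omega) (hA.reg_covLaplacian (i := N) le_rfl (by omega) hΦ) α]
  simp only [ENNReal.toReal_ofNat]
  congr 1
  refine lintegral_congr fun x => ?_
  rw [← ofReal_norm, Real.norm_of_nonneg (mul_nonneg (w_rpow_pos x _).le (covNorm_nonneg ..)),
    ENNReal.rpow_two, ← ENNReal.ofReal_pow (mul_nonneg (w_rpow_pos x _).le (covNorm_nonneg ..)),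
    mul_pow, ← w_rpow_two_mul]
  ring_nf

theorem curvatureBounds_of_norms (σ : ℝ) (A : Fin 3 → R3 → 𝔤) {q : ℕ} {a b : Fin (q + 1) → ℝ≥0}
    (ha : ∀ p : Fin (q + 1), curvatureNorm σ A p = a p)
    (hb : ∀ p : Fin (q + 1), divCurvatureNorm σ A p = b p) :
    CurvatureBounds (1 - σ) A q (∑ p, a p) (∑ p, b p ^ 3) := by
  have hle : ∀ {ι : Type} [Fintype ι] (X : ι → R3 → 𝔤) (J : List (Fin 3)) (i : ι) (x : R3),
      ENNReal.ofReal (w x ^ (((J.length : ℝ) + 2) * (1 - σ)) * ‖covDerivs A J (X i) x‖) ≤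
        ‖w x ^ (((J.length : ℝ) + 2) * (1 - σ)) * covNorm A J.length X x‖ₑ := fun X J i x => by
    rw [← ofReal_norm, Real.norm_of_nonneg (mul_nonneg (w_rpow_pos x _).le (covNorm_nonneg ..))]
    exact ENNReal.ofReal_le_ofReal (mul_le_mul_of_nonneg_left
      (norm_covDerivs_le_covNorm A X J i x) (w_rpow_pos x _).le)
  refine ⟨fun J hJ i => ?_, fun J hJ l => ?_⟩
  · have h1 := ha ⟨J.length, by omega⟩
    rw [curvatureNorm, eLpNorm_exponent_top] at h1
    filter_upwards [ae_le_eLpNormEssSup (f := fun x => w x ^ (((J.length : ℝ) + 2) * (1 - σ)) *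
      covNorm A J.length (curvature A) x) (μ := volume)] with x hx
    have h2 := (hle (curvature A) J i x).trans (hx.trans h1.le)
    have h3 : a ⟨J.length, by omega⟩ ≤ ∑ p, a p :=
      Finset.single_le_sum (fun _ _ => zero_le) (Finset.mem_univ _)
    rw [← ENNReal.ofReal_coe_nnreal, ENNReal.ofReal_le_ofReal_iff (NNReal.coe_nonneg _)] at h2
    exact h2.trans (NNReal.coe_le_coe.2 h3)
  · have h1 := hb ⟨J.length, by omega⟩
    rw [divCurvatureNorm, eLpNorm_eq_lintegral_rpow_enorm_toReal (by norm_num) (by norm_num)] at h1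
    simp only [ENNReal.toReal_ofNat] at h1
    have h2 := congrArg (fun y : ℝ≥0∞ => y ^ (3 : ℝ)) h1
    simp only [← ENNReal.rpow_mul] at h2
    norm_num at h2
    have h3 : b ⟨J.length, by omega⟩ ^ 3 ≤ ∑ p, b p ^ 3 :=
      Finset.single_le_sum (f := fun p => b p ^ 3) (fun _ _ => zero_le) (Finset.mem_univ _)
    refine le_trans (lintegral_mono fun x => ?_)
      (h2.le.trans (by exact_mod_cast ENNReal.coe_le_coe.2 h3))
    have := ENNReal.rpow_le_rpow (hle (divCurvature A) J l x) (z := 3) (by norm_num)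
    simpa using this

/-- The inequality, with the constant still chosen for each family of curvature norms. -/
theorem exists_sobolevNorm_le (σ : ℝ) (hσ₀ : 0 < σ) (hσ₁ : σ ≤ 1) {n : ℕ} (hn : 2 ≤ n)
    (a b : Fin (curvatureOrder n + 1) → ℝ≥0) :
    ∃ C : ℝ≥0, ∀ A : Fin 3 → R3 → 𝔤, LocalAssumptions n A →
      (∀ p : Fin (curvatureOrder n + 1), curvatureNorm σ A p = a p) →
      (∀ p : Fin (curvatureOrder n + 1), divCurvatureNorm σ A p = b p) →
      ∀ Φ : R3 → 𝔤, ContDiff ℝ (n + 1 : ℕ) Φ → HasCompactSupport Φ →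
        sobolevNorm σ A n Φ ≤ C * (sobolevNorm σ A (n - 1) Φ + laplacianNorm σ A n Φ) := by
  obtain ⟨C, hC⟩ := exists_sobolevSq_le (𝔤 := 𝔤) σ hσ₀ hσ₁ hn (∑ p, a p) (∑ p, b p ^ 3)
  refine ⟨C ^ (1 / 2 : ℝ), fun A hloc ha hb Φ hΦ hc => ?_⟩
  have hA := hloc.regPotential hn
  have hΦr : Reg (potentialExp n) (max n 3) Φ :=
    reg_of_contDiff (hΦ.of_le (by exact_mod_cast max_le (Nat.le_succ n) (by omega)))
  obtain ⟨R, hR⟩ := hc.isCompact.isBounded.subset_closedBall (0 : R3)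
  have hv : VanishesOff R Φ := Eventually.of_forall fun x hx =>
    image_eq_zero_of_notMem_tsupport fun hx' => by
      have := hR hx'
      rw [mem_closedBall_zero_iff] at this
      linarith
  rw [hA.sobolevNorm_eq σ (le_max_left _ _) hΦr,
    hA.sobolevNorm_eq σ ((Nat.sub_le n 1).trans (le_max_left _ _)) hΦr,
    hA.laplacianNorm_eq σ (le_max_left _ _) hΦr]
  refine (ENNReal.rpow_le_rpow (hC hA (curvatureBounds_of_norms σ A ha hb) hΦr hv)
    (by norm_num)).trans ?_
  rw [ENNReal.mul_rpow_of_nonneg _ _ (by norm_num), ENNReal.coe_rpow_of_nonneg _ (by norm_num)]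
  gcongr
  exact ENNReal.rpow_add_le_add_rpow _ _ (by norm_num) (by norm_num)

end Norms

end CovariantPoisson

theorem proposition3p1 {𝔤 : Type*} [CovariantPoisson.NormedLieRing 𝔤]
    [CovariantPoisson.CompactLieAlgebra 𝔤] (σ : ℝ) (hσ₀ : 0 < σ) (hσ₁ : σ ≤ 1)
    (n : ℕ) (hn : 2 ≤ n) :
    ∃ C : (Fin (CovariantPoisson.curvatureOrder n + 1) → ℝ≥0) →
        (Fin (CovariantPoisson.curvatureOrder n + 1) → ℝ≥0) → ℝ≥0,
      ∀ A : Fin 3 → CovariantPoisson.R3 → 𝔤, CovariantPoisson.LocalAssumptions n A →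
      ∀ a b : Fin (CovariantPoisson.curvatureOrder n + 1) → ℝ≥0,
        (∀ p : Fin (CovariantPoisson.curvatureOrder n + 1), CovariantPoisson.curvatureNorm σ A p = a p) →
        (∀ p : Fin (CovariantPoisson.curvatureOrder n + 1), CovariantPoisson.divCurvatureNorm σ A p = b p) →
      ∀ Φ : CovariantPoisson.R3 → 𝔤, ContDiff ℝ (n + 1 : ℕ) Φ → HasCompactSupport Φ →
        CovariantPoisson.sobolevNorm σ A n Φ ≤
          C a b * (CovariantPoisson.sobolevNorm σ A (n - 1) Φ +
            CovariantPoisson.laplacianNorm σ A n Φ) := by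
  choose C hC using CovariantPoisson.exists_sobolevNorm_le (𝔤 := 𝔤) σ hσ₀ hσ₁ hn
  exact ⟨C, fun A hA a b ha hb => hC a b A hA ha hb⟩
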